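/- Let $\mathrm{Sch}_{\mathbb C}$ be the category of schemes $X$ locally of finite type over $\mathbb{C}$ whose connected components are quasi-compact and in which every finite set of points lies in an affine open subset (for example, all $X$ locally of finite type with quasi-projective connected components). For $n\in\mathbb N$, $\mathrm{Sym}^n(X)=X^n/\!/S_n$ denotes the (categorical) quotient of $X^n$ by the symmetric group in $\mathrm{Sch}_{\mathbb C}$, and $\oplus:\mathrm{Sym}^l(X)\times\mathrm{Sym}^{m}(X)\to\mathrm{Sym}^{l+m}(X)$ the map induced by concatenation. A *motivic theory* $R$ assigns to every $X\in \mathrm{Sch}_{\mathbb C}$ an abelian group $R(X)$, with functorial pull-back homomorphisms $u^*:R(Y)\to R(X)$ for all $u:X\to Y$, functorial push-forward homomorphisms $u_!:R(X)\to R(Y)$ for all $u$ of finite type, a biadditive, associative, symmetric exterior product $\boxtimes:R(X)\times R(Y)\to R(X\times Y)$ with unit $1\in R(\mathrm{Spec}\,\mathbb C)$, and maps $\sigma^n:R(X)\to R(\mathrm{Sym}^n(X))$ for $n\in\mathbb N$ with $\sigma^n(1)=1$, such that: (i) restriction to the connected components $X_i$ of $X$ is an isomorphism $R(X)\to\prod_i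 R(X_i)$; (ii) for every cartesian square with $\tilde u:X\times_ZY\to Y$, $\tilde v:X\times_ZY\to X$ the base changes of $u:X\to Z$, $v:Y\to Z$, and $u$ of finite type, $\tilde u_!\tilde v^*=v^*u_!$; (iii) $(u\times v)^*(a\boxtimes b)=u^*(a)\boxtimes v^*(b)$, and for $u,v$ of finite type $(u\times v)_!(a\boxtimes b)=u_!(a)\boxtimes v_!(b)$ and $\mathrm{Sym}^n(u)_!(\sigma^n(a))=\sigma^n(u_!(a))$; (iv) $\sigma^n(a+b)=\sum_{l=0}^n\oplus_!(\sigma^l(a)\boxtimes\sigma^{n-l}(b))$, $\sigma^0(a)=1$ and $\sigma^1(a)=a$ for $a,b\in R(X)$; (v) for every closed subscheme $i:Z\hookrightarrow X$ with open complement $j:X\setminus Z\hookrightarrow X$: $i^*i_!=\mathrm{id}$, $j^*j_!=\mathrm{id}$, $j^*i_!=0$, $i^*j_!=0$, and $a=i_!i^*(a)+j_!j^*(a)$ for all $a\in R(X)$; (vi) $\sigma^n(\mathbb 1_X)=\mathbb 1_{\mathrm{Sym}^n(X)}$, where $\mathbb 1_X=(X\to\mathrm{Spec}\,\mathbb C)^*(1)$.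 A *morphism* $\eta:R\to R'$ of motivic theories is a collection of group homomorphisms $\eta_X:R(X)\to R'(X)$ commuting with pull-backs, push-forwards and exterior products, and preserving the unit $1$; it is a *$\lambda$-morphism* if it also commutes with all $\sigma^n$. For $X\in\mathrm{Sch}_{\mathbb C}$ let $K_0(\mathrm{Sch}_X)$ be the abelian group generated by the isomorphism classes $[V\to X]$ of morphisms of finite type with $V\in\mathrm{Sch}_{\mathbb C}$, modulo $[V\to X]=[Z\to X]+[V\setminus Z\to X]$ for all closed subschemes $Z\subseteq V$. Put $\underline{K}_0(\mathrm{Sch}_X)=\prod_{X_i\in\pi_0(X)}K_0(\mathrm{Sch}_{X_i})$, and write $[V\to X]\in\underline{K}_0(\mathrm{Sch}_X)$ for the family $([V\times_XX_i\to X_i])_i$. **Lemma.** The quotients $\mathrm{Sym}^n(X)$ exist in $\mathrm{Sch}_{\mathbb C}$ for all $X\in\mathrm{Sch}_{\mathbb C}$ and $n\in\mathbb N$, and $X\mapsto\underline{K}_0(\mathrm{Sch}_X)$ carries the structure of a motivic theory satisfying $$1=[\mathrm{Spec}\,\mathbb C\xrightarrow{\mathrm{id}}\mathrm{Spec}\,\mathbb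 C],\quad u^*[W\to Y]=[X\times_YW\to X],\quad u_![V\xrightarrow{v}X]=[V\xrightarrow{uv}Y],$$ $$[V\xrightarrow{v}X]\boxtimes[W\xrightarrow{w}Y]=[V\times W\xrightarrow{v\times w}X\times Y],\quad \sigma^n[V\to X]=[\mathrm{Sym}^n(V)\to\mathrm{Sym}^n(X)].$$ This motivic theory $\underline{K}_0(\mathrm{Sch})$ is an initial object in the category of motivic theories: for every motivic theory $R$ there is exactly one morphism $\underline{K}_0(\mathrm{Sch})\to R$. Moreover, this unique morphism is a $\lambda$-morphism. -/

import Mathlib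

open CategoryTheory CategoryTheory.Limits AlgebraicGeometry

universe v w

noncomputable section

namespace Motivic

/-- The schemes over `ℂ` on which motivic theories live: locally of finite type over `ℂ`, with
quasi-compact (hence finite type) connected components, and such that every finite set of points
lies in an affine open subset. The last condition holds for instance if all connected components
are quasi-projective; it implies separatedness, and it is what makes the quotients `X^n // S_n`
exist as schemes. -/
def IsAdmissible : ObjectProperty (Over (Spec (.of ℂ))) := fun X =>
  LocallyOfFiniteType X.hom ∧
  (∀ x : X.left, IsCompact (connectedComponent x)) ∧
  (∀ s : Set X.left, s.Finite → ∃ U : X.left.Opens, IsAffineOpen U ∧ s ⊆ (U : Set X.left))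

/-- The category of admissible schemes over `ℂ`, with all morphisms over `ℂ`. -/
abbrev CSch : Type 1 := IsAdmissible.FullSubcategory

namespace CSch

/-- The underlying scheme. -/
abbrev toScheme (X : CSch) : Scheme.{0} := X.obj.left

instance (X : CSch) : LocallyOfFiniteType X.obj.hom := X.property.1

instance (X : CSch) : IsLocallyNoetherian X.toScheme :=
  LocallyOfFiniteType.isLocallyNoetherian X.obj.hom

end CSch

/-- The underlying morphism of schemes. -/
abbrev mor {X Y : CSch} (u : X ⟶ Y) : X.toScheme ⟶ Y.toScheme := u.hom.left

instance {X Y : CSch} (u : X ⟶ Y) : LocallyOfFiniteType (mor u) := by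
  have : LocallyOfFiniteType (mor u ≫ Y.obj.hom) := by
    rw [show mor u ≫ Y.obj.hom = X.obj.hom from Over.w u.hom]; infer_instance
  exact locallyOfFiniteType_of_comp _ Y.obj.hom

theorem isOpen_connectedComponent_of_noetherian {α : Type*} [TopologicalSpace α]
    [TopologicalSpace.NoetherianSpace α] (x : α) : IsOpen (connectedComponent x) := by
  have hfin : Finite (ConnectedComponents α) := by
    have := (TopologicalSpace.NoetherianSpace.finite_irreducibleComponents (α := α)).to_subtype
    refine Finite.of_surjective
      (fun Z : irreducibleComponents α => ConnectedComponents.mk (Z.2.1.1.some : α)) ?_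
    intro c
    obtain ⟨y, rfl⟩ := ConnectedComponents.surjective_coe c
    refine ⟨⟨irreducibleComponent y, irreducibleComponent_mem_irreducibleComponents y⟩, ?_⟩
    rw [ConnectedComponents.coe_eq_coe']
    refine (isIrreducible_irreducibleComponent (x := y)).2.isPreconnected.subset_connectedComponent
      mem_irreducibleComponent (Set.Nonempty.some_mem _)
  have h : (connectedComponent x)ᶜ =
      ⋃ c ∈ {c : ConnectedComponents α | c ≠ ConnectedComponents.mk x},
        ConnectedComponents.mk ⁻¹' {c} := by
    ext y
    simp only [Set.mem_compl_iff, Set.mem_ofPred_eq, Set.mem_iUnion, Set.mem_preimage,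
      Set.mem_singleton_iff, exists_prop, exists_eq_right', ne_eq, ConnectedComponents.coe_eq_coe']
  rw [← isClosed_compl_iff, h]
  refine Set.Finite.isClosed_biUnion (Set.toFinite _) fun c _ => ?_
  obtain ⟨y, rfl⟩ := ConnectedComponents.surjective_coe c
  rw [connectedComponents_preimage_singleton]
  exact isClosed_connectedComponent

theorem isOpen_connectedComponent_of_locallyNoetherian {X : Scheme.{0}} [IsLocallyNoetherian X]
    (x : X) : IsOpen (connectedComponent x) := by
  rw [isOpen_iff_mem_nhds]
  intro y hy
  obtain ⟨_, ⟨W', hW, rfl⟩, hyW, -⟩ :=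
    X.isBasis_affineOpens.exists_subset_of_mem_open (Set.mem_univ y) isOpen_univ
  let W : X.Opens := W'
  have : IsNoetherianRing Γ(X, W) := IsLocallyNoetherian.component_noetherian ⟨W, hW⟩
  have : TopologicalSpace.NoetherianSpace W.toScheme := noetherianSpace_of_isAffineOpen W hW
  have ho := W.ι.isOpenEmbedding.isOpenMap _
    (isOpen_connectedComponent_of_noetherian (α := W.toScheme) ⟨y, hyW⟩)
  refine Filter.mem_of_superset (ho.mem_nhds ⟨_, mem_connectedComponent, rfl⟩) ?_
  rw [connectedComponent_eq hy]
  exact (isPreconnected_connectedComponent.image _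
    W.ι.continuous.continuousOn).subset_connectedComponent ⟨_, mem_connectedComponent, rfl⟩

theorem isAdmissible_pt : IsAdmissible (Over.mk (𝟙 (Spec (.of ℂ)))) :=
  ⟨inferInstanceAs (LocallyOfFiniteType (𝟙 (Spec (.of ℂ)))),
    fun _ => isClosed_connectedComponent.isCompact (X := (Spec (.of ℂ))),
    fun _ _ => ⟨⊤, isAffineOpen_top (Spec (.of ℂ)), fun _ _ => trivial⟩⟩

/-- `Spec ℂ` as an object of `CSch`. -/
def pt : CSch := ⟨Over.mk (𝟙 _), isAdmissible_pt⟩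

theorem isAdmissible_restrict (X : CSch) (U : X.toScheme.Opens) (hU : IsClosed (U : Set X.toScheme)) :
    IsAdmissible (Over.mk (U.ι ≫ X.obj.hom)) := by
  have hc : IsClosedImmersion U.ι := .of_isPreimmersion _ (by simpa using hU)
  refine ⟨inferInstanceAs (LocallyOfFiniteType (U.ι ≫ X.obj.hom)), ?_, ?_⟩
  · intro (x : U.toScheme)
    change IsCompact (connectedComponent x)
    have hce : Topology.IsClosedEmbedding (U.ι) := hc.isClosedEmbedding
    rw [hce.isEmbedding.isCompact_iff]
    refine (X.property.2.1 (U.ι x)).of_isClosed_subset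
      (hce.isClosedMap _ isClosed_connectedComponent) ?_
    exact (isPreconnected_connectedComponent.image _
      U.ι.continuous.continuousOn).subset_connectedComponent ⟨_, mem_connectedComponent, rfl⟩
  · intro s hs
    obtain ⟨W, hW, hsW⟩ := X.property.2.2 (U.ι '' s) (hs.image _)
    exact ⟨U.ι ⁻¹ᵁ W, hW.preimage U.ι, fun x hx => hsW ⟨x, hx, rfl⟩⟩

theorem isAdmissible_prod (X Y : CSch) :
    IsAdmissible (Over.mk (pullback.fst X.obj.hom Y.obj.hom ≫ X.obj.hom)) := by
  have key : ∀ {U : X.toScheme.Opens} {V : Y.toScheme.Opens}, IsAffineOpen U → IsAffineOpen V →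
      IsAffineOpen (pullback.fst X.obj.hom Y.obj.hom ⁻¹ᵁ U ⊓
        pullback.snd X.obj.hom Y.obj.hom ⁻¹ᵁ V) := by
    intro U V hU hV
    have : IsAffine U.toScheme := hU
    have : IsAffine V.toScheme := hV
    let p : pullback (U.ι ≫ X.obj.hom) (V.ι ≫ Y.obj.hom) ⟶ pullback X.obj.hom Y.obj.hom :=
      pullback.map _ _ _ _ U.ι V.ι (𝟙 _) (by simp) (by simp)
    have hp : IsOpenImmersion p := by dsimp only [p]; infer_instance
    have : IsAffine (pullback (U.ι ≫ X.obj.hom) (V.ι ≫ Y.obj.hom)) :=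
      inferInstanceAs (IsAffine (pullback (Z := Spec (.of ℂ)) (U.ι ≫ X.obj.hom) (V.ι ≫ Y.obj.hom)))
    have h := isAffineOpen_opensRange p
    convert h
    ext1
    simp [p, Scheme.Pullback.range_map]
  refine ⟨?_, ?_, ?_⟩
  · change LocallyOfFiniteType (pullback.fst X.obj.hom Y.obj.hom ≫ X.obj.hom)
    infer_instance
  · intro (z : ↥(pullback X.obj.hom Y.obj.hom))
    change IsCompact (connectedComponent z)
    have cov : ∀ (Z : CSch) (w : Z.toScheme), ∃ S : Set Z.toScheme.Opens, S.Finite ∧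
        (∀ U ∈ S, IsAffineOpen U) ∧ connectedComponent w ⊆ ⋃ U ∈ S, (U : Set Z.toScheme) := by
      intro Z w
      obtain ⟨t, ht⟩ := (Z.property.2.1 w).elim_finite_subcover
        (fun U : Z.toScheme.affineOpens => ((U : Z.toScheme.Opens) : Set Z.toScheme))
        (fun U => U.1.isOpen) (fun y _ => by
          obtain ⟨_, ⟨W, hW, rfl⟩, hyW, -⟩ :=
            Z.toScheme.isBasis_affineOpens.exists_subset_of_mem_open (Set.mem_univ y) isOpen_univ
          exact Set.mem_iUnion.2 ⟨⟨W, hW⟩, hyW⟩)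
      refine ⟨Subtype.val '' (t : Set Z.toScheme.affineOpens), t.finite_toSet.image _, ?_, ?_⟩
      · rintro _ ⟨U, -, rfl⟩; exact U.2
      · intro y hy
        obtain ⟨U, hU, hyU⟩ := Set.mem_iUnion₂.1 (ht hy)
        exact Set.mem_iUnion₂.2 ⟨U.1, ⟨U, hU, rfl⟩, hyU⟩
    obtain ⟨S, hSf, hSa, hS⟩ := cov X (pullback.fst X.obj.hom Y.obj.hom z)
    obtain ⟨T, hTf, hTa, hT⟩ := cov Y (pullback.snd X.obj.hom Y.obj.hom z)
    have hcomp : IsCompact (⋃ U ∈ S, ⋃ V ∈ T,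
        ((pullback.fst X.obj.hom Y.obj.hom ⁻¹ᵁ U ⊓ pullback.snd X.obj.hom Y.obj.hom ⁻¹ᵁ V :
          (pullback X.obj.hom Y.obj.hom).Opens) : Set ↥(pullback X.obj.hom Y.obj.hom))) :=
      hSf.isCompact_biUnion fun U hU => hTf.isCompact_biUnion fun V hV =>
        (key (hSa U hU) (hTa V hV)).isCompact
    refine hcomp.of_isClosed_subset isClosed_connectedComponent fun y hy => ?_
    have h1 := hS ((isPreconnected_connectedComponent.image _
      (pullback.fst X.obj.hom Y.obj.hom).continuous.continuousOn).subset_connectedComponent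
        ⟨_, mem_connectedComponent, rfl⟩ ⟨y, hy, rfl⟩)
    have h2 := hT ((isPreconnected_connectedComponent.image _
      (pullback.snd X.obj.hom Y.obj.hom).continuous.continuousOn).subset_connectedComponent
        ⟨_, mem_connectedComponent, rfl⟩ ⟨y, hy, rfl⟩)
    obtain ⟨U, hU, hyU⟩ := Set.mem_iUnion₂.1 h1
    obtain ⟨V, hV, hyV⟩ := Set.mem_iUnion₂.1 h2
    exact Set.mem_iUnion₂.2 ⟨U, hU, Set.mem_iUnion₂.2 ⟨V, hV, hyU, hyV⟩⟩
  · intro (s : Set ↥(pullback X.obj.hom Y.obj.hom)) hs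
    obtain ⟨U, hU, hsU⟩ := X.property.2.2 (pullback.fst X.obj.hom Y.obj.hom '' s) (hs.image _)
    obtain ⟨V, hV, hsV⟩ := Y.property.2.2 (pullback.snd X.obj.hom Y.obj.hom '' s) (hs.image _)
    exact ⟨_, key hU hV, fun x hx => ⟨hsU ⟨x, hx, rfl⟩, hsV ⟨x, hx, rfl⟩⟩⟩

/-- The product `X ×_ℂ Y`, with its projections, is a product in `CSch`. -/
def prodFan (X Y : CSch) : BinaryFan X Y :=
  BinaryFan.mk (P := (⟨_, isAdmissible_prod X Y⟩ : CSch))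
    (ObjectProperty.homMk (Over.homMk (pullback.fst X.obj.hom Y.obj.hom) rfl))
    (ObjectProperty.homMk (Over.homMk (pullback.snd X.obj.hom Y.obj.hom) pullback.condition.symm))

def prodFanIsLimit (X Y : CSch) : IsLimit (prodFan X Y) :=
  BinaryFan.isLimitMk
    (fun s => ObjectProperty.homMk (Over.homMk
      (pullback.lift (mor s.fst) (mor s.snd) ((Over.w s.fst.hom).trans (Over.w s.snd.hom).symm))
      ((pullback.lift_fst_assoc _ _ _ _).trans (Over.w s.fst.hom))))
    (fun s => by
      apply ObjectProperty.hom_ext; apply Over.OverMorphism.ext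
      exact pullback.lift_fst _ _ _)
    (fun s => by
      apply ObjectProperty.hom_ext; apply Over.OverMorphism.ext
      exact pullback.lift_snd _ _ _)
    (fun s m h₁ h₂ => by
      apply ObjectProperty.hom_ext; apply Over.OverMorphism.ext
      apply pullback.hom_ext
      · exact (congrArg mor h₁).trans (pullback.lift_fst _ _ _).symm
      · exact (congrArg mor h₂).trans (pullback.lift_snd _ _ _).symm)

/-- The structure morphism `X ⟶ Spec ℂ`. -/
def toPt (X : CSch) : X ⟶ pt :=
  ObjectProperty.homMk (Over.homMk X.obj.hom (Category.comp_id _))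

def ptIsTerminal : IsTerminal pt :=
  IsTerminal.ofUniqueHom toPt fun X m => by
    apply ObjectProperty.hom_ext; apply Over.OverMorphism.ext
    exact (Category.comp_id _).symm.trans (Over.w m.hom)

instance : HasBinaryProducts CSch :=
  have : ∀ X Y : CSch, HasLimit (pair X Y) := fun X Y => ⟨⟨_, prodFanIsLimit X Y⟩⟩
  hasBinaryProducts_of_hasLimit_pair CSch

instance : HasTerminal CSch := ptIsTerminal.hasTerminal

instance : HasFiniteProducts CSch := hasFiniteProducts_of_has_binary_and_terminal

/-- Morphisms of finite type: locally of finite type and quasi-compact. -/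
def FT {X Y : CSch} (u : X ⟶ Y) : Prop := LocallyOfFiniteType (mor u) ∧ QuasiCompact (mor u)

theorem FT.id (X : CSch) : FT (𝟙 X) :=
  ⟨inferInstanceAs (LocallyOfFiniteType (𝟙 X.toScheme)),
    inferInstanceAs (QuasiCompact (𝟙 X.toScheme))⟩

theorem FT.comp {X Y Z : CSch} {u : X ⟶ Y} {v : Y ⟶ Z} (hu : FT u) (hv : FT v) : FT (u ≫ v) := by
  have := hu.1; have := hu.2; have := hv.1; have := hv.2
  exact ⟨inferInstanceAs (LocallyOfFiniteType (mor u ≫ mor v)),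
    inferInstanceAs (QuasiCompact (mor u ≫ mor v))⟩

theorem FT.of_isClosedImmersion {X Y : CSch} {u : X ⟶ Y} (h : IsClosedImmersion (mor u)) : FT u :=
  ⟨inferInstance, inferInstance⟩

theorem FT.of_isOpenImmersion {X Y : CSch} {u : X ⟶ Y} (h : IsOpenImmersion (mor u)) : FT u :=
  ⟨inferInstance, inferInstance⟩

/-- `i : Z ⟶ X` is the inclusion of a closed subscheme and `j : U ⟶ X` the inclusion of its open
complement. -/
structure IsCut {X Z U : CSch} (i : Z ⟶ X) (j : U ⟶ X) : Prop where
  closed : IsClosedImmersion (mor i)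
  isOpen : IsOpenImmersion (mor j)
  compl : Set.range (mor j) = (Set.range (mor i))ᶜ

/-- An open and closed subscheme of `X`, as an object of `CSch`. -/
def restrict (X : CSch) (U : X.toScheme.Opens) (hU : IsClosed (U : Set X.toScheme)) : CSch :=
  ⟨_, isAdmissible_restrict X U hU⟩

/-- The inclusion of an open and closed subscheme. -/
def restrictι (X : CSch) (U : X.toScheme.Opens) (hU : IsClosed (U : Set X.toScheme)) :
    restrict X U hU ⟶ X :=
  ObjectProperty.homMk (Over.homMk U.ι rfl)

/-- The set of connected components of `X`. -/
abbrev π₀ (X : CSch) := _root_.ConnectedComponents X.toScheme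

/-- A connected component of `X` as an open subset. -/
def compOpens (X : CSch) (c : π₀ X) : X.toScheme.Opens where
  carrier := ConnectedComponents.mk ⁻¹' {c}
  is_open' := by
    obtain ⟨y, rfl⟩ := ConnectedComponents.surjective_coe c
    rw [connectedComponents_preimage_singleton]
    exact isOpen_connectedComponent_of_locallyNoetherian y

theorem isClosed_compOpens (X : CSch) (c : π₀ X) :
    IsClosed (compOpens X c : Set X.toScheme) := by
  obtain ⟨y, rfl⟩ := ConnectedComponents.surjective_coe c
  change IsClosed (ConnectedComponents.mk ⁻¹' {ConnectedComponents.mk y})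
  rw [connectedComponents_preimage_singleton]
  exact isClosed_connectedComponent

/-- A connected component of `X`, as an open (and closed) subscheme. -/
def component (X : CSch) (c : π₀ X) : CSch := restrict X (compOpens X c) (isClosed_compOpens X c)

/-- The inclusion of a connected component. -/
def componentι (X : CSch) (c : π₀ X) : component X c ⟶ X := restrictι X _ _

/-- The morphism `v⁻¹(U) ⟶ U` obtained from `v : V ⟶ X` by restriction to an open and closed
`U ⊆ X`. -/
def restrictMap {V X : CSch} (v : V ⟶ X) (U : X.toScheme.Opens)
    (hU : IsClosed (U : Set X.toScheme)) :
    restrict V (mor v ⁻¹ᵁ U) (hU.preimage (mor v).continuous) ⟶ restrict X U hU :=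
  ObjectProperty.homMk (Over.homMk (mor v ∣_ U) (by
    change (mor v ∣_ U) ≫ U.ι ≫ X.obj.hom = (mor v ⁻¹ᵁ U).ι ≫ V.obj.hom
    rw [morphismRestrict_ι_assoc]
    exact congrArg _ (Over.w v.hom)))

theorem FT.restrictMap {V X : CSch} {v : V ⟶ X} (hv : FT v) (U : X.toScheme.Opens)
    (hU : IsClosed (U : Set X.toScheme)) : FT (restrictMap v U hU) := by
  have := hv.2
  exact ⟨inferInstance, inferInstanceAs (QuasiCompact (mor v ∣_ U))⟩

/-- The `n`-fold power `X^n` over `ℂ`. -/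
abbrev pow (n : ℕ) (X : CSch) : CSch := ∏ᶜ fun _ : Fin n => X

/-- The action of a permutation on `X^n`. -/
def permute {n : ℕ} (X : CSch) (τ : Equiv.Perm (Fin n)) : pow n X ⟶ pow n X :=
  Pi.lift fun i => Pi.π (fun _ : Fin n => X) (τ i)

/-- The morphism `u^n : X^n ⟶ Y^n`. -/
def powMap (n : ℕ) {X Y : CSch} (u : X ⟶ Y) : pow n X ⟶ pow n Y :=
  Pi.lift fun i => Pi.π (fun _ : Fin n => X) i ≫ u

theorem permute_powMap {n : ℕ} {X Y : CSch} (u : X ⟶ Y) (τ : Equiv.Perm (Fin n)) :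
    permute X τ ≫ powMap n u = powMap n u ≫ permute Y τ := by
  apply Pi.hom_ext
  intro i
  simp [permute, powMap]

/-- An `n`-th symmetric power of `X`: an object `Sym^n(X) = X^n // S_n` together with a morphism
`X^n ⟶ Sym^n(X)` which is the categorical quotient of `X^n` by the symmetric group. It is unique
up to unique isomorphism. -/
structure SymPow (n : ℕ) (X : CSch) where
  obj : CSch
  proj : pow n X ⟶ obj
  invariant : ∀ τ : Equiv.Perm (Fin n), permute X τ ≫ proj = proj
  existsUnique_desc : ∀ {T : CSch} (f : pow n X ⟶ T),
    (∀ τ : Equiv.Perm (Fin n), permute X τ ≫ f = f) → ∃! g : obj ⟶ T, proj ≫ g = f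

theorem SymPow.map_aux {n : ℕ} {X Y : CSch} (T : SymPow n Y) (u : X ⟶ Y)
    (τ : Equiv.Perm (Fin n)) :
    permute X τ ≫ powMap n u ≫ T.proj = powMap n u ≫ T.proj := by
  rw [← Category.assoc, permute_powMap, Category.assoc, T.invariant]

/-- The morphism `Sym^n(u) : Sym^n(X) ⟶ Sym^n(Y)`: the unique morphism through which
`X^n ⟶ Y^n ⟶ Sym^n(Y)` factors. -/
def SymPow.map {n : ℕ} {X Y : CSch} (S : SymPow n X) (T : SymPow n Y) (u : X ⟶ Y) :
    S.obj ⟶ T.obj :=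
  (S.existsUnique_desc (powMap n u ≫ T.proj) (T.map_aux u)).choose

/-- The concatenation isomorphism `X^l × X^m ⟶ X^n`, where `l + m = n`. -/
def concat {l m n : ℕ} (h : l + m = n) (X : CSch) : pow l X ⨯ pow m X ⟶ pow n X :=
  Pi.lift fun k : Fin n =>
    if hk : (k : ℕ) < l then prod.fst ≫ Pi.π (fun _ : Fin l => X) ⟨k, hk⟩
    else prod.snd ≫ Pi.π (fun _ : Fin m => X) ⟨k - l, by omega⟩

/-- `c` is the addition morphism `⊕ : Sym^l(X) × Sym^m(X) ⟶ Sym^n(X)`, `l + m = n`, i.e. the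
morphism induced by the concatenation `X^l × X^m ⟶ X^n`. -/
def IsSymAdd {l m n : ℕ} (h : l + m = n) {X : CSch} (S : SymPow l X) (T : SymPow m X)
    (P : SymPow n X) (c : S.obj ⨯ T.obj ⟶ P.obj) : Prop :=
  prod.map S.proj T.proj ≫ c = concat h X ≫ P.proj

/-- The structure of a motivic theory on a family of abelian groups `R X`: pull-backs `pull`,
push-forwards `push` along morphisms of finite type, a biadditive exterior product `ext` with unit
`one`, and operations `sigma : R X → R (Sym^n X)`. The operations are given for every model of
the symmetric power; different models are compatible by `push_sigma` for the identity of `X`.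
The hypotheses of the form `FT (S.map T u)`, `FT (prod.map u v)`, ... only supply the argument which
push-forward needs. -/
structure MotivicStructure (R : CSch → Type v) [∀ X, AddCommGroup (R X)] where
  pull : ∀ {X Y : CSch}, (X ⟶ Y) → (R Y →+ R X)
  push : ∀ {X Y : CSch} (u : X ⟶ Y), FT u → (R X →+ R Y)
  one : R pt
  ext : ∀ {X Y : CSch}, R X →+ R Y →+ R (X ⨯ Y)
  sigma : ∀ {n : ℕ} {X : CSch} (S : SymPow n X), R X → R S.obj
  -- functoriality of pull-backs and push-forwards
  pull_id : ∀ {X : CSch} (a : R X), pull (𝟙 X) a = a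
  pull_comp : ∀ {X Y Z : CSch} (u : X ⟶ Y) (v : Y ⟶ Z) (a : R Z),
    pull (u ≫ v) a = pull u (pull v a)
  push_id : ∀ {X : CSch} (a : R X), push (𝟙 X) (FT.id X) a = a
  push_comp : ∀ {X Y Z : CSch} (u : X ⟶ Y) (v : Y ⟶ Z) (hu : FT u) (hv : FT v) (a : R X),
    push (u ≫ v) (hu.comp hv) a = push v hv (push u hu a)
  -- the exterior product is associative and symmetric, with unit `one`
  ext_assoc : ∀ {X Y Z : CSch} (a : R X) (b : R Y) (c : R Z),
    pull (prod.associator X Y Z).hom (ext a (ext b c)) = ext (ext a b) c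
  ext_symm : ∀ {X Y : CSch} (a : R X) (b : R Y), pull (prod.braiding Y X).hom (ext a b) = ext b a
  ext_one : ∀ {X : CSch} (a : R X), pull (prod.lift (𝟙 X) (toPt X)) (ext a one) = a
  -- `σ^n(1) = 1`
  sigma_one : ∀ {n : ℕ} (S : SymPow n pt), sigma S one = pull (toPt S.obj) one
  -- `R X` is the product of the groups of the connected components of `X`
  pull_component_bijective : ∀ X : CSch,
    Function.Bijective fun (a : R X) (c : π₀ X) => pull (componentι X c) a
  -- base change for cartesian squares
  base_change : ∀ {P X Y Z : CSch} {v' : P ⟶ X} {u' : P ⟶ Y} {u : X ⟶ Z} {v : Y ⟶ Z},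
    IsPullback v' u' u v → ∀ (hu : FT u) (hu' : FT u') (a : R X),
      push u' hu' (pull v' a) = pull v (push u hu a)
  -- compatibility of the exterior product and of `σ^n` with pull-backs and push-forwards
  pull_ext : ∀ {X X' Y Y' : CSch} (u : X ⟶ X') (v : Y ⟶ Y') (a : R X') (b : R Y'),
    pull (prod.map u v) (ext a b) = ext (pull u a) (pull v b)
  push_ext : ∀ {X X' Y Y' : CSch} (u : X ⟶ X') (v : Y ⟶ Y') (hu : FT u) (hv : FT v)
    (huv : FT (prod.map u v)) (a : R X) (b : R Y),
    push (prod.map u v) huv (ext a b) = ext (push u hu a) (push v hv b)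
  push_sigma : ∀ {n : ℕ} {X Y : CSch} (S : SymPow n X) (T : SymPow n Y) (u : X ⟶ Y) (hu : FT u)
    (hSu : FT (S.map T u)) (a : R X), push (S.map T u) hSu (sigma S a) = sigma T (push u hu a)
  -- `σ^n(a + b) = ∑ σ^l(a) σ^(n-l)(b)`, with the convolution product; `σ^0(a) = 1`, `σ^1(a) = a`
  sigma_add : ∀ {n : ℕ} {X : CSch} (S : ∀ l : ℕ, SymPow l X)
    (s : ∀ l : Fin (n + 1), (S l).obj ⨯ (S (n - l)).obj ⟶ (S n).obj)
    (_ : ∀ l : Fin (n + 1),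
      IsSymAdd (Nat.add_sub_of_le (Nat.le_of_lt_succ l.2)) (S l) (S (n - l)) (S n) (s l))
    (hs : ∀ l, FT (s l)) (a b : R X),
    sigma (S n) (a + b) = ∑ l, push (s l) (hs l) (ext (sigma (S l) a) (sigma (S (n - l)) b))
  sigma_zero : ∀ {X : CSch} (S : SymPow 0 X) (a : R X), sigma S a = pull (toPt S.obj) one
  sigma_single : ∀ {X : CSch} (S : SymPow 1 X) (a : R X),
    pull (Pi.lift (fun _ : Fin 1 => 𝟙 X) ≫ S.proj) (sigma S a) = a
  -- the motivic property
  cut_closed : ∀ {X Z U : CSch} {i : Z ⟶ X} {j : U ⟶ X} (h : IsCut i j) (a : R Z),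
    pull i (push i (.of_isClosedImmersion h.closed) a) = a ∧
      pull j (push i (.of_isClosedImmersion h.closed) a) = 0
  cut_open : ∀ {X Z U : CSch} {i : Z ⟶ X} {j : U ⟶ X} (h : IsCut i j) (a : R U),
    pull j (push j (.of_isOpenImmersion h.isOpen) a) = a ∧
      pull i (push j (.of_isOpenImmersion h.isOpen) a) = 0
  cut_add : ∀ {X Z U : CSch} {i : Z ⟶ X} {j : U ⟶ X} (h : IsCut i j) (a : R X),
    a = push i (.of_isClosedImmersion h.closed) (pull i a) +
      push j (.of_isOpenImmersion h.isOpen) (pull j a)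
  -- `σ^n(1_X) = 1_{Sym^n(X)}`, where `1_X` is the pull-back of the unit
  sigma_unit : ∀ {n : ℕ} {X : CSch} (S : SymPow n X),
    sigma S (pull (toPt X) one) = pull (toPt S.obj) one

/-- A motivic theory with values in abelian groups in `Type v`. -/
structure MotivicTheory where
  obj : CSch → Type v
  [group : ∀ X, AddCommGroup (obj X)]
  str : MotivicStructure obj

attribute [instance] MotivicTheory.group

/-- A morphism of motivic theories: group homomorphisms commuting with pull-backs, push-forwards and
exterior products, including the unit of the exterior product. -/
@[ext]
structure MotivicTheory.Hom (R : MotivicTheory.{v}) (R' : MotivicTheory.{w}) where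
  app : ∀ X : CSch, R.obj X →+ R'.obj X
  pull : ∀ {X Y : CSch} (u : X ⟶ Y) (a : R.obj Y),
    app X (R.str.pull u a) = R'.str.pull u (app Y a)
  push : ∀ {X Y : CSch} (u : X ⟶ Y) (hu : FT u) (a : R.obj X),
    app Y (R.str.push u hu a) = R'.str.push u hu (app X a)
  ext_app : ∀ {X Y : CSch} (a : R.obj X) (b : R.obj Y),
    app (X ⨯ Y) (R.str.ext a b) = R'.str.ext (app X a) (app Y b)
  one : app pt R.str.one = R'.str.one

/-- A `λ`-morphism: a morphism which also commutes with the operations `σ^n`. -/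
def MotivicTheory.Hom.IsLambda {R : MotivicTheory.{v}} {R' : MotivicTheory.{w}}
    (η : R.Hom R') : Prop :=
  ∀ {n : ℕ} {X : CSch} (S : SymPow n X) (a : R.obj X),
    η.app S.obj (R.str.sigma S a) = R'.str.sigma S (η.app X a)

/-- The category of motivic theories. -/
instance : Category MotivicTheory.{v} where
  Hom R R' := R.Hom R'
  id R := ⟨fun X => AddMonoidHom.id _, fun _ _ => rfl, fun _ _ _ => rfl, fun _ _ => rfl, rfl⟩
  comp f g := ⟨fun X => (g.app X).comp (f.app X),
    fun u a => by simp [f.pull, g.pull], fun u hu a => by simp [f.push, g.push],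
    fun a b => by simp [f.ext_app, g.ext_app], by simp [f.one, g.one]⟩

/-- A morphism of finite type `V ⟶ X`, with `V` in `CSch`. -/
structure FTOver (X : CSch) where
  dom : CSch
  hom : dom ⟶ X
  ft : FT hom

/-- The relations of the relative Grothendieck group: isomorphic `V ⟶ X` and `V' ⟶ X` are identified,
and `[V ⟶ X] = [Z ⟶ X] + [V \ Z ⟶ X]` for every closed subscheme `Z` of `V`. -/
inductive K0Rel (X : CSch) : FreeAbelianGroup (FTOver X) → Prop
  | iso {V V' : CSch} (v : V ⟶ X) (hv : FT v) (v' : V' ⟶ X) (hv' : FT v') (e : V ≅ V')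
      (h : v = e.hom ≫ v') : K0Rel X (.of ⟨V, v, hv⟩ - .of ⟨V', v', hv'⟩)
  | cut {V Z U : CSch} (v : V ⟶ X) (hv : FT v) (i : Z ⟶ V) (j : U ⟶ V) (h : IsCut i j) :
      K0Rel X (.of ⟨V, v, hv⟩ - .of ⟨Z, i ≫ v, (FT.of_isClosedImmersion h.closed).comp hv⟩ -
        .of ⟨U, j ≫ v, (FT.of_isOpenImmersion h.isOpen).comp hv⟩)

/-- The relative Grothendieck group `K_0(Sch_X)`. -/
def K0 (X : CSch) : Type 1 :=
  FreeAbelianGroup (FTOver X) ⧸ AddSubgroup.closure {r | K0Rel X r}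

instance (X : CSch) : AddCommGroup (K0 X) :=
  inferInstanceAs (AddCommGroup (FreeAbelianGroup (FTOver X) ⧸ AddSubgroup.closure {r | K0Rel X r}))

/-- The class `[V ⟶ X]` in `K_0(Sch_X)`. -/
def K0.cls {V X : CSch} (v : V ⟶ X) (hv : FT v) : K0 X :=
  QuotientAddGroup.mk (FreeAbelianGroup.of ⟨V, v, hv⟩)

/-- The completed relative Grothendieck group: the product of the groups `K_0(Sch_{X_i})` over the
connected components `X_i` of `X`. -/
def K0Bar (X : CSch) : Type 1 := ∀ c : π₀ X, K0 (component X c)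

instance (X : CSch) : AddCommGroup (K0Bar X) :=
  inferInstanceAs (AddCommGroup (∀ c : π₀ X, K0 (component X c)))

/-- The class `[V ⟶ X]` in the completed group: the family of the classes `[V ×_X X_i ⟶ X_i]`. -/
def K0Bar.cls {V X : CSch} (v : V ⟶ X) (hv : FT v) : K0Bar X := fun c =>
  K0.cls (restrictMap v (compOpens X c) (isClosed_compOpens X c)) (hv.restrictMap _ _)

/-- The structure of a motivic theory on the completed relative Grothendieck groups is the geometric
one: on classes `[V ⟶ X]`, the operations are given by base change, composition, product and
symmetric power. -/
structure IsGeometric (K : MotivicStructure K0Bar) : Prop where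
  one : K.one = K0Bar.cls (𝟙 pt) (FT.id pt)
  pull : ∀ {P W X Y : CSch} {p : P ⟶ X} {q : P ⟶ W} {u : X ⟶ Y} {w : W ⟶ Y},
    IsPullback p q u w → ∀ (hw : FT w) (hp : FT p),
      K.pull u (K0Bar.cls w hw) = K0Bar.cls p hp
  push : ∀ {V X Y : CSch} (v : V ⟶ X) (u : X ⟶ Y) (hv : FT v) (hu : FT u),
    K.push u hu (K0Bar.cls v hv) = K0Bar.cls (v ≫ u) (hv.comp hu)
  ext : ∀ {V X W Y : CSch} (v : V ⟶ X) (w : W ⟶ Y) (hv : FT v) (hw : FT w)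
    (hvw : FT (prod.map v w)),
    K.ext (K0Bar.cls v hv) (K0Bar.cls w hw) = K0Bar.cls (prod.map v w) hvw
  sigma : ∀ {n : ℕ} {V X : CSch} (v : V ⟶ X) (hv : FT v) (S : SymPow n V) (T : SymPow n X)
    (hSv : FT (S.map T v)), K.sigma T (K0Bar.cls v hv) = K0Bar.cls (S.map T v) hSv

end Motivic
end

/-! Two things have to be understood: quotients by finite groups, and why the symmetric powers
respect the scissor relations.

Quotients. If a finite group acts on an admissible scheme, every finite set of points lies in an
invariant affine open subset (intersect translates of an affine open containing all orbits,
`exists_invOpens`). Over such a subset the quotient is the spectrum of the ring of invariants, and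
these spectra glue. Positive integers are invertible, so averaging is available and taking
invariants commutes with arbitrary base change (`invariants_of_algebraIsPushout`). It is therefore
convenient to work with the affine-local notion `IsGood`: an affine invariant morphism whose
functions downstairs are the invariant functions upstairs. It is stable under base change, products
and composition. A good quotient is closed and surjective, its fibres are the orbits, and it is a
categorical quotient for separated targets. By uniqueness, every symmetric power in the categorical
sense is a good quotient (`SymPow.isGood`).

The completed Grothendieck group. Disjoint unions of arbitrary families exist among admissible
schemes, so every element of `K0Bar X` is a difference of two classes of morphisms of finite type,
even if `X` has infinitely many components (`K0Bar.exists_eq_sub`). Pull-back, push-forward and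
exterior product are additive, so their axioms only need to be checked on classes, where they are
statements about fibre products.

Symmetric powers. The operations `σ^n` are not additive. If `Z` is closed in `V` with open
complement `U`, then `Sym^n(V)` is stratified by the number `l` of coordinates lying in `Z`, and the
strata are `Sym^l(Z) × Sym^(n-l)(U)` (`exists_isCut_strata`). That these products embed as closed
subschemes of suitable open subschemes again uses averaging: an invariant function on a closed
subset extends to an invariant function (`exists_invariant_lift`). Consequently `V ↦ ([Sym^n(V)])_n`
turns scissor sums into convolution products (`symCls_cut`), that is, it is a homomorphism from `K0
X` to the multiplicative group of series with constant term `1`. It extends to the completion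
because each component of `Sym^n(X)` only involves a quasi-compact open part of `X`
(`symCls_congr`).

Universality. In every motivic theory `[V → X] = v_! [V = V]`, and `[V = V]` is a pull-back of the
unit, so a morphism must send `[V → X]` to `v_!(1_V)`; this gives uniqueness. Conversely the cut
axiom, base change and the product decomposition over components show that `v_!(1_V)` depends only
on the class and is compatible with all additive operations. For a class, compatibility with `σ^n`
is the axiom on units together with the one on push-forwards. A general element `a` satisfies `a +
[w] = [v]`, and the convolution formula determines all `σ^n(a)` from the series of `[v]` and `[w]`
(`conv_cancel`). -/

noncomputable section

namespace Motivic

/-! ### Admissible schemes -/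

/-- Prime avoidance: a finite set of points in an affine open and in an open `D` lies in an
affine open contained in `D`. -/
theorem exists_isAffineOpen_le_of_finite {X : Scheme.{0}} {W : X.Opens} (hW : IsAffineOpen W)
    (D : X.Opens) {s : Set X} (hs : s.Finite) (hsW : s ⊆ (W : Set X)) (hsD : s ⊆ (D : Set X)) :
    ∃ V : X.Opens, IsAffineOpen V ∧ s ⊆ (V : Set X) ∧ V ≤ D := by
  classical
  let p : ∀ x : X, x ∈ W → Ideal Γ(X, W) := fun x hx =>
    (IsLocalRing.maximalIdeal (X.presheaf.stalk x)).comap (X.presheaf.germ W x hx).hom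
  have hp : ∀ x (hx : x ∈ W) (f : Γ(X, W)), x ∈ X.basicOpen f ↔ f ∉ p x hx := fun x hx f => by
    rw [X.mem_basicOpen f x hx]
    simp [p]
  have hp' : ∀ x (hx : x ∈ W), (p x hx).IsPrime := fun x hx => by
    dsimp only [p]; infer_instance
  have key : ∀ x : s, ∃ f : Γ(X, W), (x : X) ∈ X.basicOpen f ∧ X.basicOpen f ≤ D := fun x => by
    obtain ⟨f, hf, hxf⟩ := hW.exists_basicOpen_le ⟨x.1, hsD x.2⟩ (hsW x.2)
    exact ⟨f, hxf, hf⟩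
  choose f hf hfD using key
  have : Finite s := hs
  have : Fintype s := Fintype.ofFinite s
  -- Each function in `I` vanishes at every point of `W` outside `D`. It remains to find a member of
  -- `I` that vanishes at no point of `s`, which is prime avoidance.
  let I : Ideal Γ(X, W) := Ideal.span (Set.range f)
  have hI : ∀ g ∈ I, X.basicOpen g ≤ D := by
    intro g hg y hy
    by_contra hyD
    have hyW : y ∈ W := X.basicOpen_le g hy
    refine (hp y hyW g).1 hy (Ideal.span_le.2 ?_ hg)
    rintro _ ⟨x, rfl⟩
    by_contra h
    exact hyD (hfD x ((hp y hyW _).2 h))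
  have hp2 : ∀ x : s, (p x.1 (hsW x.2)).IsPrime := fun x => hp' _ _
  obtain ⟨q, hq⟩ : ∃ q : s → Ideal Γ(X, W), ∀ x, q x = p x.1 (hsW x.2) := ⟨_, fun _ => rfl⟩
  simp only [← hq] at hp2
  have hne : ¬ ((I : Set Γ(X, W)) ⊆ ⋃ x ∈ (Finset.univ : Finset s), (q x : Set Γ(X, W))) := by
    by_cases hse : Nonempty s
    · obtain ⟨x₀⟩ := hse
      intro h
      obtain ⟨x, -, hx⟩ := (Ideal.subset_union_prime (s := (Finset.univ : Finset s)) x₀ x₀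
        (fun x _ _ _ => hp2 x)).1 (by simpa using h)
      exact (hp x.1 (hsW x.2) (f x)).1 (hf x) (hq x ▸ hx (Ideal.subset_span ⟨x, rfl⟩))
    -- If `s` is empty, the union of primes is empty, whereas `I` contains `0`.
    · intro h
      obtain ⟨x, -⟩ := Set.mem_iUnion.1 (h I.zero_mem)
      exact hse ⟨x⟩
  obtain ⟨g, hg, hg'⟩ := Set.not_subset.1 hne
  refine ⟨X.basicOpen g, hW.basicOpen g, fun x hx => ?_, hI g hg⟩
  refine (hp x (hsW hx) g).2 fun h => hg' ?_
  exact Set.mem_iUnion₂.2 ⟨⟨x, hx⟩, Finset.mem_univ _, (hq ⟨x, hx⟩).symm ▸ h⟩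

/-- A component of `U` maps into a component of `X`, which is a noetherian space, so that all its
subsets are compact. An affine open subset of `X` need not lie in the image of `j`; prime avoidance
shrinks it. -/
theorem isAdmissible_of_isOpenImmersion (X : CSch) {U : Scheme.{0}} (j : U ⟶ X.toScheme)
    [IsOpenImmersion j] : IsAdmissible (Over.mk (j ≫ X.obj.hom)) := by
  refine ⟨inferInstanceAs (LocallyOfFiniteType (j ≫ X.obj.hom)), ?_, ?_⟩
  · intro (x : U)
    change IsCompact (connectedComponent x)
    let C := compOpens X (ConnectedComponents.mk (j x))
    have hC : (C : Set X.toScheme) = connectedComponent (j x) :=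
      connectedComponents_preimage_singleton
    have : CompactSpace C.toScheme := by
      refine isCompact_iff_compactSpace.1 ?_
      rw [hC]
      exact X.property.2.1 _
    have : IsNoetherian C.toScheme := {}
    rw [j.isOpenEmbedding.isEmbedding.isCompact_iff]
    have hsub : j '' connectedComponent x ⊆ (C : Set X.toScheme) := by
      rw [hC]
      exact (isPreconnected_connectedComponent.image _
        j.continuous.continuousOn).subset_connectedComponent ⟨_, mem_connectedComponent, rfl⟩
    have h := (TopologicalSpace.NoetherianSpace.isCompact
      (C.ι ⁻¹' (j '' connectedComponent x))).image C.ι.continuous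
    rwa [Set.image_preimage_eq_of_subset (by simpa using hsub)] at h
  · intro s hs
    obtain ⟨W, hW, hsW⟩ := X.property.2.2 (j '' s) (hs.image _)
    obtain ⟨V, hV, hsV, hVD⟩ := exists_isAffineOpen_le_of_finite hW j.opensRange (hs.image _) hsW
      (Set.image_subset_range _ _)
    refine ⟨j ⁻¹ᵁ V, hV.preimage_of_isOpenImmersion j hVD, fun x hx => hsV ⟨x, hx, rfl⟩⟩

theorem isAdmissible_of_isAffineHom (X : CSch) {Y : Scheme.{0}} (f : Y ⟶ X.toScheme)
    [IsAffineHom f] [LocallyOfFiniteType f] : IsAdmissible (Over.mk (f ≫ X.obj.hom)) := by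
  refine ⟨inferInstanceAs (LocallyOfFiniteType (f ≫ X.obj.hom)), ?_, ?_⟩
  · intro (y : Y)
    change IsCompact (connectedComponent y)
    have hC : IsCompact (compOpens X (ConnectedComponents.mk (f y)) : Set X.toScheme) := by
      rw [show (compOpens X (ConnectedComponents.mk (f y)) : Set X.toScheme) =
        connectedComponent (f y) from connectedComponents_preimage_singleton]
      exact X.property.2.1 _
    refine (f.isCompact_preimage hC).of_isClosed_subset isClosed_connectedComponent ?_
    intro z hz
    change ConnectedComponents.mk (f z) = ConnectedComponents.mk (f y)
    rw [ConnectedComponents.coe_eq_coe']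
    exact (isPreconnected_connectedComponent.image _
      f.continuous.continuousOn).subset_connectedComponent ⟨_, mem_connectedComponent, rfl⟩
        ⟨z, hz, rfl⟩
  · intro s hs
    obtain ⟨W, hW, hsW⟩ := X.property.2.2 (f '' s) (hs.image _)
    exact ⟨f ⁻¹ᵁ W, hW.preimage f, fun x hx => hsW ⟨x, hx, rfl⟩⟩

/-- A point of the fibre product off the diagonal has both its projections in a common affine open
`V`, hence lies in the open subset `V × V`, in which the diagonal is closed because `V` is
separated. -/
theorem isSeparated_of_exists_isAffineOpen {X S : Scheme.{0}} (f : X ⟶ S) [IsAffine S]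
    (h : ∀ x y : X, ∃ U : X.Opens, IsAffineOpen U ∧ x ∈ U ∧ y ∈ U) : IsSeparated f := by
  constructor
  refine .of_isPreimmersion _ ?_
  rw [← isOpen_compl_iff, isOpen_iff_mem_nhds]
  intro z hz
  obtain ⟨V, hV, h1, h2⟩ := h (pullback.fst f f z) (pullback.snd f f z)
  have hV : IsAffine V.toScheme := hV
  let p : pullback (V.ι ≫ f) (V.ι ≫ f) ⟶ pullback f f :=
    pullback.map _ _ _ _ V.ι V.ι (𝟙 _) (by simp) (by simp)
  have hp : IsOpenImmersion p := by dsimp only [p]; infer_instance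
  have hp1 : p ≫ pullback.fst f f = pullback.fst _ _ ≫ V.ι := pullback.lift_fst _ _ _
  have hp2 : p ≫ pullback.snd f f = pullback.snd _ _ ≫ V.ι := pullback.lift_snd _ _ _
  have hd : V.ι ≫ pullback.diagonal f = pullback.diagonal (V.ι ≫ f) ≫ p := by
    apply pullback.hom_ext
    · rw [Category.assoc, Category.assoc, hp1, pullback.diagonal_fst, pullback.diagonal_fst_assoc,
        Category.comp_id]
    · rw [Category.assoc, Category.assoc, hp2, pullback.diagonal_snd, pullback.diagonal_snd_assoc,
        Category.comp_id]
  have hcl : IsClosed (Set.range (pullback.diagonal (V.ι ≫ f))) :=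
    (pullback.diagonal (V.ι ≫ f)).isClosedEmbedding.isClosed_range
  have hr : Set.range p = pullback.fst f f ⁻¹' V ∩ pullback.snd f f ⁻¹' V := by
    simp [p, Scheme.Pullback.range_map]
  obtain ⟨w, rfl⟩ : z ∈ Set.range p := by rw [hr]; exact ⟨h1, h2⟩
  refine Filter.mem_of_superset ((p.isOpenEmbedding.isOpenMap _ hcl.isOpen_compl).mem_nhds
    ⟨w, fun ⟨v, hv⟩ => hz ⟨V.ι v, ?_⟩, rfl⟩) ?_
  · rw [← hv, ← Scheme.Hom.comp_apply, hd, Scheme.Hom.comp_apply]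
  · rintro _ ⟨w, hw, rfl⟩ ⟨x, hx⟩
    refine hw ⟨pullback.fst (V.ι ≫ f) (V.ι ≫ f) w, p.isOpenEmbedding.injective ?_⟩
    have : V.ι (pullback.fst (V.ι ≫ f) (V.ι ≫ f) w) = x := by
      rw [← Scheme.Hom.comp_apply, ← hp1, Scheme.Hom.comp_apply, ← hx, ← Scheme.Hom.comp_apply]
      simp
    rw [← Scheme.Hom.comp_apply, ← hd, Scheme.Hom.comp_apply, this, hx]

instance (X : CSch) : IsSeparated X.obj.hom :=
  isSeparated_of_exists_isAffineOpen _ fun x y => by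
    obtain ⟨U, hU, h⟩ := X.property.2.2 {x, y} (Set.toFinite _)
    exact ⟨U, hU, h (by simp), h (by simp)⟩

/-- Since `Z` is separated, the fibre product over `Z` is a closed subscheme of the product over
`ℂ`, and closed immersions are affine. -/
theorem isAdmissible_pullback {X Y Z : CSch} (f : X ⟶ Z) (g : Y ⟶ Z) :
    IsAdmissible (Over.mk (pullback.fst (mor f) (mor g) ≫ X.obj.hom)) := by
  have hf : mor f ≫ Z.obj.hom = X.obj.hom := Over.w f.hom
  have hg : mor g ≫ Z.obj.hom = Y.obj.hom := Over.w g.hom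
  let P : CSch := ⟨_, isAdmissible_prod X Y⟩
  let i : pullback (mor f) (mor g) ⟶ P.toScheme :=
    pullback.map _ _ _ _ (𝟙 _) (𝟙 _) Z.obj.hom (by simp) (by simp)
  have hi : IsClosedImmersion i := by
    let e : pullback (mor f ≫ Z.obj.hom) (mor g ≫ Z.obj.hom) ≅ pullback X.obj.hom Y.obj.hom :=
      pullback.congrHom hf hg
    have : i = pullback.mapDesc (mor f) (mor g) Z.obj.hom ≫ e.hom := by
      apply pullback.hom_ext
      · refine (pullback.lift_fst _ _ _).trans ?_
        rw [Category.assoc, show e.hom ≫ pullback.fst X.obj.hom Y.obj.hom = pullback.fst _ _ from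
          (pullback.lift_fst _ _ _).trans (Category.comp_id _)]
        exact (pullback.lift_fst _ _ _).symm
      · refine (pullback.lift_snd _ _ _).trans ?_
        rw [Category.assoc, show e.hom ≫ pullback.snd X.obj.hom Y.obj.hom = pullback.snd _ _ from
          (pullback.lift_snd _ _ _).trans (Category.comp_id _)]
        exact (pullback.lift_snd _ _ _).symm
    rw [this]
    infer_instance
  have := isAdmissible_of_isAffineHom P i
  have h2 : i ≫ P.obj.hom = pullback.fst (mor f) (mor g) ≫ X.obj.hom := by
    refine (Category.assoc _ _ _).symm.trans (congrArg (· ≫ X.obj.hom) ?_)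
    exact (pullback.lift_fst _ _ _).trans (Category.comp_id _)
  rwa [h2] at this

end Motivic

namespace Motivic

/-! ### Morphisms of admissible schemes -/

theorem mor_w {X Y : CSch} (u : X ⟶ Y) : mor u ≫ Y.obj.hom = X.obj.hom := Over.w u.hom

theorem mor_injective {X Y : CSch} {u v : X ⟶ Y} (h : mor u = mor v) : u = v := by
  apply ObjectProperty.hom_ext; exact Over.OverMorphism.ext h

/-- A morphism in `CSch` from a morphism of schemes over `ℂ`. -/
def ofMor {X Y : CSch} (φ : X.toScheme ⟶ Y.toScheme) (h : φ ≫ Y.obj.hom = X.obj.hom) : X ⟶ Y :=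
  ObjectProperty.homMk (Over.homMk φ h)

@[simp] theorem mor_comp {X Y Z : CSch} (u : X ⟶ Y) (v : Y ⟶ Z) : mor (u ≫ v) = mor u ≫ mor v := rfl

theorem mor_comp_apply {X Y Z : CSch} (u : X ⟶ Y) (v : Y ⟶ Z) (x : X.toScheme) :
    mor (u ≫ v) x = mor v (mor u x) := rfl

theorem isIso_mor {X Y : CSch} (u : X ⟶ Y) [IsIso u] : IsIso (mor u) :=
  ⟨mor (inv u), by rw [← mor_comp, IsIso.hom_inv_id]; rfl,
    by rw [← mor_comp, IsIso.inv_hom_id]; rfl⟩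

theorem mono_of_mono_mor {X Y : CSch} (u : X ⟶ Y) [Mono (mor u)] : Mono u :=
  ⟨fun _ _ h => mor_injective ((cancel_mono (mor u)).1 (congrArg mor h))⟩

instance (priority := 100) {X Y : CSch} (u : X ⟶ Y) [IsOpenImmersion (mor u)] : Mono u :=
  mono_of_mono_mor u

instance (priority := 100) {X Y : CSch} (u : X ⟶ Y) [IsClosedImmersion (mor u)] : Mono u :=
  mono_of_mono_mor u

/-- By surjectivity of `u`, the preimage of a compact set under `v` is the image under `u` of its
preimage under the composite. Applied to quotient maps, this shows that morphisms between symmetric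
powers are of finite type. -/
theorem FT.of_surjective_comp {X Y Z : CSch} {u : X ⟶ Y} {v : Y ⟶ Z} (h : FT (u ≫ v))
    (hu : Function.Surjective (mor u)) : FT v := by
  refine ⟨inferInstance, ⟨fun U hUo (hc : IsCompact U) => ?_⟩⟩
  have : QuasiCompact (mor u ≫ mor v) := h.2
  have h2 := (QuasiCompact.isCompact_preimage (f := mor u ≫ mor v) U hUo hc).image (mor u).continuous
  rwa [show (mor u ≫ mor v) ⁻¹' U = mor u ⁻¹' (mor v ⁻¹' U) from rfl,
    Set.image_preimage_eq _ hu] at h2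

theorem FT.of_isIso {X Y : CSch} (u : X ⟶ Y) [IsIso u] : FT u :=
  have := isIso_mor u
  FT.of_isOpenImmersion inferInstance

/-! ### Pull-backs -/

theorem isPullback_of_mor {P X Y Z : CSch} {p : P ⟶ X} {q : P ⟶ Y} {f : X ⟶ Z} {g : Y ⟶ Z}
    (h : IsPullback (mor p) (mor q) (mor f) (mor g)) : IsPullback p q f g := by
  refine ⟨⟨mor_injective h.w⟩, ⟨PullbackCone.IsLimit.mk _
    (fun s => ofMor (h.lift (mor s.fst) (mor s.snd) (congrArg mor s.condition)) ?_) ?_ ?_ ?_⟩⟩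
  · rw [← mor_w p, h.lift_fst_assoc, mor_w]
  · intro s; exact mor_injective (h.lift_fst _ _ _)
  · intro s; exact mor_injective (h.lift_snd _ _ _)
  · intro s m h1 h2
    apply mor_injective
    apply h.hom_ext
    · exact (congrArg mor h1).trans (h.lift_fst _ _ _).symm
    · exact (congrArg mor h2).trans (h.lift_snd _ _ _).symm

/-- The fibre product in `CSch`. -/
def fibObj {X Y Z : CSch} (f : X ⟶ Z) (g : Y ⟶ Z) : CSch := ⟨_, isAdmissible_pullback f g⟩

/-- The first projection of the fibre product. -/
def fibFst {X Y Z : CSch} (f : X ⟶ Z) (g : Y ⟶ Z) : fibObj f g ⟶ X :=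
  ofMor (pullback.fst (mor f) (mor g)) rfl

/-- The second projection of the fibre product. -/
def fibSnd {X Y Z : CSch} (f : X ⟶ Z) (g : Y ⟶ Z) : fibObj f g ⟶ Y :=
  ofMor (pullback.snd (mor f) (mor g)) (by
    change _ = pullback.fst (mor f) (mor g) ≫ X.obj.hom
    exact ((pullback.fst (mor f) (mor g)) ≫= (mor_w f).symm).trans
      ((pullback.condition_assoc _).trans (pullback.snd (mor f) (mor g) ≫= mor_w g)).symm.symm |>.symm)

theorem isPullback_fib {X Y Z : CSch} (f : X ⟶ Z) (g : Y ⟶ Z) :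
    IsPullback (fibFst f g) (fibSnd f g) f g :=
  isPullback_of_mor (IsPullback.of_hasPullback (mor f) (mor g))

/-- The fibre product of schemes is itself admissible, so it is also a fibre product in `CSch`, and
any other one is isomorphic to it. -/
theorem isPullback_mor {P X Y Z : CSch} {p : P ⟶ X} {q : P ⟶ Y} {f : X ⟶ Z} {g : Y ⟶ Z}
    (h : IsPullback p q f g) : IsPullback (mor p) (mor q) (mor f) (mor g) := by
  let e := h.isoIsPullback _ _ (isPullback_fib f g)
  have h1 : e.hom ≫ fibFst f g = p := h.isoIsPullback_hom_fst _ _ _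
  have h2 : e.hom ≫ fibSnd f g = q := h.isoIsPullback_hom_snd _ _ _
  have h3 : IsPullback (pullback.fst (mor f) (mor g)) (pullback.snd (mor f) (mor g)) _ _ :=
    IsPullback.of_hasPullback (mor f) (mor g)
  have := isIso_mor e.inv
  refine IsPullback.of_iso h3 (@asIso _ _ _ _ (mor e.inv) this) (Iso.refl _) (Iso.refl _) (Iso.refl _) ?_ ?_
    (by simp) (by simp)
  · exact (Category.comp_id _).trans (congrArg mor ((Iso.eq_inv_comp e).2 h1))
  · exact (Category.comp_id _).trans (congrArg mor ((Iso.eq_inv_comp e).2 h2))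

section BaseChange

variable {P X Y Z : CSch} {p : P ⟶ X} {q : P ⟶ Y} {f : X ⟶ Z} {g : Y ⟶ Z}

theorem range_of_isPullback (h : IsPullback p q f g) :
    Set.range (mor p) = mor f ⁻¹' Set.range (mor g) := by
  ext x
  constructor
  · rintro ⟨y, rfl⟩
    exact ⟨mor q y, by rw [← mor_comp_apply, ← mor_comp_apply, h.w]⟩
  · rintro ⟨y, hy⟩
    obtain ⟨z, hz, -⟩ := Scheme.exists_preimage_of_isPullback (isPullback_mor h) x y hy.symm
    exact ⟨z, hz⟩

theorem isClosedImmersion_of_isPullback (h : IsPullback p q f g)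
    (hg : IsClosedImmersion (mor g)) : IsClosedImmersion (mor p) :=
  MorphismProperty.of_isPullback (isPullback_mor h).flip hg

theorem isOpenImmersion_of_isPullback (h : IsPullback p q f g)
    (hg : IsOpenImmersion (mor g)) : IsOpenImmersion (mor p) :=
  MorphismProperty.of_isPullback (isPullback_mor h).flip hg

theorem FT.of_isPullback (h : IsPullback p q f g) (hg : FT g) : FT p :=
  ⟨inferInstance, MorphismProperty.of_isPullback (P := @QuasiCompact) (isPullback_mor h).flip hg.2⟩

end BaseChange

theorem IsCut.of_isPullback {V X Z U Z' U' : CSch} {i : Z ⟶ X} {j : U ⟶ X} (h : IsCut i j)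
    {f : V ⟶ X} {i' : Z' ⟶ V} {j' : U' ⟶ V} {a : Z' ⟶ Z} {b : U' ⟶ U}
    (hi : IsPullback i' a f i) (hj : IsPullback j' b f j) : IsCut i' j' where
  closed := isClosedImmersion_of_isPullback hi h.closed
  isOpen := isOpenImmersion_of_isPullback hj h.isOpen
  compl := by
    rw [range_of_isPullback hi, range_of_isPullback hj, h.compl, Set.preimage_compl]

/-! ### Open subschemes -/

/-- An open subscheme, as an object of `CSch`. -/
def openSub (X : CSch) (U : X.toScheme.Opens) : CSch := ⟨_, isAdmissible_of_isOpenImmersion X U.ι⟩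

/-- The inclusion of an open subscheme. -/
def openSubι (X : CSch) (U : X.toScheme.Opens) : openSub X U ⟶ X := ofMor U.ι rfl

instance (X : CSch) (U : X.toScheme.Opens) : IsOpenImmersion (mor (openSubι X U)) :=
  inferInstanceAs (IsOpenImmersion U.ι)

@[simp] theorem range_openSubι (X : CSch) (U : X.toScheme.Opens) :
    Set.range (mor (openSubι X U)) = U := by
  change Set.range U.ι = U
  simp

/-- Lifting a morphism through an open immersion. -/
def liftOpen {X U T : CSch} (j : U ⟶ X) [IsOpenImmersion (mor j)] (f : T ⟶ X)
    (h : Set.range (mor f) ⊆ Set.range (mor j)) : T ⟶ U :=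
  ofMor (IsOpenImmersion.lift (mor j) (mor f) h) (by
    rw [← mor_w j, IsOpenImmersion.lift_fac_assoc, mor_w])

@[simp]
theorem liftOpen_fac {X U T : CSch} (j : U ⟶ X) [IsOpenImmersion (mor j)] (f : T ⟶ X)
    (h : Set.range (mor f) ⊆ Set.range (mor j)) : liftOpen j f h ≫ j = f :=
  mor_injective (IsOpenImmersion.lift_fac _ _ _)

/-- Open immersions with the same range are isomorphic. -/
def isoOfRangeEq {X U V : CSch} (i : U ⟶ X) (j : V ⟶ X) [IsOpenImmersion (mor i)]
    [IsOpenImmersion (mor j)] (h : Set.range (mor i) = Set.range (mor j)) : U ≅ V where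
  hom := liftOpen j i h.le
  inv := liftOpen i j h.ge
  hom_inv_id := by rw [← cancel_mono i]; simp
  inv_hom_id := by rw [← cancel_mono j]; simp

@[simp]
theorem isoOfRangeEq_hom_comp {X U V : CSch} (i : U ⟶ X) (j : V ⟶ X) [IsOpenImmersion (mor i)]
    [IsOpenImmersion (mor j)] (h : Set.range (mor i) = Set.range (mor j)) :
    (isoOfRangeEq i j h).hom ≫ j = i := liftOpen_fac _ _ _

/-- A commutative square whose horizontal arrows are open immersions is cartesian as soon as
it is so on points. -/
theorem isPullback_of_isOpenImmersion {P X Y Z : CSch} {p : P ⟶ X} {q : P ⟶ Y} {f : X ⟶ Z}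
    {g : Y ⟶ Z} [IsOpenImmersion (mor p)] [IsOpenImmersion (mor g)] (h : p ≫ f = q ≫ g)
    (hr : mor f ⁻¹' Set.range (mor g) ⊆ Set.range (mor p)) : IsPullback p q f g := by
  refine ⟨⟨h⟩, ⟨PullbackCone.IsLimit.mk _ (fun s => liftOpen p s.fst ?_) ?_ ?_ ?_⟩⟩
  · refine Set.range_subset_iff.2 fun x => hr ⟨mor s.snd x, ?_⟩
    rw [← mor_comp_apply, ← mor_comp_apply, s.condition]
  · intro s; exact liftOpen_fac p s.fst _
  · intro s
    rw [← cancel_mono g, Category.assoc, ← h, ← Category.assoc]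
    exact (liftOpen_fac p s.fst _ =≫ f).trans s.condition
  · intro s m h1 _
    rw [← cancel_mono p, h1]
    exact (liftOpen_fac p s.fst _).symm

/-! ### Disjoint unions -/

section Sigma

variable {σ : Type} (V : σ → CSch)

theorem isClopen_range_sigmaι (f : σ → Scheme.{0}) (i : σ) :
    IsClopen (Set.range (Sigma.ι f i)) := by
  refine ⟨?_, (Sigma.ι f i).isOpenEmbedding.isOpen_range⟩
  have : (Set.range (Sigma.ι f i))ᶜ = ⋃ j : {j // j ≠ i}, Set.range (Sigma.ι f j.1) := by
    ext x
    obtain ⟨j, y, rfl⟩ := (sigmaOpenCover f).exists_eq x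
    simp only [Set.mem_compl_iff, Set.mem_iUnion, Subtype.exists]
    constructor
    · intro h
      exact ⟨j, fun e => h (e ▸ ⟨y, rfl⟩), y, rfl⟩
    · rintro ⟨k, hk, z, hz⟩ ⟨w, hw⟩
      exact hk (congrArg Sigma.fst ((sigmaι_eq_iff f _ _ _ _).1 (hz.trans hw.symm)))
  rw [← isOpen_compl_iff, this]
  exact isOpen_iUnion fun j => (Sigma.ι f j.1).isOpenEmbedding.isOpen_range

/-- The members of the family are open and closed in the disjoint union, so a connected component
lies in one of them. A finite set of points meets finitely many members, and a finite disjoint union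
of affine opens is affine. -/
theorem isAdmissible_sigma :
    IsAdmissible (Over.mk (Sigma.desc fun i => (V i).obj.hom)) := by
  let f : σ → Scheme.{0} := fun i => (V i).toScheme
  let h : ∐ f ⟶ Spec (.of ℂ) := Sigma.desc fun i => (V i).obj.hom
  refine ⟨?_, ?_, ?_⟩
  · change LocallyOfFiniteType h
    have := HasRingHomProperty.instIsZariskiLocalAtSource (P := @LocallyOfFiniteType)
    rw [IsZariskiLocalAtSource.iff_of_openCover (P := @LocallyOfFiniteType) (sigmaOpenCover f)]
    intro i
    have : (sigmaOpenCover f).f i ≫ h = (V i).obj.hom := Sigma.ι_desc _ _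
    rw [this]
    exact (V i).property.1
  · intro (x : ↥(∐ f))
    change IsCompact (connectedComponent x)
    obtain ⟨i, y, hy⟩ := (sigmaOpenCover f).exists_eq x
    change f i at y
    have hy : Sigma.ι f i y = x := hy
    refine (((V i).property.2.1 y).image (Sigma.ι f i).continuous).of_isClosed_subset
      isClosed_connectedComponent fun z hz => ?_
    have hsub : connectedComponent x ⊆ Set.range (Sigma.ι f i) :=
      (isClopen_range_sigmaι f i).connectedComponent_subset ⟨y, hy⟩
    obtain ⟨w, rfl⟩ := hsub hz
    refine ⟨w, ?_, rfl⟩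
    have hpre := isPreconnected_connectedComponent (x := x).preimage_of_isOpenMap
      (Sigma.ι f i).isOpenEmbedding.injective (Sigma.ι f i).isOpenEmbedding.isOpenMap hsub
    have hy2 : y ∈ Sigma.ι f i ⁻¹' connectedComponent x := by
      rw [Set.mem_preimage, hy]; exact mem_connectedComponent
    exact hpre.subset_connectedComponent hy2 hz
  · intro (s : Set ↥(∐ f)) hs
    have hU : ∀ i, ∃ U : (f i).Opens, IsAffineOpen U ∧ Sigma.ι f i ⁻¹' s ⊆ (U : Set (f i)) :=
      fun i => (V i).property.2.2 (Sigma.ι f i ⁻¹' s)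
        (hs.preimage (Sigma.ι f i).isOpenEmbedding.injective.injOn)
    choose U hUa hUs using hU
    let idx : ↥(∐ f) → σ := fun x => (sigmaOpenCover f).idx x
    let t : Set σ := idx '' s
    have ht : Finite t := hs.image idx
    let α : ∀ i : t, (U i.1).toScheme ⟶ ∐ f := fun i => (U i.1).ι ≫ Sigma.ι f i.1
    have hα : IsOpenImmersion (Sigma.desc α) := by
      refine isOpenImmersion_sigmaDesc _ α fun i j hij => ?_
      rw [Function.onFun, Set.disjoint_left]
      rintro _ ⟨a, rfl⟩ ⟨b, hb⟩
      exact hij (Subtype.ext (congrArg Sigma.fst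
        ((sigmaι_eq_iff f _ _ ((U j.1).ι b) ((U i.1).ι a)).1 hb)).symm)
    have : ∀ i : t, IsAffine (U i.1).toScheme := fun i => hUa i.1
    refine ⟨(Sigma.desc α).opensRange, isAffineOpen_opensRange _, fun x hx => ?_⟩
    obtain ⟨y, hy⟩ := (sigmaOpenCover f).covers x
    let i : t := ⟨idx x, x, hx, rfl⟩
    have hy' : Sigma.ι f i.1 y = x := hy
    have hyU : y ∈ U i.1 := hUs i.1 (by change Sigma.ι f i.1 y ∈ s; rwa [hy'])
    refine ⟨Sigma.ι (fun i : t => (U i.1).toScheme) i ⟨y, hyU⟩, ?_⟩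
    have h1 := Sigma.ι_desc α i
    exact (congrArg (fun φ : (U i.1).toScheme ⟶ ∐ f => φ ⟨y, hyU⟩) h1).trans hy'

/-- The disjoint union of a family of objects of `CSch`. -/
def sigmaObj : CSch := ⟨_, isAdmissible_sigma V⟩

/-- The inclusion of a member of the family in the disjoint union. -/
def sigmaInj (i : σ) : V i ⟶ sigmaObj V :=
  ofMor (Sigma.ι (fun i => (V i).toScheme) i) (Sigma.ι_desc _ _)

instance (i : σ) : IsOpenImmersion (mor (sigmaInj V i)) :=
  inferInstanceAs (IsOpenImmersion (Sigma.ι (fun i => (V i).toScheme) i))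

theorem exists_sigmaInj_eq (x : (sigmaObj V).toScheme) : ∃ i y, mor (sigmaInj V i) y = x :=
  (sigmaOpenCover _).exists_eq x

theorem sigmaInj_eq_iff {i j : σ} {x : (V i).toScheme} {y : (V j).toScheme}
    (h : mor (sigmaInj V i) x = mor (sigmaInj V j) y) : i = j :=
  congrArg Sigma.fst ((sigmaι_eq_iff (fun i => (V i).toScheme) _ _ _ _).1 h)

variable {V} in
/-- The morphism on a disjoint union given by a family of morphisms. -/
def sigmaDesc {X : CSch} (f : ∀ i, V i ⟶ X) : sigmaObj V ⟶ X :=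
  ofMor (Sigma.desc fun i => mor (f i)) (by
    apply Sigma.hom_ext
    intro i
    refine Eq.trans ?_ (Sigma.ι_desc (fun i => (V i).obj.hom) i).symm
    exact (Sigma.ι_desc_assoc _ _ _).trans (mor_w (f i)))

variable {V} in
@[simp]
theorem sigmaInj_desc {X : CSch} (f : ∀ i, V i ⟶ X) (i : σ) :
    sigmaInj V i ≫ sigmaDesc f = f i :=
  mor_injective (Sigma.ι_desc _ _)

end Sigma

end Motivic

namespace Motivic

/-! ### Rings of invariants -/

/-- The Reynolds operator (average over `G`) is a `B`-linear retraction `E : A → B`. Its base change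
`E' : A' → B'` is a retraction as well, and the composite of `E'` with `B' → A'` is the average over
`G` on `A'`, which fixes the invariants. Flatness of `B → B'` is not needed. -/
theorem invariants_of_algebraIsPushout {B B' A A' : Type} [CommRing B] [CommRing B'] [CommRing A]
    [CommRing A'] [Algebra B B'] [Algebra B A] [Algebra B' A'] [Algebra A A'] [Algebra B A']
    [IsScalarTower B B' A'] [IsScalarTower B A A'] [hp : Algebra.IsPushout B B' A A']
    {G : Type} [Group G] [Finite G] (σ : G → (A →+* A)) (σ' : G → (A' →+* A'))
    (hmul : ∀ g k, σ (g * k) = (σ g).comp (σ k))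
    (hφ : ∀ g b, σ g (algebraMap B A b) = algebraMap B A b)
    (hα : ∀ g a, σ' g (algebraMap A A' a) = algebraMap A A' (σ g a))
    (hφ' : ∀ g b, σ' g (algebraMap B' A' b) = algebraMap B' A' b)
    (hu : IsUnit ((Nat.card G : ℕ) : A)) (hinj : Function.Injective (algebraMap B A))
    (hsurj : ∀ a : A, (∀ g, σ g a = a) → a ∈ Set.range (algebraMap B A)) :
    Function.Injective (algebraMap B' A') ∧
      ∀ a : A', (∀ g, σ' g a = a) → a ∈ Set.range (algebraMap B' A') := by
  classical
  have := Fintype.ofFinite G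
  obtain ⟨c, hc⟩ := hu.exists_right_inv
  have hcσ : ∀ g, σ g c = c := fun g => by
    have h1 := congrArg (σ g) hc
    rw [map_mul, map_natCast, map_one] at h1
    calc σ g c = (c * (Nat.card G : ℕ)) * σ g c := by rw [mul_comm c, hc, one_mul]
      _ = c := by rw [mul_assoc, h1, mul_one]
  let avg : A →ₗ[B] A :=
    { toFun := fun a => c * ∑ g, σ g a
      map_add' := fun a b => by simp [Finset.sum_add_distrib, mul_add]
      map_smul' := fun b a => by
        simp only [Algebra.smul_def, map_mul, hφ, ← Finset.mul_sum, RingHom.id_apply]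
        ring }
  have havg : ∀ a g, σ g (avg a) = avg a := fun a g => by
    change σ g (c * ∑ k, σ k a) = c * ∑ k, σ k a
    rw [map_mul, hcσ, map_sum]
    congr 1
    refine Fintype.sum_equiv (Equiv.mulLeft g) _ _ fun k => ?_
    rw [Equiv.coe_mulLeft, hmul]; rfl
  have havg' : ∀ b : B, avg (algebraMap B A b) = algebraMap B A b := fun b => by
    change c * ∑ k, σ k _ = _
    simp only [hφ, Finset.sum_const, Finset.card_univ, ← Nat.card_eq_fintype_card, nsmul_eq_mul]
    rw [← mul_assoc, mul_comm c, hc, one_mul]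
  -- Injectivity of `B → A` makes the chosen preimages unique, and therefore linear in `a`.
  choose e he using fun a => hsurj (avg a) (havg a)
  let E : A →ₗ[B] B :=
    { toFun := e
      map_add' := fun a b => hinj (by simp [he])
      map_smul' := fun b a => hinj (by
        rw [he, map_smul, Algebra.smul_def, RingHom.id_apply, smul_eq_mul, map_mul, he]) }
  let ι : B →ₗ[B] B' := Algebra.linearMap B B'
  let E' : A' →ₗ[B'] B' := hp.out.lift (ι ∘ₗ E)
  have hE' : ∀ a, E' (algebraMap A A' a) = algebraMap B B' (e a) :=
    fun a => hp.out.lift_eq (ι ∘ₗ E) a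
  have he1 : e 1 = 1 := hinj (by
    have := havg' 1
    rwa [he, map_one (algebraMap B A), ← map_one (algebraMap B A)])
  have hE1 : ∀ b, E' (algebraMap B' A' b) = b := fun b => by
    rw [Algebra.algebraMap_eq_smul_one, map_smul, ← map_one (algebraMap A A'), hE', he1, map_one,
      smul_eq_mul, mul_one]
  refine ⟨Function.LeftInverse.injective hE1, fun a ha => ⟨E' a, ?_⟩⟩
  let c' := algebraMap A A' c
  let avg' : A' →ₗ[B'] A' :=
    { toFun := fun a => c' * ∑ g, σ' g a
      map_add' := fun a b => by simp [Finset.sum_add_distrib, mul_add]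
      map_smul' := fun b a => by
        simp only [Algebra.smul_def, map_mul, hφ', ← Finset.mul_sum, RingHom.id_apply]
        ring }
  -- Both sides are `B'`-linear, so they can be compared on the image of `A`, which generates `A'`
  -- over `B'`.
  have key : Algebra.linearMap B' A' ∘ₗ E' = avg' := by
    refine hp.out.algHom_ext _ _ fun a => ?_
    change algebraMap B' A' (E' (algebraMap A A' a)) = c' * ∑ g, σ' g (algebraMap A A' a)
    rw [hE', ← IsScalarTower.algebraMap_apply B B' A', IsScalarTower.algebraMap_apply B A A', he]
    simp only [hα, ← map_sum, c', ← map_mul]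
    rfl
  have h2 : avg' a = a := by
    change c' * ∑ g, σ' g a = a
    simp only [ha, Finset.sum_const, Finset.card_univ, ← Nat.card_eq_fintype_card, nsmul_eq_mul]
    rw [← mul_assoc, mul_comm c', ← map_natCast (algebraMap A A'), ← map_mul, hc, map_one, one_mul]
  exact (DFunLike.congr_fun key a).trans h2

/-- If `A` is a `B`-algebra with `B = A ^ G` and `|G|` is invertible, then `B' = (A ⊗[B] B') ^ G`. -/
theorem invariants_of_isPushout {B A B' A' : CommRingCat.{0}} {φ : B ⟶ A} {β : B ⟶ B'} {α : A ⟶ A'}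
    {φ' : B' ⟶ A'} (h : IsPushout φ β α φ') {G : Type} [Group G] [Finite G] (σ : G → (A ⟶ A))
    (σ' : G → (A' ⟶ A')) (hmul : ∀ g k, σ (g * k) = σ k ≫ σ g) (hφ : ∀ g, φ ≫ σ g = φ)
    (hα : ∀ g, α ≫ σ' g = σ g ≫ α) (hφ' : ∀ g, φ' ≫ σ' g = φ')
    (hu : IsUnit ((Nat.card G : ℕ) : A)) (hinj : Function.Injective φ)
    (hsurj : ∀ a : A, (∀ g, σ g a = a) → a ∈ Set.range φ) :
    Function.Injective φ' ∧ ∀ a : A', (∀ g, σ' g a = a) → a ∈ Set.range φ' := by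
  algebraize [φ.hom, β.hom, α.hom, φ'.hom, (φ ≫ α).hom]
  have : IsScalarTower B B' A' := .of_algebraMap_eq fun b => DFunLike.congr_fun (congrArg CommRingCat.Hom.hom h.w) b
  have : IsScalarTower B A A' := .of_algebraMap_eq fun b => rfl
  have hp : Algebra.IsPushout B B' A A' := CommRingCat.isPushout_iff_isPushout.1 h.flip
  exact invariants_of_algebraIsPushout (B := B) (B' := B') (A := A) (A' := A')
    (fun g => (σ g).hom) (fun g => (σ' g).hom)
    (fun g k => by rw [hmul]; rfl) (fun g b => DFunLike.congr_fun (congrArg CommRingCat.Hom.hom (hφ g)) b) (fun g a => DFunLike.congr_fun (congrArg CommRingCat.Hom.hom (hα g)) a)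
    (fun g b => DFunLike.congr_fun (congrArg CommRingCat.Hom.hom (hφ' g)) b) hu hinj hsurj

/-! ### Good quotients -/

/-- A left action of `G` on an object, given by a family of endomorphisms. -/
structure IsAct {C : Type*} [Category C] {G : Type} [Group G] {Y : C} (ρ : G → (Y ⟶ Y)) : Prop where
  one : ρ 1 = 𝟙 Y
  mul : ∀ g k, ρ (g * k) = ρ g ≫ ρ k

/-- Schemes on which all positive integers are invertible. -/
class IsRational (Y : Scheme.{0}) : Prop where
  isUnit_natCast : ∀ (U : Y.Opens) (n : ℕ), n ≠ 0 → IsUnit ((n : ℕ) : Γ(Y, U))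

theorem IsRational.of_hom {X Y : Scheme.{0}} (f : X ⟶ Y) [IsRational Y] : IsRational X := by
  refine ⟨fun U n hn => ?_⟩
  have := ((isUnit_natCast (Y := Y) ⊤ n hn).map (f.appLE ⊤ U le_top).hom)
  rwa [map_natCast] at this

instance : IsRational (Spec (.of ℂ)) := by
  refine ⟨fun U n hn => ?_⟩
  have h := (IsUnit.mk0 (n : ℂ) (Nat.cast_ne_zero.2 hn)).map ((Scheme.ΓSpecIso (.of ℂ)).inv ≫
    (Spec (.of ℂ)).presheaf.map (homOfLE le_top).op).hom (F := ℂ →+* Γ(Spec (.of ℂ), U))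
  rwa [map_natCast] at h

instance (X : CSch) : IsRational X.toScheme := .of_hom X.obj.hom

section Good

variable {G : Type} [Group G] {Y Q : Scheme.{0}} {ρ : G → (Y ⟶ Y)} {q : Y ⟶ Q}

/-- Over the open `U`, the functions on the quotient are the invariant functions. -/
structure GoodOn (ρ : G → (Y ⟶ Y)) (q : Y ⟶ Q) (U : Q.Opens) : Prop where
  inj : Function.Injective (q.app U)
  surj : ∀ s : Γ(Y, q ⁻¹ᵁ U), (∀ g (h : q ⁻¹ᵁ U ≤ ρ g ⁻¹ᵁ q ⁻¹ᵁ U), (ρ g).appLE _ _ h s = s) →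
    s ∈ Set.range (q.app U)

/-- `q` is a good quotient of `Y` by the action `ρ` of `G`: it is affine and invariant, and the
functions on the quotient are the invariant functions. -/
structure IsGood (ρ : G → (Y ⟶ Y)) (q : Y ⟶ Q) : Prop where
  inv : ∀ g, ρ g ≫ q = q
  affine : IsAffineHom q
  good : ∀ U : Q.Opens, IsAffineOpen U → GoodOn ρ q U

omit [Group G] in
theorem preimage_le_of_inv (h : ∀ g, ρ g ≫ q = q) (U : Q.Opens) (g : G) :
    q ⁻¹ᵁ U ≤ ρ g ⁻¹ᵁ q ⁻¹ᵁ U := by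
  rw [← Scheme.Hom.comp_preimage, h]

/-- Over affine open subsets the cartesian square becomes a pushout square of rings, and rings of
invariants commute with base change because the order of `G` is invertible. -/
theorem GoodOn.of_isPullback [Finite G] [IsRational Y] {Y' Q' : Scheme.{0}} {ρ' : G → (Y' ⟶ Y')}
    {q' : Y' ⟶ Q'} {p : Y' ⟶ Y} {j : Q' ⟶ Q} (H : IsPullback p q' q j) [IsAffineHom q]
    (hρ : IsAct ρ) (hq : ∀ g, ρ g ≫ q = q) (hq' : ∀ g, ρ' g ≫ q' = q')
    (hρ' : ∀ g, ρ' g ≫ p = p ≫ ρ g) {U : Q.Opens} (hU : IsAffineOpen U) (h : GoodOn ρ q U)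
    {U' : Q'.Opens} (hU' : IsAffineOpen U') (hUU' : U' ≤ j ⁻¹ᵁ U) : GoodOn ρ' q' U' := by
  have hUY : q' ⁻¹ᵁ U' = p ⁻¹ᵁ (q ⁻¹ᵁ U) ⊓ q' ⁻¹ᵁ U' := by
    rw [right_eq_inf, ← Scheme.Hom.comp_preimage, H.w, Scheme.Hom.comp_preimage]
    exact q'.preimage_mono hUU'
  have hp : q' ⁻¹ᵁ U' ≤ p ⁻¹ᵁ (q ⁻¹ᵁ U) := hUY.le.trans inf_le_left
  have hpo := (isIso_pushoutSection_iff H hUU' le_rfl hUY).1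
    (isIso_pushoutSection_of_isAffineOpen H hUU' le_rfl hUY hU hU' (hU.preimage q))
  have e := preimage_le_of_inv hq U
  have e' := preimage_le_of_inv hq' U'
  have key := invariants_of_isPushout hpo (fun g => (ρ g).appLE _ _ (e g))
    (fun g => (ρ' g).appLE _ _ (e' g))
    (fun g k => by simp only [Scheme.Hom.appLE_comp_appLE, hρ.mul])
    (fun g => by simp only [Scheme.Hom.appLE_comp_appLE, hq])
    (fun g => by simp only [Scheme.Hom.appLE_comp_appLE, hρ'])
    (fun g => by simp only [Scheme.Hom.appLE_comp_appLE, hq'])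
    (IsRational.isUnit_natCast _ _ Nat.card_pos.ne')
    (by rw [Scheme.Hom.appLE_eq_app]; exact h.inj)
    (fun a ha => by
      rw [Scheme.Hom.appLE_eq_app]; exact h.surj a fun g _ => ha g)
  rw [Scheme.Hom.appLE_eq_app] at key
  exact ⟨key.1, fun s hs => key.2 s fun g => hs g (e' g)⟩

theorem GoodOn.of_le [Finite G] [IsRational Y] [IsAffineHom q] (hρ : IsAct ρ)
    (hq : ∀ g, ρ g ≫ q = q) {U V : Q.Opens} (hU : IsAffineOpen U) (hV : IsAffineOpen V)
    (hVU : V ≤ U) (h : GoodOn ρ q U) : GoodOn ρ q V :=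
  h.of_isPullback (IsPullback.of_horiz_isIso ⟨by simp⟩ : IsPullback (𝟙 Y) q q (𝟙 Q)) hρ hq hq
    (by simp) hU hV hVU

-- By the sheaf property, an invariant function descends on each member of the cover, and the local
-- descents glue. Only injectivity of pull-back is needed on the overlaps, to see that the descents
-- agree there.
omit [Group G] in
theorem GoodOn.of_cover (hq : ∀ g, ρ g ≫ q = q) {U : Q.Opens} {ι : Type}
    (V : ι → Q.Opens) (hVU : ∀ i, V i ≤ U) (hV : U ≤ iSup V) (h : ∀ i, GoodOn ρ q (V i))
    (hinf : ∀ i j, Function.Injective (q.app (V i ⊓ V j))) : GoodOn ρ q U := by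
  have hVq : q ⁻¹ᵁ U ≤ ⨆ i, q ⁻¹ᵁ V i := fun y hy => by
    obtain ⟨i, hi⟩ := TopologicalSpace.Opens.mem_iSup.1 (hV hy)
    exact TopologicalSpace.Opens.mem_iSup.2 ⟨i, hi⟩
  have hnat : ∀ {W W' : Q.Opens} (hW : W' ≤ W) (t : Γ(Q, W)),
      q.app W' (Q.presheaf.map (homOfLE hW).op t) =
        Y.presheaf.map (homOfLE (q.preimage_mono hW)).op (q.app W t) := fun hW t => by
    rw [← ConcreteCategory.comp_apply, q.naturality]; rfl
  refine ⟨fun s t hst => ?_, fun s hs => ?_⟩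
  · refine Q.sheaf.eq_of_locally_eq' V U (fun i => homOfLE (hVU i)) hV s t fun i => ?_
    apply (h i).inj
    exact (hnat (hVU i) s).trans ((congrArg _ hst).trans (hnat (hVU i) t).symm)
  · have hex : ∀ i, ∃ t : Γ(Q, V i),
        q.app (V i) t = Y.presheaf.map (homOfLE (q.preimage_mono (hVU i))).op s := fun i => by
      refine (h i).surj _ fun g hg => ?_
      have h1 := hs g (preimage_le_of_inv hq U g)
      conv_rhs => rw [← h1]
      rw [← ConcreteCategory.comp_apply, ← ConcreteCategory.comp_apply, Scheme.Hom.map_appLE,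
        Scheme.Hom.appLE_map]
    choose t ht using hex
    obtain ⟨b, hb, -⟩ := Q.sheaf.existsUnique_gluing' V U (fun i => homOfLE (hVU i)) hV t
      (fun i j => hinf i j (by
        refine (hnat inf_le_left (t i)).trans (Eq.trans ?_ (hnat inf_le_right (t j)).symm)
        rw [ht, ht, ← ConcreteCategory.comp_apply, ← ConcreteCategory.comp_apply,
          ← Functor.map_comp, ← Functor.map_comp]
        rfl))
    refine ⟨b, Y.sheaf.eq_of_locally_eq' (fun i => q ⁻¹ᵁ V i) _
      (fun i => homOfLE (q.preimage_mono (hVU i))) hVq _ _ fun i => ?_⟩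
    refine (hnat (hVU i) b).symm.trans ((congrArg (q.app (V i)) (hb i)).trans (ht i))

/-- Goodness passes to smaller affine opens by base change and can be checked on basic opens
generating the unit ideal, so it is an affine-local property and one affine cover suffices. -/
theorem IsGood.of_cover [Finite G] [IsRational Y] (hρ : IsAct ρ) (hq : ∀ g, ρ g ≫ q = q)
    [IsAffineHom q] {ι : Type} (V : ι → Q.Opens) (hV : ∀ i, IsAffineOpen (V i)) (hc : iSup V = ⊤)
    (h : ∀ i, GoodOn ρ q (V i)) : IsGood ρ q := by
  refine ⟨hq, inferInstance, fun U hU => ?_⟩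
  refine of_affine_open_cover (P := fun U => GoodOn ρ q U) (fun i => ⟨V i, hV i⟩) hc ⟨U, hU⟩
    (fun U f hU => hU.of_le hρ hq U.2 (U.2.basicOpen f) (Q.basicOpen_le f)) ?_ h
  intro U s hs hf
  refine GoodOn.of_cover hq (fun f : s => Q.basicOpen f.1) (fun f => Q.basicOpen_le _) ?_ hf ?_
  · rw [← U.2.iSup_basicOpen_eq_self_iff] at hs
    conv_lhs => rw [← hs]
    exact le_rfl
  · intro f g
    have : Q.basicOpen f.1 ⊓ Q.basicOpen g.1 = Q.basicOpen (f.1 * g.1) := by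
      rw [Scheme.basicOpen_mul]
    refine (GoodOn.of_le hρ hq (U.2.basicOpen f.1) ?_ inf_le_left (hf f)).inj
    rw [this]
    exact U.2.basicOpen _

theorem IsGood.of_isPullback [Finite G] [IsRational Y] {Y' Q' : Scheme.{0}} {ρ' : G → (Y' ⟶ Y')}
    {q' : Y' ⟶ Q'} {p : Y' ⟶ Y} {j : Q' ⟶ Q} (H : IsPullback p q' q j)
    (hρ : IsAct ρ) (hact' : IsAct ρ') (hq : IsGood ρ q) (hq' : ∀ g, ρ' g ≫ q' = q')
    (hρ' : ∀ g, ρ' g ≫ p = p ≫ ρ g) : IsGood ρ' q' := by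
  have := hq.affine
  have : IsRational Y' := .of_hom p
  have : IsAffineHom q' := MorphismProperty.of_isPullback H hq.affine
  have hex : ∀ x : Q', ∃ V : Q'.Opens, x ∈ V ∧ IsAffineOpen V ∧ GoodOn ρ' q' V := fun x => by
    obtain ⟨_, ⟨U, hU, rfl⟩, hxU, -⟩ :=
      Q.isBasis_affineOpens.exists_subset_of_mem_open (Set.mem_univ (j x)) isOpen_univ
    obtain ⟨_, ⟨V, hV, rfl⟩, hxV, hVU⟩ :=
      Q'.isBasis_affineOpens.exists_subset_of_mem_open (show x ∈ (j ⁻¹ᵁ U : Q'.Opens) from hxU)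
        (j ⁻¹ᵁ U).isOpen
    exact ⟨V, hxV, hV, (hq.good U hU).of_isPullback H hρ hq.inv hq' hρ' hU hV hVU⟩
  choose V hxV hV hgood using hex
  exact IsGood.of_cover hact' hq' V hV (eq_top_iff.2 fun x _ =>
    TopologicalSpace.Opens.mem_iSup.2 ⟨x, hxV x⟩) hgood

end Good

end Motivic

/-! ### Topology of good quotients: closedness, surjectivity, fibres as orbits -/

namespace Motivic

section Good

variable {G : Type} [Group G] {Y Q : Scheme.{0}} {ρ : G → (Y ⟶ Y)} {q : Y ⟶ Q}

/-- The prime ideal of functions on `U` vanishing at a point. -/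
def vanishingPrime {X : Scheme.{0}} {U : X.Opens} (x : X) (hx : x ∈ U) : Ideal Γ(X, U) :=
  (IsLocalRing.maximalIdeal (X.presheaf.stalk x)).comap (X.presheaf.germ U x hx).hom

instance {X : Scheme.{0}} {U : X.Opens} (x : X) (hx : x ∈ U) : (vanishingPrime x hx).IsPrime := by
  unfold vanishingPrime; infer_instance

theorem notMem_vanishingPrime {X : Scheme.{0}} {U : X.Opens} {x : X} (hx : x ∈ U) (f : Γ(X, U)) :
    f ∉ vanishingPrime x hx ↔ x ∈ X.basicOpen f := by
  rw [X.mem_basicOpen f x hx]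
  simp [vanishingPrime]

theorem comap_vanishingPrime {X Z : Scheme.{0}} (f : X ⟶ Z) {U : Z.Opens} {V : X.Opens}
    (e : V ≤ f ⁻¹ᵁ U) {x : X} (hx : x ∈ V) :
    (vanishingPrime x hx).comap (f.appLE U V e).hom = vanishingPrime (f x) (e hx) := by
  ext s
  refine not_iff_not.1 ((notMem_vanishingPrime hx (f.appLE U V e s)).trans (Iff.trans ?_
    (notMem_vanishingPrime (x := f x) (U := U) (e hx) s).symm))
  rw [Scheme.basicOpen_appLE]
  exact ⟨fun h => h.2, fun h => ⟨hx, h⟩⟩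

theorem eq_of_vanishingPrime_eq {X : Scheme.{0}} {U : X.Opens} (hU : IsAffineOpen U) {x y : X}
    (hx : x ∈ U) (hy : y ∈ U) (h : vanishingPrime x hx = vanishingPrime y hy) : x = y := by
  have key : ∀ {x y : X} (hx : x ∈ U) (hy : y ∈ U), vanishingPrime x hx = vanishingPrime y hy →
      ∀ V : Set X, IsOpen V → x ∈ V → y ∈ V := by
    intro x y hx hy h V hV hxV
    obtain ⟨f, hf, hxf⟩ := hU.exists_basicOpen_le (V := ⟨V, hV⟩) ⟨x, hxV⟩ hx
    exact hf ((notMem_vanishingPrime hy f).1 (h ▸ (notMem_vanishingPrime hx f).2 hxf))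
  refine (inseparable_iff_forall_isOpen.2 fun V hV => ⟨key hx hy h V hV, key hy hx h.symm V hV⟩).eq

/-- On an affine open the functions upstairs are an extension of their ring of invariants under a
finite group. Such extensions are integral, and the group permutes transitively the primes over a
given prime. -/
theorem IsGood.algebra_isInvariant (hq : IsGood ρ q) (hρ : IsAct ρ) {U : Q.Opens}
    (hU : IsAffineOpen U) [Finite G] : (q.app U).hom.IsIntegral ∧
      ∀ P P' : Ideal Γ(Y, q ⁻¹ᵁ U), P.IsPrime → P'.IsPrime →
        P.comap (q.app U).hom = P'.comap (q.app U).hom →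
        ∃ g, P' = P.comap ((ρ g).appLE _ _ (preimage_le_of_inv hq.inv U g)).hom := by
  let e := preimage_le_of_inv hq.inv U
  let _ : MulSemiringAction G Γ(Y, q ⁻¹ᵁ U) :=
    { smul := fun g s => (ρ g).appLE _ _ (e g) s
      one_smul := fun s => by
        change (ρ 1).appLE _ _ (e 1) s = s
        have : (ρ 1).appLE _ _ (e 1) = 𝟙 _ := by
          have h : ∀ (r : Y ⟶ Y) (hr : r = 𝟙 Y) (e), r.appLE (q ⁻¹ᵁ U) (q ⁻¹ᵁ U) e = 𝟙 _ := by
            rintro _ rfl e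
            exact (Category.id_comp _).trans (Y.presheaf.map_id _)
          exact h _ hρ.one _
        rw [this]; rfl
      mul_smul := fun g k s => by
        change (ρ (g * k)).appLE _ _ (e _) s = (ρ g).appLE _ _ (e g) ((ρ k).appLE _ _ (e k) s)
        rw [← ConcreteCategory.comp_apply, Scheme.Hom.appLE_comp_appLE]
        simp only [hρ.mul]
      smul_zero := fun g => map_zero _
      smul_add := fun g => map_add _
      smul_one := fun g => map_one _
      smul_mul := fun g => map_mul _ }
  have hsmul : ∀ (g : G) (s : Γ(Y, q ⁻¹ᵁ U)), g • s = (ρ g).appLE _ _ (e g) s := fun _ _ => rfl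
  algebraize [(q.app U).hom]
  have hinv : Algebra.IsInvariant Γ(Q, U) Γ(Y, q ⁻¹ᵁ U) G :=
    ⟨fun s hs => (hq.good U hU).surj s fun g _ => hs g⟩
  have hfix : ∀ (g : G) (b : Γ(Q, U)), g • q.app U b = q.app U b := fun g b => by
    rw [hsmul, ← ConcreteCategory.comp_apply, Scheme.Hom.app_eq_appLE,
      Scheme.Hom.appLE_comp_appLE]
    simp only [hq.inv]
  have : SMulCommClass G Γ(Q, U) Γ(Y, q ⁻¹ᵁ U) := ⟨fun g b s => by
    rw [Algebra.smul_def, Algebra.smul_def, smul_mul']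
    congr 1
    exact hfix g b⟩
  refine ⟨(Algebra.IsInvariant.isIntegral Γ(Q, U) Γ(Y, q ⁻¹ᵁ U) G).1, fun P P' hP hP' h => ?_⟩
  obtain ⟨g, hg⟩ := Algebra.IsInvariant.exists_smul_of_under_eq Γ(Q, U) Γ(Y, q ⁻¹ᵁ U) G P P' h
  -- The translate of an ideal by `g` is its preimage under the action of `g⁻¹`.
  refine ⟨g⁻¹, ?_⟩
  rw [hg, Ideal.pointwise_smul_eq_comap]
  rfl

theorem IsGood.isIntegralHom [Finite G] (hρ : IsAct ρ) (hq : IsGood ρ q) : IsIntegralHom q :=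
  have := hq.affine
  ⟨fun _ hU => (hq.algebra_isInvariant hρ hU).1⟩

theorem IsGood.isClosedMap [Finite G] (hρ : IsAct ρ) (hq : IsGood ρ q) : IsClosedMap q :=
  have := hq.isIntegralHom hρ
  q.isClosedMap

omit [Group G] in
theorem IsGood.isSchemeTheoreticallyDominant (hq : IsGood ρ q) :
    IsSchemeTheoreticallyDominant q := by
  have := hq.affine
  refine ⟨Scheme.IdealSheafData.ext (funext fun U => ?_)⟩
  rw [Scheme.Hom.ker_apply, (RingHom.injective_iff_ker_eq_bot _).1 (hq.good U.1 U.2).inj]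
  rfl

/-- The image is dense because functions pull back injectively, and closed because `q` is integral.
-/
theorem IsGood.surjective [Finite G] (hρ : IsAct ρ) (hq : IsGood ρ q) : Function.Surjective q := by
  have := hq.affine
  have := hq.isSchemeTheoreticallyDominant
  have h1 : IsDominant q := inferInstance
  have h2 := (hq.isClosedMap hρ).isClosed_range
  rw [← Set.range_eq_univ, ← h2.closure_eq]
  exact h1.denseRange.closure_eq

/-- Points of an affine open are determined by the primes of functions vanishing at them, and the
group acts transitively on the primes over the one of `q y`. -/
theorem IsGood.exists_eq [Finite G] (hρ : IsAct ρ) (hq : IsGood ρ q) {y y' : Y} (h : q y = q y') :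
    ∃ g, ρ g y = y' := by
  obtain ⟨_, ⟨U, hU, rfl⟩, hyU, -⟩ :=
    Q.isBasis_affineOpens.exists_subset_of_mem_open (Set.mem_univ (q y)) isOpen_univ
  have hy : y ∈ q ⁻¹ᵁ U := hyU
  have hy' : y' ∈ q ⁻¹ᵁ U := by change q y' ∈ U; rw [← h]; exact hyU
  have := hq.affine
  have hc : ∀ {y : Y} (hy : y ∈ q ⁻¹ᵁ U),
      (vanishingPrime y hy).comap (q.app U).hom = vanishingPrime (q y) hy := fun hy => by
    rw [← comap_vanishingPrime q le_rfl hy, Scheme.Hom.appLE_eq_app]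
  obtain ⟨g, hg⟩ := (hq.algebra_isInvariant hρ hU).2 (vanishingPrime y hy) (vanishingPrime y' hy')
    inferInstance inferInstance (by rw [hc, hc]; congr 1)
  refine ⟨g, eq_of_vanishingPrime_eq (hU.preimage q) (preimage_le_of_inv hq.inv U g hy) hy' ?_⟩
  rw [hg, comap_vanishingPrime]

/-! ### Good quotients are categorical quotients -/

-- The equalizer of `a` and `b` is a closed subscheme since `T` is separated, and `q` factors
-- through it. Functions pull back injectively along `q`, so the ideal of this closed subscheme is
-- zero.
omit [Group G] in
theorem IsGood.hom_ext (hq : IsGood ρ q) {T : Scheme.{0}} [T.IsSeparated] {a b : Q ⟶ T}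
    (h : q ≫ a = q ≫ b) : a = b := by
  have := hq.affine
  have hd := hq.isSchemeTheoreticallyDominant
  have hcl : IsClosedImmersion (equalizer.ι a b) := inferInstance
  have hl : equalizer.lift q h ≫ equalizer.ι a b = q := equalizer.lift_ι _ _
  have hk : (equalizer.ι a b).ker = ⊥ := by
    have h1 := Scheme.Hom.le_ker_comp (equalizer.lift q h) (equalizer.ι a b)
    rw [hl, hd.ker_eq_bot] at h1
    exact le_bot_iff.1 h1
  have := IsClosedImmersion.isIso_iff_ker_eq_bot.2 hk
  rw [← cancel_epi (equalizer.ι a b)]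
  exact equalizer.condition a b

/-- The action lifts to the fibre product, for which `q'` is again a good quotient. This supplies
uniqueness on overlaps when descended morphisms are glued. -/
theorem IsGood.hom_ext_of_isPullback [Finite G] [IsRational Y] (hρ : IsAct ρ) (hq : IsGood ρ q)
    {Y' Q' : Scheme.{0}} {p : Y' ⟶ Y} {q' : Y' ⟶ Q'} {j : Q' ⟶ Q} (H : IsPullback p q' q j)
    {T : Scheme.{0}} [T.IsSeparated] {a b : Q' ⟶ T} (h : q' ≫ a = q' ≫ b) : a = b := by
  let ρ' : G → (Y' ⟶ Y') := fun g => H.lift (p ≫ ρ g) q' (by rw [Category.assoc, hq.inv, H.w])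
  have h1 : ∀ g, ρ' g ≫ p = p ≫ ρ g := fun g => H.lift_fst _ _ _
  have h2 : ∀ g, ρ' g ≫ q' = q' := fun g => H.lift_snd _ _ _
  refine (IsGood.of_isPullback H hρ ⟨H.hom_ext ?_ ?_, fun g k => H.hom_ext ?_ ?_⟩ hq h2 h1).hom_ext h
  · rw [h1, hρ.one, Category.comp_id, Category.id_comp]
  · rw [h2, Category.id_comp]
  · rw [h1, hρ.mul, Category.assoc, h1, reassoc_of% (h1 g)]
  · rw [h2, Category.assoc, h2, h2]

/-- The image of a saturated open subset under a good quotient. -/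
def IsGood.imageOpens [Finite G] (hρ : IsAct ρ) (hq : IsGood ρ q) (W : Y.Opens) : Q.Opens :=
  ⟨(q '' (W : Set Y)ᶜ)ᶜ, (hq.isClosedMap hρ _ W.isOpen.isClosed_compl).isOpen_compl⟩

theorem IsGood.preimage_imageOpens [Finite G] (hρ : IsAct ρ) (hq : IsGood ρ q) {W : Y.Opens}
    (hW : ∀ g, W ≤ ρ g ⁻¹ᵁ W) : q ⁻¹ᵁ hq.imageOpens hρ W = W := by
  ext y
  constructor
  · intro hy
    by_contra h
    exact hy ⟨y, h, rfl⟩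
  · rintro hy ⟨y', hy', e⟩
    obtain ⟨g, rfl⟩ := hq.exists_eq hρ e.symm
    exact hy' (hW g hy)

/-- Two local descents agree on an overlap because they agree after composition with the base change
of `q` to the overlap. The hypothesis `hφ` is phrased with test objects `R` so that it applies both
to these base changes and to the pulled back cover of `Y`. -/
theorem IsGood.exists_desc_of_openCover [Finite G] [IsRational Y] (hρ : IsAct ρ) (hq : IsGood ρ q)
    {T : Scheme.{0}} [T.IsSeparated] (f : Y ⟶ T) (𝒰 : Q.OpenCover.{0}) (φ : ∀ i, 𝒰.X i ⟶ T)
    (hφ : ∀ (i : 𝒰.I₀) {R : Scheme.{0}} (a : R ⟶ Y) (b : R ⟶ 𝒰.X i),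
      a ≫ q = b ≫ 𝒰.f i → b ≫ φ i = a ≫ f) : ∃ a, q ≫ a = f := by
  refine ⟨𝒰.glueMorphisms φ fun x y => ?_, ?_⟩
  · have H := IsPullback.of_hasPullback q (pullback.fst (𝒰.f x) (𝒰.f y) ≫ 𝒰.f x)
    refine hq.hom_ext_of_isPullback hρ H ?_
    rw [← Category.assoc, ← Category.assoc]
    exact (hφ x _ _ (H.w.trans (Category.assoc _ _ _).symm)).trans (hφ y _ _
      (H.w.trans ((_ ≫= pullback.condition).trans (Category.assoc _ _ _).symm))).symm
  · refine Scheme.Cover.hom_ext (𝒰.pullback₁ q) _ _ fun (x : 𝒰.I₀) => ?_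
    have h1 : pullback.fst q (𝒰.f x) ≫ q = pullback.snd q (𝒰.f x) ≫ 𝒰.f x := pullback.condition
    refine (Category.assoc _ _ _).symm.trans ((h1 =≫ _).trans ((Category.assoc _ _ _).trans ?_))
    exact (_ ≫= Scheme.Cover.ι_glueMorphisms _ _ _ _).trans (hφ x _ _ h1)

theorem IsGood.isCategorical [Finite G] [IsRational Y] (hρ : IsAct ρ) (hq : IsGood ρ q)
    {T : Scheme.{0}} [T.IsSeparated] (f : Y ⟶ T) (hf : ∀ g, ρ g ≫ f = f) : ∃ a, q ≫ a = f := by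
  have := hq.affine
  have hsat : ∀ (W : T.Opens) g, f ⁻¹ᵁ W ≤ ρ g ⁻¹ᵁ f ⁻¹ᵁ W := fun W g => by
    rw [← Scheme.Hom.comp_preimage, hf]
  -- Preimages of opens of `T` are invariant, hence preimages of opens of `Q`. This gives affine
  -- opens of `Q` over which `f` takes values in an affine open of `T`.
  let V : T.Opens → Q.Opens := fun W => hq.imageOpens hρ (f ⁻¹ᵁ W)
  have hV : ∀ W, q ⁻¹ᵁ V W = f ⁻¹ᵁ W := fun W => hq.preimage_imageOpens hρ (hsat W)
  have hex : ∀ x : Q, ∃ (U : Q.Opens) (W : T.Opens), IsAffineOpen U ∧ IsAffineOpen W ∧ x ∈ U ∧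
      q ⁻¹ᵁ U ≤ f ⁻¹ᵁ W := fun x => by
    obtain ⟨y, rfl⟩ := hq.surjective hρ x
    obtain ⟨_, ⟨W, hW, rfl⟩, hyW, -⟩ :=
      T.isBasis_affineOpens.exists_subset_of_mem_open (Set.mem_univ (f y)) isOpen_univ
    have hyV : y ∈ q ⁻¹ᵁ V W := by rw [hV]; exact hyW
    obtain ⟨_, ⟨U, hU, rfl⟩, hyU, hUV⟩ :=
      Q.isBasis_affineOpens.exists_subset_of_mem_open (show q y ∈ V W from hyV) (V W).isOpen
    exact ⟨U, W, hU, hW, hyU, (q.preimage_mono hUV).trans (hV W).le⟩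
  choose U W hU hW hxU hUW using hex
  -- Functions pulled back along the invariant morphism `f` are invariant, so they come from
  -- functions on the quotient; uniqueness makes the assignment a ring homomorphism.
  have hψ : ∀ x, ∃ ψ : Γ(T, W x) ⟶ Γ(Q, U x), ψ ≫ q.app (U x) = f.appLE _ _ (hUW x) := fun x => by
    have h1 : ∀ s : Γ(T, W x), ∃ t, q.app (U x) t = f.appLE _ _ (hUW x) s := fun s => by
      refine (hq.good _ (hU x)).surj _ fun g hg => ?_
      rw [← ConcreteCategory.comp_apply, Scheme.Hom.appLE_comp_appLE]
      simp only [hf]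
    choose t ht using h1
    have hinj := (hq.good _ (hU x)).inj
    refine ⟨CommRingCat.ofHom
      { toFun := t
        map_one' := hinj (by rw [ht, map_one, map_one])
        map_zero' := hinj (by rw [ht, map_zero, map_zero])
        map_mul' := fun a b => hinj (by rw [ht, map_mul, map_mul, ht, ht])
        map_add' := fun a b => hinj (by rw [ht, map_add, map_add, ht, ht]) }, ?_⟩
    ext s
    exact ht s
  choose ψ hψ using hψ
  let 𝒰 : Q.OpenCover :=
    { I₀ := Q
      X := fun x => Spec Γ(Q, U x)
      f := fun x => (hU x).fromSpec
      mem₀ := by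
        rw [Scheme.presieve₀_mem_precoverage_iff]
        refine ⟨fun x => ⟨x, ?_⟩, fun x => inferInstance⟩
        rw [(hU x).range_fromSpec]
        exact hxU x }
  let φ : ∀ x, Spec Γ(Q, U x) ⟶ T := fun x => Spec.map (ψ x) ≫ (hW x).fromSpec
  have hφ : ∀ (x : Q) {R : Scheme.{0}} (a : R ⟶ Y) (b : R ⟶ Spec Γ(Q, U x)),
      a ≫ q = b ≫ (hU x).fromSpec → b ≫ φ x = a ≫ f := fun x R a b h => by
    have hV := (hU x).preimage q
    let c : R ⟶ Spec Γ(Y, q ⁻¹ᵁ U x) := IsOpenImmersion.lift hV.fromSpec a (by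
      rw [hV.range_fromSpec]
      refine Set.range_subset_iff.2 fun z => ?_
      have h1 : (a ≫ q) z ∈ Set.range (hU x).fromSpec := ⟨b z, by rw [h]; rfl⟩
      rw [(hU x).range_fromSpec] at h1
      exact h1)
    have hca : c ≫ hV.fromSpec = a := IsOpenImmersion.lift_fac _ _ _
    have hcb : c ≫ Spec.map (q.app (U x)) = b := by
      rw [← cancel_mono (hU x).fromSpec, ← h, ← hca, Scheme.Hom.app_eq_appLE, Category.assoc,
        Category.assoc, (hU x).SpecMap_appLE_fromSpec q hV le_rfl]
    rw [← hcb, ← hca]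
    simp only [φ, Category.assoc]
    rw [← Spec.map_comp_assoc, hψ, (hW x).SpecMap_appLE_fromSpec f hV]
  exact hq.exists_desc_of_openCover hρ f 𝒰 φ hφ

end Good

end Motivic

/-! ### Uniqueness, stages, affine schemes and invariant open subschemes -/

namespace Motivic

section Good

variable {G : Type} [Group G] {Y Q : Scheme.{0}} {ρ : G → (Y ⟶ Y)} {q : Y ⟶ Q}

theorem IsGood.comp_iso [Finite G] [IsRational Y] (hρ : IsAct ρ) (hq : IsGood ρ q) {Q' : Scheme.{0}}
    (e : Q ⟶ Q') [IsIso e] : IsGood ρ (q ≫ e) :=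
  IsGood.of_isPullback (IsPullback.of_horiz_isIso ⟨by simp⟩ :
    IsPullback (𝟙 Y) (q ≫ e) q (CategoryTheory.inv e)) hρ hρ
    hq (fun g => by rw [← Category.assoc, hq.inv]) (by simp)

theorem IsGood.isIso_of_comp_eq [Finite G] [IsRational Y] (hρ : IsAct ρ) (hq : IsGood ρ q)
    {Q' : Scheme.{0}} {q' : Y ⟶ Q'} (hq' : IsGood ρ q') [Q.IsSeparated] [Q'.IsSeparated]
    {t : Q' ⟶ Q} (h : q' ≫ t = q) : IsIso t := by
  obtain ⟨s, hs⟩ := hq.isCategorical hρ q' hq'.inv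
  exact ⟨s, hq'.hom_ext (by rw [reassoc_of% h, hs, Category.comp_id]),
    hq.hom_ext (by rw [reassoc_of% hs, h, Category.comp_id])⟩

omit [Group G] in
/-- Good quotients can be taken in stages. -/
theorem IsGood.comp {H K : Type} [Group H] [Group K] {M : Scheme.{0}} {q₁ : Y ⟶ M} {q₂ : M ⟶ Q}
    {ρ₂ : H → (M ⟶ M)} {τ : K → (Y ⟶ Y)} (h₁ : IsGood ρ q₁) (h₂ : IsGood ρ₂ q₂)
    (hinv : ∀ k, τ k ≫ q₁ ≫ q₂ = q₁ ≫ q₂) (α : G → K) (hα : ∀ g, τ (α g) = ρ g) (β : H → K)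
    (hβ : ∀ h, τ (β h) ≫ q₁ = q₁ ≫ ρ₂ h) : IsGood τ (q₁ ≫ q₂) := by
  have := h₁.affine
  have := h₂.affine
  refine ⟨hinv, inferInstance, fun U hU => ?_⟩
  have g₁ := h₁.good _ (hU.preimage q₂)
  have g₂ := h₂.good _ hU
  refine ⟨?_, fun s hs => ?_⟩
  · rw [Scheme.Hom.comp_app]
    exact g₁.inj.comp g₂.inj
  · let V := q₂ ⁻¹ᵁ U
    let W := q₁ ⁻¹ᵁ V
    change Γ(Y, W) at s
    have e : ∀ k, W ≤ τ k ⁻¹ᵁ W := preimage_le_of_inv hinv U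
    have hs' : ∀ k, (τ k).appLE W W (e k) s = s := fun k => hs k _
    have key : ∀ t : Γ(M, V), q₁.appLE V W le_rfl t = q₁.app V t := fun t => by
      rw [Scheme.Hom.appLE_eq_app]
    obtain ⟨t, ht⟩ := g₁.surj s fun g hg => by
      have h1 := hs' (α g)
      simp only [hα] at h1
      exact h1
    -- The function `t` on `M` is `H`-invariant because its pull-back `s` is invariant under `τ (β
    -- h)`, which lifts the action of `h`, and pull-back along `q₁` is injective.
    obtain ⟨r, hr⟩ := g₂.surj t fun h hh => g₁.inj (by
      have E : (ρ₂ h).appLE V V hh ≫ q₁.appLE V W le_rfl =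
          q₁.appLE V W le_rfl ≫ (τ (β h)).appLE W W (e (β h)) := by
        rw [Scheme.Hom.appLE_comp_appLE, Scheme.Hom.appLE_comp_appLE]
        simp only [hβ]
      have E' := DFunLike.congr_fun (congrArg CommRingCat.Hom.hom E) t
      exact (key _).symm.trans (E'.trans (((congrArg ((τ (β h)).appLE W W (e (β h)))
        ((key t).trans ht))).trans ((hs' (β h)).trans ht.symm))))
    refine ⟨r, ?_⟩
    rw [Scheme.Hom.comp_app]
    exact (congrArg (q₁.app V) hr).trans ht

/-- Good quotients of affine schemes by finite groups. -/
theorem exists_isGood_of_isAffine [Finite G] [IsAffine Y] [IsRational Y] (hρ : IsAct ρ) :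
    ∃ (Q : Scheme.{0}) (q : Y ⟶ Q), IsAffine Q ∧ IsGood ρ q := by
  let B : Subring Γ(Y, ⊤) := ⨅ g, RingHom.eqLocus (ρ g).appTop.hom (RingHom.id _)
  have hB : ∀ s, s ∈ B ↔ ∀ g, (ρ g).appTop s = s := fun s => by
    rw [Subring.mem_iInf]; rfl
  let i : CommRingCat.of B ⟶ Γ(Y, ⊤) := CommRingCat.ofHom B.subtype
  have hi : ∀ g, i ≫ (ρ g).appTop = i := fun g => by
    ext s; exact (hB s.1).1 s.2 g
  let q : Y ⟶ Spec (.of B) := Y.toSpecΓ ≫ Spec.map i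
  have hinv : ∀ g, ρ g ≫ q = q := fun g => by
    have h1 := Scheme.toSpecΓ_naturality (ρ g)
    simp only [q]
    rw [← Category.assoc, h1, Category.assoc, ← Spec.map_comp, hi]
  have hq : IsAffineHom q := inferInstance
  have happ : (Scheme.ΓSpecIso (.of B)).inv ≫ q.appTop = i := by
    simp only [q, Scheme.Hom.comp_appTop, Scheme.toSpecΓ_appTop, ← Category.assoc]
    rw [← Scheme.ΓSpecIso_inv_naturality]
    simp
  have happ' : ∀ b : B, q.appTop ((Scheme.ΓSpecIso (.of B)).inv b) = b.1 := fun b =>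
    DFunLike.congr_fun (congrArg CommRingCat.Hom.hom happ) b
  -- The quotient is affine, so the cover by the single open `⊤` suffices, and there goodness is the
  -- definition of the subring of invariants `B`.
  refine ⟨_, q, inferInstance, IsGood.of_cover hρ hinv (fun _ : Unit => ⊤)
    (fun _ => isAffineOpen_top _) (by simp) fun _ => ⟨?_, fun s hs => ?_⟩⟩
  · have h1 : q.app ⊤ = (Scheme.ΓSpecIso (.of B)).hom ≫ i := by
      rw [← happ]; exact (Iso.hom_inv_id_assoc _ _).symm
    rw [h1]
    exact Subtype.val_injective.comp (ConcreteCategory.bijective_of_isIso _).injective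
  · exact ⟨_, happ' ⟨s, (hB s).2 fun g => by
      refine Eq.trans ?_ (hs g le_rfl)
      exact (DFunLike.congr_fun (congrArg CommRingCat.Hom.hom
        (Scheme.Hom.appLE_eq_app (f := ρ g) (U := ⊤))) s).symm⟩⟩

theorem isPullback_of_range {P X Y Z : Scheme.{0}} {p : P ⟶ X} {q : P ⟶ Y} {f : X ⟶ Z}
    {g : Y ⟶ Z} [IsOpenImmersion p] [IsOpenImmersion g] (h : p ≫ f = q ≫ g)
    (hr : f ⁻¹' Set.range g ⊆ Set.range p) : IsPullback p q f g := by
  refine ⟨⟨h⟩, ⟨PullbackCone.IsLimit.mk _ (fun s => IsOpenImmersion.lift p s.fst ?_) ?_ ?_ ?_⟩⟩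
  · refine Set.range_subset_iff.2 fun x => hr ⟨s.snd x, ?_⟩
    rw [← Scheme.Hom.comp_apply, ← Scheme.Hom.comp_apply, s.condition]
  · intro s; exact IsOpenImmersion.lift_fac _ _ _
  · intro s
    rw [← cancel_mono g, Category.assoc, ← h, ← Category.assoc]
    exact (IsOpenImmersion.lift_fac _ _ _ =≫ f).trans s.condition
  · intro s m h1 _
    rw [← cancel_mono p, h1]
    exact (IsOpenImmersion.lift_fac _ _ _).symm

theorem isSeparated_of_hom {X S : Scheme.{0}} (f : X ⟶ S) [IsSeparated f] [S.IsSeparated] :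
    X.IsSeparated :=
  ⟨by rw [← terminal.comp_from f]; infer_instance⟩

instance (X : CSch) : X.toScheme.IsSeparated := isSeparated_of_hom X.obj.hom

/-- The image of `j` is an invariant open, hence the preimage of an open `V` of `Q`. By base change
`Y' ⟶ V` is a good quotient, and uniqueness of good quotients identifies `Q'` with `V`. -/
theorem IsGood.isPullback_of_isOpenImmersion [Finite G] [IsRational Y] (hρ : IsAct ρ)
    (hq : IsGood ρ q) {Y' Q' : Scheme.{0}} {ρ' : G → (Y' ⟶ Y')} (hρ' : IsAct ρ') {q' : Y' ⟶ Q'}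
    (hq' : IsGood ρ' q') [Q.IsSeparated] [Q'.IsSeparated] {j : Y' ⟶ Y} [IsOpenImmersion j]
    (hj : ∀ g, ρ' g ≫ j = j ≫ ρ g) {t : Q' ⟶ Q} (ht : q' ≫ t = j ≫ q) :
    IsOpenImmersion t ∧ IsPullback j q' q t := by
  have : IsRational Y' := .of_hom j
  have hsat : ∀ g, j.opensRange ≤ ρ g ⁻¹ᵁ j.opensRange := by
    rintro g _ ⟨y, rfl⟩
    exact ⟨ρ' g y, by rw [← Scheme.Hom.comp_apply, hj]; rfl⟩
  let V := hq.imageOpens hρ j.opensRange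
  have hV : q ⁻¹ᵁ V = j.opensRange := hq.preimage_imageOpens hρ hsat
  have hjV : ∀ y, q (j y) ∈ V := fun y => by
    have : j y ∈ q ⁻¹ᵁ V := by rw [hV]; exact ⟨y, rfl⟩
    exact this
  have hr : Set.range (j ≫ q) ⊆ Set.range V.ι := by
    rw [Scheme.Opens.range_ι]
    exact Set.range_subset_iff.2 hjV
  let k : Y' ⟶ V := IsOpenImmersion.lift V.ι (j ≫ q) hr
  have hk : k ≫ V.ι = j ≫ q := IsOpenImmersion.lift_fac _ _ _
  have hpb : IsPullback j k q V.ι := isPullback_of_range hk.symm (by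
    rw [Scheme.Opens.range_ι]
    exact fun y hy => hV.le hy)
  have hgood : IsGood ρ' k := IsGood.of_isPullback hpb hρ hρ' hq (fun g => by
    rw [← cancel_mono V.ι, Category.assoc, hk, reassoc_of% (hj g), hq.inv]) hj
  have hrt : Set.range t ⊆ Set.range V.ι := by
    rw [Scheme.Opens.range_ι]
    refine Set.range_subset_iff.2 fun x => ?_
    obtain ⟨y, rfl⟩ := hq'.surjective hρ' x
    rw [← Scheme.Hom.comp_apply, ht]
    exact hjV y
  let t' : Q' ⟶ V := IsOpenImmersion.lift V.ι t hrt
  have ht' : t' ≫ V.ι = t := IsOpenImmersion.lift_fac _ _ _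
  have hqt : q' ≫ t' = k := by rw [← cancel_mono V.ι, Category.assoc, ht', ht, hk]
  have : V.toScheme.IsSeparated := isSeparated_of_hom V.ι
  have : IsIso t' := hgood.isIso_of_comp_eq hρ' hq' hqt
  have hto : IsOpenImmersion t := by rw [← ht']; infer_instance
  refine ⟨hto, isPullback_of_range ht.symm ?_⟩
  refine Set.Subset.trans (Set.preimage_mono (t := Set.range V.ι) ?_) ?_
  · rw [← ht']
    exact Set.range_subset_iff.2 fun x => ⟨t' x, rfl⟩
  · rw [Scheme.Opens.range_ι]
    exact fun y hy => hV.le hy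

end Good

end Motivic

/-! ### Gluing the quotients of the invariant affine open subsets -/

namespace Motivic

theorem IsAffineOpen.inf_of_isSeparated {Y : Scheme.{0}} [Y.IsSeparated] {U V : Y.Opens}
    (hU : IsAffineOpen U) (hV : IsAffineOpen V) : IsAffineOpen (U ⊓ V) := by
  have : IsAffine U.toScheme := hU
  have : IsAffineHom (U.ι ≫ terminal.from Y) := by
    rw [terminal.comp_from]; infer_instance
  have : IsAffineHom U.ι := IsAffineHom.of_comp U.ι (terminal.from Y)
  have h := (hV.preimage U.ι).image_of_isOpenImmersion U.ι
  rwa [Scheme.Hom.image_preimage_eq_opensRange_inf, Scheme.Opens.opensRange_ι] at h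

theorem homOfLE_ι_apply {Y : Scheme.{0}} {U V : Y.Opens} (h : U ≤ V) (y : U.toScheme) :
    V.ι (Y.homOfLE h y) = U.ι y := by
  rw [← Scheme.Hom.comp_apply, Scheme.homOfLE_ι]

section Gluing

variable {G : Type} [Group G] {Y : Scheme.{0}} (ρ : G → (Y ⟶ Y))

/-- The affine open subsets that are invariant under a group action. -/
abbrev InvOpens := {U : Y.Opens // IsAffineOpen U ∧ ∀ g, U ≤ ρ g ⁻¹ᵁ U}

variable {ρ}

/-- The restriction of a group action to an invariant open subset. -/
def resAct (U : InvOpens ρ) (g : G) : U.1.toScheme ⟶ U.1.toScheme := (ρ g).resLE U.1 U.1 (U.2.2 g)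

omit [Group G] in
theorem resAct_ι (U : InvOpens ρ) (g : G) : resAct U g ≫ U.1.ι = U.1.ι ≫ ρ g :=
  Scheme.Hom.resLE_comp_ι _ _

theorem isAct_resAct (hρ : IsAct ρ) (U : InvOpens ρ) : IsAct (resAct U) where
  one := by rw [← cancel_mono U.1.ι, resAct_ι, hρ.one, Category.comp_id, Category.id_comp]
  mul g k := by
    rw [← cancel_mono U.1.ι, resAct_ι, hρ.mul, Category.assoc, resAct_ι, ← Category.assoc,
      ← Category.assoc, resAct_ι]

variable [Finite G] [IsRational Y] (hρ : IsAct ρ)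

include hρ in
theorem exists_isGood_resAct (U : InvOpens ρ) :
    ∃ (Q : Scheme.{0}) (q : U.1.toScheme ⟶ Q), IsAffine Q ∧ IsGood (resAct U) q := by
  have : IsAffine U.1.toScheme := U.2.1
  have : IsRational U.1.toScheme := .of_hom U.1.ι
  exact exists_isGood_of_isAffine (isAct_resAct hρ U)

/-- The quotient of an invariant affine open subset. -/
def affQuot (U : InvOpens ρ) : Scheme.{0} := (exists_isGood_resAct hρ U).choose

/-- The projection to the quotient of an invariant affine open subset. -/
def affProj (U : InvOpens ρ) : U.1.toScheme ⟶ affQuot hρ U :=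
  (exists_isGood_resAct hρ U).choose_spec.choose

instance (U : InvOpens ρ) : IsAffine (affQuot hρ U) :=
  (exists_isGood_resAct hρ U).choose_spec.choose_spec.1

theorem isGood_affProj (U : InvOpens ρ) : IsGood (resAct U) (affProj hρ U) :=
  (exists_isGood_resAct hρ U).choose_spec.choose_spec.2

theorem exists_affMap {U V : InvOpens ρ} (h : U ≤ V) :
    ∃ t : affQuot hρ U ⟶ affQuot hρ V, affProj hρ U ≫ t = Y.homOfLE h ≫ affProj hρ V := by
  have : IsRational U.1.toScheme := .of_hom U.1.ι
  refine (isGood_affProj hρ U).isCategorical (isAct_resAct hρ U) _ fun g => ?_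
  have h1 : resAct U g ≫ Y.homOfLE h = Y.homOfLE h ≫ resAct V g := by
    rw [← cancel_mono V.1.ι, Category.assoc, Category.assoc, resAct_ι, Scheme.homOfLE_ι,
      Scheme.homOfLE_ι_assoc, resAct_ι]
  rw [reassoc_of% h1, (isGood_affProj hρ V).inv]

/-- The morphism between quotients of invariant affine open subsets. -/
def affMap {U V : InvOpens ρ} (h : U ≤ V) : affQuot hρ U ⟶ affQuot hρ V :=
  (exists_affMap hρ h).choose

theorem affProj_affMap {U V : InvOpens ρ} (h : U ≤ V) :
    affProj hρ U ≫ affMap hρ h = Y.homOfLE h ≫ affProj hρ V := (exists_affMap hρ h).choose_spec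

theorem isPullback_affMap {U V : InvOpens ρ} (h : U ≤ V) : IsOpenImmersion (affMap hρ h) ∧
    IsPullback (Y.homOfLE h) (affProj hρ U) (affProj hρ V) (affMap hρ h) := by
  have : IsRational V.1.toScheme := .of_hom V.1.ι
  refine (isGood_affProj hρ V).isPullback_of_isOpenImmersion (isAct_resAct hρ V)
    (isAct_resAct hρ U) (isGood_affProj hρ U) (fun g => ?_) (affProj_affMap hρ h)
  rw [← cancel_mono V.1.ι, Category.assoc, Category.assoc, resAct_ι, Scheme.homOfLE_ι,
    Scheme.homOfLE_ι_assoc, resAct_ι]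

/-- The diagram of quotients of invariant affine open subsets. -/
def affFunctor : InvOpens ρ ⥤ Scheme.{0} where
  obj := affQuot hρ
  map h := affMap hρ h.le
  map_id U := (isGood_affProj hρ U).hom_ext (by
    rw [affProj_affMap, Category.comp_id]; simp)
  map_comp {U V W} a b := (isGood_affProj hρ U).hom_ext (by
    rw [affProj_affMap, ← Category.assoc, affProj_affMap, Category.assoc, affProj_affMap]
    simp)

instance {U V : InvOpens ρ} (h : U ⟶ V) : IsOpenImmersion ((affFunctor hρ).map h) :=
  (isPullback_affMap hρ h.le).1

theorem surjective_affProj (U : InvOpens ρ) : Function.Surjective (affProj hρ U) :=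
  (isGood_affProj hρ U).surjective (isAct_resAct hρ U)

theorem affProj_eq_iff {U : InvOpens ρ} {y y' : U.1.toScheme} :
    affProj hρ U y = affProj hρ U y' ↔ ∃ g, ρ g (U.1.ι y) = U.1.ι y' := by
  have hι : ∀ g (y : U.1.toScheme), U.1.ι (resAct U g y) = ρ g (U.1.ι y) := fun g y => by
    rw [← Scheme.Hom.comp_apply, resAct_ι, Scheme.Hom.comp_apply]
  constructor
  · intro h
    obtain ⟨g, rfl⟩ := (isGood_affProj hρ U).exists_eq (isAct_resAct hρ U) h
    exact ⟨g, (hι g y).symm⟩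
  · rintro ⟨g, hg⟩
    have h1 : resAct U g y = y' := U.1.ι.isOpenEmbedding.injective ((hι g y).trans hg)
    rw [← h1, ← Scheme.Hom.comp_apply, (isGood_affProj hρ U).inv]

theorem affMap_affProj {U V : InvOpens ρ} (h : U ≤ V) (y : U.1.toScheme) :
    affMap hρ h (affProj hρ U y) = affProj hρ V (Y.homOfLE h y) := by
  rw [← Scheme.Hom.comp_apply, affProj_affMap, Scheme.Hom.comp_apply]

variable [Y.IsSeparated]

/-- The intersection of two invariant affine open subsets. -/
def InvOpens.inf (U V : InvOpens ρ) : InvOpens ρ :=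
  ⟨U.1 ⊓ V.1, IsAffineOpen.inf_of_isSeparated U.2.1 V.2.1, fun g _ hy =>
    ⟨U.2.2 g hy.1, V.2.2 g hy.2⟩⟩

/-- Points of the quotients of `U` and `V` with the same image come from points of `Y` in one orbit.
After a translation the representative lies in `U ∩ V`, whose quotient maps to both. This condition
makes the colimit a gluing along open immersions. -/
instance : (affFunctor hρ ⋙ Scheme.forget).IsLocallyDirected where
  cond {U V W} fU fV x x' h := by
    obtain ⟨y, rfl⟩ := surjective_affProj hρ U x
    obtain ⟨y', rfl⟩ := surjective_affProj hρ V x'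
    replace h := (affMap_affProj hρ fU.le y).symm.trans (h.trans (affMap_affProj hρ fV.le y'))
    obtain ⟨g, hg⟩ := (affProj_eq_iff hρ).1 h
    rw [homOfLE_ι_apply, homOfLE_ι_apply] at hg
    have hU : V.1.ι y' ∈ U.1 := by rw [← hg]; exact U.2.2 g y.2
    obtain ⟨z, hz⟩ : ∃ z, (U.inf V).1.ι z = V.1.ι y' := ⟨⟨V.1.ι y', hU, y'.2⟩, rfl⟩
    have hlU : U.inf V ≤ U := inf_le_left (a := U.1)
    have hlV : U.inf V ≤ V := inf_le_right (a := U.1)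
    refine ⟨U.inf V, homOfLE hlU, homOfLE hlV, affProj hρ (U.inf V) z, ?_, ?_⟩
    · refine (affMap_affProj hρ hlU z).trans ((affProj_eq_iff hρ).2 ⟨g, ?_⟩).symm
      rw [homOfLE_ι_apply, hg, hz]
    · refine (affMap_affProj hρ hlV z).trans (congrArg _ (V.1.ι.isOpenEmbedding.injective ?_))
      rw [homOfLE_ι_apply, hz]

/-- The quotients of the invariant affine open subsets, glued together. -/
def gluedQuot : Scheme.{0} := colimit (affFunctor hρ)

/-- The quotient of an invariant affine open subset, as an open subset of the glued quotient. -/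
def gluedι (U : InvOpens ρ) : affQuot hρ U ⟶ gluedQuot hρ := colimit.ι (affFunctor hρ) U

instance (U : InvOpens ρ) : IsOpenImmersion (gluedι hρ U) :=
  inferInstanceAs (IsOpenImmersion (colimit.ι (affFunctor hρ) U))

theorem affMap_gluedι {U V : InvOpens ρ} (h : U ≤ V) :
    affMap hρ h ≫ gluedι hρ V = gluedι hρ U := colimit.w (affFunctor hρ) (homOfLE h)

/-- On the overlap of `U` and `V` both local projections factor through the quotient of the
invariant affine open `U ∩ V`. -/
theorem exists_gluedProj (hcov : ∀ y, ∃ U : InvOpens ρ, y ∈ U.1) :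
    ∃ q : Y ⟶ gluedQuot hρ,
      ∀ U, U.1.ι ≫ q = affProj hρ U ≫ gluedι hρ U := by
  let 𝒰 : Y.OpenCover :=
    { I₀ := InvOpens ρ
      X := fun U => U.1.toScheme
      f := fun U => U.1.ι
      mem₀ := by
        rw [Scheme.presieve₀_mem_precoverage_iff]
        refine ⟨fun y => ?_, fun U => inferInstance⟩
        obtain ⟨U, hU⟩ := hcov y
        exact ⟨U, by rw [Scheme.Opens.range_ι]; exact hU⟩ }
  refine ⟨𝒰.glueMorphisms (fun U => affProj hρ U ≫ gluedι hρ U) ?_,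
    fun U => Scheme.Cover.ι_glueMorphisms 𝒰 _ _ U⟩
  intro (U : InvOpens ρ) (V : InvOpens ρ)
  change pullback.fst U.1.ι V.1.ι ≫ affProj hρ U ≫ gluedι hρ U =
    pullback.snd U.1.ι V.1.ι ≫ affProj hρ V ≫ gluedι hρ V
  have hc := pullback.condition (f := U.1.ι) (g := V.1.ι)
  have hlU : U.inf V ≤ U := inf_le_left (a := U.1)
  have hlV : U.inf V ≤ V := inf_le_right (a := U.1)
  let r : pullback U.1.ι V.1.ι ⟶ (U.inf V).1.toScheme :=
    IsOpenImmersion.lift (U.inf V).1.ι (pullback.fst U.1.ι V.1.ι ≫ U.1.ι) (by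
      rw [Scheme.Opens.range_ι]
      refine Set.range_subset_iff.2 fun x => ⟨(pullback.fst U.1.ι V.1.ι x).2, ?_⟩
      rw [hc]
      exact (pullback.snd U.1.ι V.1.ι x).2)
  have hr : r ≫ (U.inf V).1.ι = pullback.fst U.1.ι V.1.ι ≫ U.1.ι := IsOpenImmersion.lift_fac _ _ _
  have hrU : r ≫ Y.homOfLE hlU = pullback.fst U.1.ι V.1.ι := by
    rw [← cancel_mono U.1.ι, Category.assoc, Scheme.homOfLE_ι, hr]
  have hrV : r ≫ Y.homOfLE hlV = pullback.snd U.1.ι V.1.ι := by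
    rw [← cancel_mono V.1.ι, Category.assoc, Scheme.homOfLE_ι, hr, hc]
  have key : ∀ {W : InvOpens ρ} (h : U.inf V ≤ W),
      Y.homOfLE h ≫ affProj hρ W ≫ gluedι hρ W =
        affProj hρ (U.inf V) ≫ gluedι hρ (U.inf V) := fun {W} h => by
    rw [← affMap_gluedι hρ h, ← Category.assoc, ← affProj_affMap hρ h, Category.assoc]
  rw [← hrU, ← hrV, Category.assoc, Category.assoc, key hlU, key hlV]

-- Functions on the image of an open immersion are the functions on its source. This transports
-- goodness from the local quotients to the open pieces of the glued one.
omit [Group G] [Finite G] [IsRational Y] [Y.IsSeparated] in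
theorem GoodOn.of_isOpenImmersion {Q Y' Q' : Scheme.{0}} {q : Y ⟶ Q} {ρ' : G → (Y' ⟶ Y')}
    {q' : Y' ⟶ Q'} {p : Y' ⟶ Y} {j : Q' ⟶ Q} [IsOpenImmersion p] [IsOpenImmersion j]
    (H : IsPullback p q' q j) (hq : ∀ g, ρ g ≫ q = q)
    (hρ' : ∀ g, ρ' g ≫ p = p ≫ ρ g) (h : GoodOn ρ' q' ⊤) : GoodOn ρ q j.opensRange := by
  let V := j.opensRange
  let W := q ⁻¹ᵁ V
  have hW : W = p.opensRange := by
    ext y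
    constructor
    · rintro ⟨x, hx⟩
      obtain ⟨z, hz, -⟩ := Scheme.exists_preimage_of_isPullback H y x hx.symm
      exact ⟨z, hz⟩
    · rintro ⟨z, rfl⟩
      exact ⟨q' z, by rw [← Scheme.Hom.comp_apply, ← H.w]; rfl⟩
  have hj : (⊤ : Q'.Opens) ≤ j ⁻¹ᵁ V := fun x _ => ⟨x, rfl⟩
  have hp : (⊤ : Y'.Opens) ≤ p ⁻¹ᵁ W := fun x _ => by rw [hW]; exact ⟨x, rfl⟩
  have hbij : ∀ {A B : Scheme.{0}} (f : A ⟶ B) [IsOpenImmersion f] (V : B.Opens)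
      (_ : V = f.opensRange) (h : ⊤ ≤ f ⁻¹ᵁ V), Function.Bijective (f.appLE V ⊤ h) := by
    intro A B f _ V hV h
    have := f.isIso_app V hV.le
    have : IsIso (A.presheaf.map (homOfLE h).op) := by
      have h2 : f ⁻¹ᵁ V = ⊤ := top_le_iff.1 h
      have : IsIso (homOfLE h) := ⟨homOfLE h2.le, rfl, rfl⟩
      infer_instance
    have : IsIso (f.appLE V ⊤ h) := inferInstanceAs (IsIso (f.app V ≫ _))
    exact ConcreteCategory.bijective_of_isIso _
  have hjb := hbij j V rfl hj
  have hpb := hbij p W hW hp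
  have e := preimage_le_of_inv hq V
  have tq' : (⊤ : Y'.Opens) ≤ q' ⁻¹ᵁ ⊤ := fun _ _ => trivial
  have hsq : ∀ s, p.appLE W ⊤ hp (q.app V s) = q'.app ⊤ (j.appLE V ⊤ hj s) := fun s => by
    have tq : W ≤ q ⁻¹ᵁ V := le_rfl
    have E : q.appLE V W tq ≫ p.appLE W ⊤ hp = j.appLE V ⊤ hj ≫ q'.appLE ⊤ ⊤ tq' := by
      rw [Scheme.Hom.appLE_comp_appLE, Scheme.Hom.appLE_comp_appLE]
      simp only [H.w]
    have h1 : ∀ s, q.appLE V W tq s = q.app V s := fun s =>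
      DFunLike.congr_fun (congrArg CommRingCat.Hom.hom (Scheme.Hom.appLE_eq_app (f := q))) s
    have h2 : ∀ s, q'.appLE ⊤ ⊤ tq' s = q'.app ⊤ s := fun s =>
      DFunLike.congr_fun (congrArg CommRingCat.Hom.hom (Scheme.Hom.appLE_eq_app (f := q'))) s
    exact (congrArg _ (h1 s).symm).trans
      ((DFunLike.congr_fun (congrArg CommRingCat.Hom.hom E) s).trans (h2 _))
  refine ⟨fun s t hst => hjb.1 (h.inj ?_), fun s hs => ?_⟩
  · rw [← hsq, ← hsq, hst]
  · change Γ(Y, W) at s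
    obtain ⟨t, ht⟩ := h.surj (p.appLE W ⊤ hp s) fun g hg => by
      have t' : (⊤ : Y'.Opens) ≤ ρ' g ⁻¹ᵁ ⊤ := fun _ _ => trivial
      have E : p.appLE W ⊤ hp ≫ (ρ' g).appLE ⊤ ⊤ t' =
          (ρ g).appLE W W (e g) ≫ p.appLE W ⊤ hp := by
        rw [Scheme.Hom.appLE_comp_appLE, Scheme.Hom.appLE_comp_appLE]
        simp only [hρ']
      exact (DFunLike.congr_fun (congrArg CommRingCat.Hom.hom E) s).trans
        (congrArg (p.appLE W ⊤ hp) (hs g (e g)))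
    obtain ⟨r, rfl⟩ := hjb.2 t
    exact ⟨r, hpb.1 ((hsq r).trans ht)⟩

/-- The glued quotient. -/
theorem isGood_of_gluedProj (hcov : ∀ y, ∃ U : InvOpens ρ, y ∈ U.1)
    {q : Y ⟶ gluedQuot hρ}
    (hq : ∀ U, U.1.ι ≫ q = affProj hρ U ≫ gluedι hρ U) :
    IsGood ρ q ∧ ∀ U : InvOpens ρ, q ⁻¹ᵁ (gluedι hρ U).opensRange = U.1 := by
  have happ : ∀ (U : InvOpens ρ) (y : U.1.toScheme),
      q (U.1.ι y) = gluedι hρ U (affProj hρ U y) := fun U y => by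
    rw [← Scheme.Hom.comp_apply, hq]; rfl
  have hinv : ∀ g, ρ g ≫ q = q := fun g => by
    refine Scheme.hom_ext_of_forall _ _ fun y => ?_
    obtain ⟨U, hU⟩ := hcov y
    refine ⟨U.1, hU, ?_⟩
    rw [← Category.assoc, ← resAct_ι, Category.assoc, hq, ← Category.assoc,
      (isGood_affProj hρ U).inv]
  have hpre : ∀ U : InvOpens ρ, q ⁻¹ᵁ (gluedι hρ U).opensRange = U.1 := by
    intro U
    ext y
    constructor
    · rintro ⟨z, hz⟩
      obtain ⟨V, hV⟩ := hcov y
      obtain ⟨y, rfl⟩ : ∃ y' : V.1.toScheme, V.1.ι y' = y := ⟨⟨y, hV⟩, rfl⟩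
      rw [happ] at hz
      -- Points identified in the colimit come from the quotient of some `W` contained in `U` and
      -- `V`. Hence `y` is a translate of a point of `W`, and it lies in `U` because `U` is
      -- invariant.
      obtain ⟨W, a, b, w, -, hw⟩ := (Scheme.IsLocallyDirected.ι_eq_ι_iff (affFunctor hρ)).1 hz
      obtain ⟨y', rfl⟩ := surjective_affProj hρ W w
      replace hw := (affMap_affProj hρ b.le y').symm.trans hw
      obtain ⟨g, hg⟩ := (affProj_eq_iff hρ).1 hw
      rw [homOfLE_ι_apply] at hg
      rw [← hg]
      exact U.2.2 g (a.le y'.2)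
    · intro hy
      exact ⟨affProj hρ U ⟨y, hy⟩, (happ U ⟨y, hy⟩).symm⟩
  have hpb : ∀ U : InvOpens ρ,
      IsPullback U.1.ι (affProj hρ U) q (gluedι hρ U) := fun U =>
    isPullback_of_range (hq U) (by
      rw [Scheme.Opens.range_ι]
      exact fun y hy => (hpre U).le hy)
  have hcovQ : ⨆ U : InvOpens ρ, (gluedι hρ U).opensRange = ⊤ := by
    refine eq_top_iff.2 fun x _ => ?_
    obtain ⟨U, z, hz⟩ := Scheme.IsLocallyDirected.ι_jointly_surjective (affFunctor hρ) x
    exact TopologicalSpace.Opens.mem_iSup.2 ⟨U, z, hz⟩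
  have haffQ : ∀ U : InvOpens ρ, IsAffineOpen (gluedι hρ U).opensRange := fun U =>
    isAffineOpen_opensRange _
  have haff : IsAffineHom q := isAffineHom_of_forall_exists_isAffineOpen q fun x => by
    obtain ⟨U, hU⟩ := TopologicalSpace.Opens.mem_iSup.1 (hcovQ.ge (show x ∈ ⊤ from trivial))
    exact ⟨_, hU, haffQ U, by rw [hpre]; exact U.2.1⟩
  refine ⟨IsGood.of_cover hρ hinv (fun U : InvOpens ρ => (gluedι hρ U).opensRange) haffQ hcovQ
    fun U => ?_, hpre⟩
  exact GoodOn.of_isOpenImmersion (hpb U) hinv (resAct_ι U)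
    ((isGood_affProj hρ U).good ⊤ (isAffineOpen_top _))

end Gluing

end Motivic

/-! ### Admissibility and existence of finite quotients -/

namespace Motivic

/-- This is the Artin–Tate lemma: `C` is of finite type and integral over `B`, hence a finite
`B`-module, and `A` is noetherian. It yields the finiteness of rings of invariants. -/
theorem finiteType_of_isIntegral {A B C : Type} [CommRing A] [CommRing B] [CommRing C]
    [IsNoetherianRing A] (f : A →+* B) (g : B →+* C) (hgf : (g.comp f).FiniteType)
    (hg : g.IsIntegral) (hi : Function.Injective g) : f.FiniteType := by
  algebraize [f, g, g.comp f]
  have h1 : Algebra.FiniteType A C := hgf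
  have h2 : Algebra.FiniteType B C := Algebra.FiniteType.of_restrictScalars_finiteType A B C
  have h3 : Algebra.IsIntegral B C := ⟨hg⟩
  have h4 : Module.Finite B C := Algebra.IsIntegral.finite
  exact ⟨fg_of_fg_of_fg A B C h1.out h4.fg_top hi⟩

section

variable {G : Type} [Group G] [Finite G] {Y Q : Scheme.{0}} {ρ : G → (Y ⟶ Y)} {q : Y ⟶ Q}

theorem IsGood.locallyOfFiniteType (hρ : IsAct ρ) (hq : IsGood ρ q) {S : Scheme.{0}}
    [IsLocallyNoetherian S] (a : Q ⟶ S) [LocallyOfFiniteType (q ≫ a)] : LocallyOfFiniteType a := by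
  refine ⟨fun {U} hU {V} hV e => ?_⟩
  have := hq.affine
  have := hq.isIntegralHom hρ
  have : IsNoetherianRing Γ(S, U) := IsLocallyNoetherian.component_noetherian ⟨U, hU⟩
  have h1 := LocallyOfFiniteType.finiteType_appLE (f := q ≫ a) hU (hV.preimage q)
    (show q ⁻¹ᵁ V ≤ (q ≫ a) ⁻¹ᵁ U from q.preimage_mono e)
  refine finiteType_of_isIntegral _ (q.app V).hom ?_ (IsIntegralHom.isIntegral_app (f := q) V hV)
    (hq.good V hV).inj
  have h2 : a.appLE U V e ≫ q.app V = (q ≫ a).appLE U (q ⁻¹ᵁ V) (q.preimage_mono e) := by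
    rw [Scheme.Hom.app_eq_appLE, Scheme.Hom.appLE_comp_appLE]
  rw [← CommRingCat.hom_comp, h2]
  exact h1

/-- The image of a component `C` of `Y` is compact and closed; it is also open, since its preimage
is the union of the preimages of `C` under the action and `q` is a quotient map. So it contains the
whole component of the point. -/
theorem IsGood.isCompact_connectedComponent (hρ : IsAct ρ) (hq : IsGood ρ q)
    (hY : ∀ y : Y, IsCompact (connectedComponent y) ∧ IsOpen (connectedComponent y)) (x : Q) :
    IsCompact (connectedComponent x) := by
  obtain ⟨y, rfl⟩ := hq.surjective hρ x
  let C := connectedComponent y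
  have hclosed : IsClosed (q '' C) := hq.isClosedMap hρ _ isClosed_connectedComponent
  have hopen : IsOpen (q '' C) := by
    have h1 : q ⁻¹' (q '' C) = ⋃ g, ρ g ⁻¹' C := by
      ext z
      simp only [Set.mem_preimage, Set.mem_image, Set.mem_iUnion]
      constructor
      · rintro ⟨w, hw, e⟩
        obtain ⟨g, rfl⟩ := hq.exists_eq hρ e.symm
        exact ⟨g, hw⟩
      · rintro ⟨g, hg⟩
        exact ⟨ρ g z, hg, by rw [← Scheme.Hom.comp_apply, hq.inv]⟩
    have h2 : IsOpen (q ⁻¹' (q '' C)) := by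
      rw [h1]
      exact isOpen_iUnion fun g => (hY y).2.preimage (ρ g).continuous
    have h3 := hq.isClosedMap hρ _ h2.isClosed_compl
    rw [← Set.preimage_compl, Set.image_preimage_eq _ (hq.surjective hρ)] at h3
    exact isClosed_compl_iff.1 h3
  exact ((hY y).1.image q.continuous).of_isClosed_subset isClosed_connectedComponent
    (IsClopen.connectedComponent_subset ⟨hclosed, hopen⟩ ⟨y, mem_connectedComponent, rfl⟩)

end

theorem isAffineOpen_finset_inf {Y : Scheme.{0}} [Y.IsSeparated] {ι : Type} (s : Finset ι)
    (hs : s.Nonempty) (U : ι → Y.Opens) (hU : ∀ i, IsAffineOpen (U i)) :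
    IsAffineOpen (s.inf U) := by
  induction hs using Finset.Nonempty.cons_induction with
  | singleton a => simpa using hU a
  | cons a s ha hs ih =>
    rw [Finset.inf_cons]
    exact IsAffineOpen.inf_of_isSeparated (hU a) ih

section

variable {G : Type} [Group G] [Finite G] {Y : CSch} {ρ : G → (Y ⟶ Y)}

omit [Finite G] in
theorem isAct_mor (hρ : IsAct ρ) : IsAct fun g => mor (ρ g) :=
  ⟨congrArg mor hρ.one, fun g k => congrArg mor (hρ.mul g k)⟩

/-- Choose an affine open containing all translates of `s` and intersect its preimages under the
group; separatedness keeps the intersection affine. -/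
theorem exists_invOpens (hρ : IsAct ρ) (s : Set Y.toScheme) (hs : s.Finite) :
    ∃ U : InvOpens fun g => mor (ρ g), s ⊆ (U.1 : Set Y.toScheme) := by
  classical
  have := Fintype.ofFinite G
  have hρ' := isAct_mor hρ
  obtain ⟨W, hW, hsW⟩ := Y.property.2.2 (⋃ g, mor (ρ g) '' s) (Set.finite_iUnion fun g => hs.image _)
  have hiso : ∀ g, IsIso (mor (ρ g)) := fun g => ⟨mor (ρ g⁻¹), by
    have h1 := hρ'.mul g g⁻¹
    have h2 := hρ'.mul g⁻¹ g
    rw [mul_inv_cancel, hρ'.one] at h1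
    rw [inv_mul_cancel, hρ'.one] at h2
    exact ⟨h1.symm, h2.symm⟩⟩
  have hmem : ∀ y : Y.toScheme, y ∈ Finset.univ.inf (fun g => mor (ρ g) ⁻¹ᵁ W) ↔
      ∀ g, mor (ρ g) y ∈ W := fun y => by
    rw [← SetLike.mem_coe, TopologicalSpace.Opens.coe_finset_inf]
    simp
  refine ⟨⟨Finset.univ.inf fun g => mor (ρ g) ⁻¹ᵁ W,
    isAffineOpen_finset_inf _ Finset.univ_nonempty _ fun g => hW.preimage_of_isIso _,
    fun g y hy => ?_⟩, fun y hy => ?_⟩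
  · refine (hmem _).2 fun k => ?_
    rw [← mor_comp_apply, ← hρ.mul]
    exact (hmem y).1 hy _
  · exact (hmem y).2 fun g => hsW (Set.mem_iUnion.2 ⟨g, y, hy, rfl⟩)

/-- Quotients of admissible schemes by finite groups exist. -/
theorem exists_isGood (hρ : IsAct ρ) :
    ∃ (Q : CSch) (q : Y ⟶ Q), IsGood (fun g => mor (ρ g)) (mor q) := by
  have hρ' := isAct_mor hρ
  have hcov : ∀ y, ∃ U : InvOpens fun g => mor (ρ g), y ∈ U.1 := fun y => by
    obtain ⟨U, hU⟩ := exists_invOpens hρ {y} (Set.finite_singleton y)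
    exact ⟨U, hU rfl⟩
  obtain ⟨q, hq⟩ := exists_gluedProj hρ' hcov
  obtain ⟨hgood, hpre⟩ := isGood_of_gluedProj hρ' hcov hq
  obtain ⟨a, ha⟩ := hgood.isCategorical hρ' Y.obj.hom fun g => mor_w (ρ g)
  have hadm : IsAdmissible (Over.mk a) := by
    refine ⟨?_, fun x => ?_, fun (s : Set (gluedQuot hρ')) hs => ?_⟩
    · have : LocallyOfFiniteType (q ≫ a) := by rw [ha]; infer_instance
      exact hgood.locallyOfFiniteType hρ' a
    · exact hgood.isCompact_connectedComponent hρ' (fun y => ⟨Y.property.2.1 y,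
        isOpen_connectedComponent_of_locallyNoetherian y⟩) x
    -- The fibres of `q` are orbits and thus finite, so the preimage of `s` lies in an invariant
    -- affine open, whose quotient is an affine open containing `s`.
    · have hfin : (q ⁻¹' s).Finite := by
        refine hs.preimage' fun x _ => ?_
        obtain ⟨y, rfl⟩ := hgood.surjective hρ' x
        refine (Set.finite_range fun g => mor (ρ g) y).subset fun z hz => ?_
        obtain ⟨g, hg⟩ := hgood.exists_eq hρ' (y := y) (y' := z) hz.symm
        exact ⟨g, hg⟩
      obtain ⟨U, hU⟩ := exists_invOpens hρ _ hfin
      refine ⟨(gluedι hρ' U).opensRange, isAffineOpen_opensRange _, fun x hx => ?_⟩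
      obtain ⟨y, rfl⟩ := hgood.surjective hρ' x
      exact (hpre U).ge (hU hx)
  exact ⟨⟨_, hadm⟩, ofMor q ha, hgood⟩

end

end Motivic

/-! ### Closed subschemes of quotients -/

namespace Motivic

/-- Invariant functions on a closed subset whose translates are disjoint from it, unless they
coincide with it, extend to invariant functions. -/
theorem exists_invariant_lift {A B : Type} [CommRing A] [CommRing B] {G H : Type} [Group G]
    [Finite G] [Group H] (σ : G → (A →+* A)) (τ : H → (B →+* B)) (φ : H →* G) (i : A →+* B)
    (hσ : ∀ g k, σ (g * k) = (σ g).comp (σ k)) (hi : Function.Surjective i)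
    (hiσ : ∀ h a, i (σ (φ h) a) = τ h (i a))
    (hdisj : ∀ g, g ∉ φ.range → RingHom.ker i ⊔ RingHom.ker (i.comp (σ g)) = ⊤)
    (hu : IsUnit ((Nat.card φ.range : ℕ) : A)) (s : B) (hs : ∀ h, τ h s = s) :
    ∃ a, (∀ g, σ g a = a) ∧ i a = s := by
  classical
  have := Fintype.ofFinite G
  obtain ⟨a, rfl⟩ := hi s
  -- By the Chinese remainder argument there is an element `e` which is `1` on the closed subset and
  -- `0` on all its other translates.
  have h1 := Ideal.sup_iInf_eq_top (I := RingHom.ker i)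
    (s := Finset.univ.filter fun g => g ∉ φ.range) (J := fun g => RingHom.ker (i.comp (σ g)))
    fun g hg => hdisj g (Finset.mem_filter.1 hg).2
  obtain ⟨x, hx, e, he, hxe⟩ := Submodule.mem_sup.1 ((Ideal.eq_top_iff_one _).1 h1)
  have hie : i e = 1 := by
    have := congrArg i hxe
    rwa [map_add, map_one, (RingHom.mem_ker).1 hx, zero_add] at this
  have hge : ∀ g, g ∉ φ.range → i (σ g e) = 0 := fun g hg => by
    simp only [Ideal.mem_iInf] at he
    exact he g (Finset.mem_filter.2 ⟨Finset.mem_univ g, hg⟩)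
  obtain ⟨c, hc⟩ := hu.exists_right_inv
  have hcσ : ∀ g, σ g c = c := fun g => by
    have h1 := congrArg (σ g) hc
    rw [map_mul, map_natCast, map_one] at h1
    calc σ g c = (c * (Nat.card φ.range : ℕ)) * σ g c := by rw [mul_comm c, hc, one_mul]
      _ = c := by rw [mul_assoc, h1, mul_one]
  -- On the closed subset only the `g` in the image of `φ` contribute, each giving `i a`. Hence the
  -- normalising factor `c` inverts the order of that image and not the order of `G`.
  refine ⟨c * ∑ g, σ g (e * a), fun g => ?_, ?_⟩
  · rw [map_mul, hcσ, map_sum]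
    congr 1
    refine Fintype.sum_equiv (Equiv.mulLeft g) _ _ fun k => ?_
    rw [Equiv.coe_mulLeft, hσ]; rfl
  · have h2 : ∀ g, i (σ g (e * a)) = if g ∈ φ.range then i a else 0 := fun g => by
      split_ifs with hg
      · obtain ⟨h, rfl⟩ := hg
        rw [hiσ, map_mul, hie, one_mul, hs]
      · rw [map_mul, map_mul, hge g hg, zero_mul]
    rw [map_mul, map_sum]
    simp only [h2]
    rw [← Finset.sum_filter, Finset.sum_const, nsmul_eq_mul, ← mul_assoc]
    have h3 : (Finset.univ.filter fun g => g ∈ φ.range).card = Nat.card φ.range := by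
      rw [Nat.card_eq_fintype_card, Fintype.card_subtype]
    rw [h3, ← map_natCast i, ← map_mul, mul_comm c, hc, map_one, one_mul]

theorem exists_vanishingPrime_eq {X : Scheme.{0}} {U : X.Opens} (hU : IsAffineOpen U)
    (p : Ideal Γ(X, U)) [hp : p.IsPrime] : ∃ (x : X) (hx : x ∈ U), vanishingPrime x hx = p := by
  let z : PrimeSpectrum Γ(X, U) := ⟨p, hp⟩
  have hx : hU.fromSpec z ∈ U := by
    have : hU.fromSpec z ∈ Set.range hU.fromSpec := ⟨z, rfl⟩
    rwa [hU.range_fromSpec] at this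
  refine ⟨hU.fromSpec z, hx, ?_⟩
  ext f
  refine not_iff_not.1 ((notMem_vanishingPrime hx f).trans ?_)
  change z ∈ hU.fromSpec ⁻¹ᵁ X.basicOpen f ↔ _
  rw [hU.fromSpec_preimage_basicOpen]
  rfl

/-- Functions on an affine scheme separate closed subschemes with disjoint images. -/
theorem ker_sup_ker_eq_top {X W W' : Scheme.{0}} {U : X.Opens} (hU : IsAffineOpen U) (f : W ⟶ X)
    (g : W' ⟶ X) [IsClosedImmersion f] [IsClosedImmersion g]
    (h : ∀ w w', f w ≠ g w') : RingHom.ker (f.app U).hom ⊔ RingHom.ker (g.app U).hom = ⊤ := by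
  have key : ∀ {W : Scheme.{0}} (f : W ⟶ X) [IsClosedImmersion f] (m : Ideal Γ(X, U)) [m.IsPrime],
      RingHom.ker (f.app U).hom ≤ m → ∃ w, ∃ hw : f w ∈ U, vanishingPrime (f w) hw = m := by
    intro W f _ m _ hm
    have hs : Function.Surjective (f.app U).hom := f.app_surjective U hU
    have : (m.map (f.app U).hom).IsPrime := Ideal.map_isPrime_of_surjective hs hm
    obtain ⟨w, hw, hwm⟩ := exists_vanishingPrime_eq (hU.preimage f) (m.map (f.app U).hom)
    refine ⟨w, hw, ?_⟩
    rw [← comap_vanishingPrime f le_rfl hw, Scheme.Hom.appLE_eq_app, hwm,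
      Ideal.comap_map_of_surjective _ hs, ← RingHom.ker_eq_comap_bot]
    exact sup_eq_left.2 hm
  by_contra hne
  obtain ⟨m, hm, hle⟩ := Ideal.exists_le_maximal _ hne
  obtain ⟨w, hw, h1⟩ := key f m (le_sup_left.trans hle)
  obtain ⟨w', hw', h2⟩ := key g m (le_sup_right.trans hle)
  exact h w w' (eq_of_vanishingPrime_eq hU hw hw' (h1.trans h2.symm))

theorem IsGood.isAffine {G : Type} [Group G] [Finite G] {Y Q : Scheme.{0}} {ρ : G → (Y ⟶ Y)}
    {q : Y ⟶ Q} [IsRational Y] [IsAffine Y] [Q.IsSeparated] (hρ : IsAct ρ) (hq : IsGood ρ q) :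
    IsAffine Q := by
  obtain ⟨Q', q', _, hq'⟩ := exists_isGood_of_isAffine hρ
  obtain ⟨t, ht⟩ := hq'.isCategorical hρ q hq.inv
  have := hq.isIso_of_comp_eq hρ hq' ht
  exact IsAffine.of_isIso (CategoryTheory.inv t)

/-- Restriction of `q` to the invariant affine open `q⁻¹(U)` is a good quotient, and by uniqueness a
good quotient of an affine scheme is the spectrum of the invariants. -/
theorem IsGood.isAffineOpen {G : Type} [Group G] [Finite G] {Y Q : Scheme.{0}} {ρ : G → (Y ⟶ Y)}
    {q : Y ⟶ Q} [IsRational Y] [Q.IsSeparated] (hρ : IsAct ρ) (hq : IsGood ρ q)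
    {U : Q.Opens} (hU : IsAffineOpen (q ⁻¹ᵁ U)) : IsAffineOpen U := by
  have : IsAffine (q ⁻¹ᵁ U).toScheme := hU
  have : IsRational (q ⁻¹ᵁ U).toScheme := .of_hom (q ⁻¹ᵁ U).ι
  have : U.toScheme.IsSeparated := isSeparated_of_hom U.ι
  let ρ' : G → ((q ⁻¹ᵁ U).toScheme ⟶ (q ⁻¹ᵁ U).toScheme) := fun g =>
    (ρ g).resLE _ _ (preimage_le_of_inv hq.inv U g)
  have hρ'ι : ∀ g, ρ' g ≫ (q ⁻¹ᵁ U).ι = (q ⁻¹ᵁ U).ι ≫ ρ g := fun g => Scheme.Hom.resLE_comp_ι _ _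
  have hρ' : IsAct ρ' := by
    refine ⟨?_, fun g k => ?_⟩
    · rw [← cancel_mono (q ⁻¹ᵁ U).ι, hρ'ι, hρ.one, Category.comp_id, Category.id_comp]
    · rw [← cancel_mono (q ⁻¹ᵁ U).ι, hρ'ι, hρ.mul, Category.assoc, hρ'ι, ← Category.assoc,
        ← Category.assoc, hρ'ι]
  have hg : IsGood ρ' (q ∣_ U) := IsGood.of_isPullback (isPullback_morphismRestrict q U).flip hρ hρ'
    hq (fun g => by
      rw [← cancel_mono U.ι, Category.assoc, morphismRestrict_ι, reassoc_of% (hρ'ι g), hq.inv])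
    hρ'ι
  exact hg.isAffine hρ'

/-- The quotient of a closed subset whose translates are disjoint from it, unless they coincide with
it, by its stabilizer is a closed subset of the quotient. -/
theorem IsGood.isClosedImmersion {G H : Type} [Group G] [Finite G] [Group H] [Finite H]
    {Y Q W P : Scheme.{0}} {ρ : G → (Y ⟶ Y)} {q : Y ⟶ Q} {τ : H → (W ⟶ W)} {r : W ⟶ P}
    [IsRational Y] [P.IsSeparated] (hρ : IsAct ρ) (hτ : IsAct τ) (hq : IsGood ρ q)
    (hr : IsGood τ r) (φ : H →* G) {i : W ⟶ Y} [IsClosedImmersion i]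
    (hi : ∀ h, τ h ≫ i = i ≫ ρ (φ h)) (hdisj : ∀ g ∉ φ.range, ∀ w w', i w ≠ ρ g (i w'))
    {t : P ⟶ Q} (ht : r ≫ t = i ≫ q) : IsClosedImmersion t := by
  have : IsRational W := .of_hom i
  have := hq.affine
  have hpre : ∀ U : Q.Opens, r ⁻¹ᵁ (t ⁻¹ᵁ U) = i ⁻¹ᵁ (q ⁻¹ᵁ U) := fun U => by
    rw [← Scheme.Hom.comp_preimage, ht, Scheme.Hom.comp_preimage]
  have haff : ∀ U : Q.Opens, IsAffineOpen U → IsAffineOpen (t ⁻¹ᵁ U) := fun U hU =>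
    hr.isAffineOpen hτ (by rw [hpre]; exact (hU.preimage q).preimage i)
  -- It remains to lift a function `s` on `t⁻¹(U)`. Its pull-back to `W` is `H`-invariant, extends
  -- to a `G`-invariant function on `q⁻¹(U)`, and the latter descends to `U`.
  refine isClosedImmersion_iff_isAffineHom.2 ⟨⟨fun U hU => haff U hU⟩, fun U hU s => ?_⟩
  let V := q ⁻¹ᵁ U
  have hV : IsAffineOpen V := hU.preimage q
  let M := i ⁻¹ᵁ V
  have hM : M ≤ r ⁻¹ᵁ (t ⁻¹ᵁ U) := (hpre U).ge
  have e := preimage_le_of_inv hq.inv U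
  have e' : ∀ h, M ≤ τ h ⁻¹ᵁ M := fun h => by
    have h1 : M ≤ (i ≫ ρ (φ h)) ⁻¹ᵁ V := i.preimage_mono (e (φ h))
    rw [← hi] at h1
    exact h1
  have hiV : M ≤ i ⁻¹ᵁ V := le_rfl
  have happ : ∀ a, i.appLE V M hiV a = i.app V a := fun a =>
    DFunLike.congr_fun (congrArg CommRingCat.Hom.hom (Scheme.Hom.appLE_eq_app (f := i))) a
  have hiso : ∀ g, IsIso (ρ g) := fun g => ⟨ρ g⁻¹, by
    rw [← hρ.mul, ← hρ.mul, mul_inv_cancel, inv_mul_cancel]; exact ⟨hρ.one, hρ.one⟩⟩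
  obtain ⟨b, hb, hbs⟩ := exists_invariant_lift (fun g => ((ρ g).appLE V V (e g)).hom)
    (fun h => ((τ h).appLE M M (e' h)).hom) φ (i.appLE V M hiV).hom
    (fun g k => by rw [← CommRingCat.hom_comp, Scheme.Hom.appLE_comp_appLE]; simp only [hρ.mul])
    (by
      have h1 := i.app_surjective V hV
      intro b
      obtain ⟨a, ha⟩ := h1 b
      exact ⟨a, (happ a).trans ha⟩)
    (fun h a => by
      have E : (ρ (φ h)).appLE V V (e _) ≫ i.appLE V M hiV =
          i.appLE V M hiV ≫ (τ h).appLE M M (e' h) := by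
        rw [Scheme.Hom.appLE_comp_appLE, Scheme.Hom.appLE_comp_appLE]
        simp only [hi]
      exact DFunLike.congr_fun (congrArg CommRingCat.Hom.hom E) a)
    (fun g hg => by
      have h1 := ker_sup_ker_eq_top hV i (i ≫ ρ g) (fun w w' => hdisj g hg w w')
      rw [← top_le_iff, ← h1]
      refine sup_le_sup (fun a ha => ?_) fun a ha => ?_
      · exact (happ a).trans ha
      · rw [RingHom.mem_ker] at ha ⊢
        have hM' : M ≤ (i ≫ ρ g) ⁻¹ᵁ V := by
          rw [Scheme.Hom.comp_preimage]; exact i.preimage_mono (e g)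
        have h2 : (i.appLE V M hiV).hom.comp ((ρ g).appLE V V (e g)).hom =
            ((i ≫ ρ g).app V ≫ W.presheaf.map (homOfLE hM').op).hom := by
          rw [← CommRingCat.hom_comp, Scheme.Hom.appLE_comp_appLE]
          rfl
        rw [h2, CommRingCat.hom_comp, RingHom.comp_apply, ha, map_zero])
    (IsRational.isUnit_natCast _ _ Nat.card_pos.ne')
    (r.appLE (t ⁻¹ᵁ U) M hM s) (fun h => by
      have E : r.appLE (t ⁻¹ᵁ U) M hM ≫ (τ h).appLE M M (e' h) = r.appLE (t ⁻¹ᵁ U) M hM := by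
        rw [Scheme.Hom.appLE_comp_appLE]
        simp only [hr.inv]
      exact DFunLike.congr_fun (congrArg CommRingCat.Hom.hom E) s)
  obtain ⟨c, rfl⟩ := (hq.good U hU).surj b fun g _ => hb g
  -- Functions on `P` are compared after pull-back to `W`, where pull-back along `r` is injective.
  refine ⟨c, (hr.good _ (haff U hU)).inj ?_⟩
  have hM2 : r ⁻¹ᵁ (t ⁻¹ᵁ U) ≤ M := (hpre U).le
  have tq : V ≤ q ⁻¹ᵁ U := le_rfl
  have tt : t ⁻¹ᵁ U ≤ t ⁻¹ᵁ U := le_rfl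
  have E : t.appLE U (t ⁻¹ᵁ U) tt ≫ r.appLE (t ⁻¹ᵁ U) M hM = q.appLE U V tq ≫ i.appLE V M hiV := by
    rw [Scheme.Hom.appLE_comp_appLE, Scheme.Hom.appLE_comp_appLE]
    simp only [ht]
  have hqa : q.appLE U V tq c = q.app U c :=
    DFunLike.congr_fun (congrArg CommRingCat.Hom.hom (Scheme.Hom.appLE_eq_app (f := q))) c
  have hta : t.appLE U (t ⁻¹ᵁ U) tt c = t.app U c :=
    DFunLike.congr_fun (congrArg CommRingCat.Hom.hom (Scheme.Hom.appLE_eq_app (f := t))) c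
  have h3 : r.appLE (t ⁻¹ᵁ U) M hM (t.app U c) = r.appLE (t ⁻¹ᵁ U) M hM s := by
    rw [← hta]
    exact (DFunLike.congr_fun (congrArg CommRingCat.Hom.hom E) c).trans
      ((congrArg (i.appLE V M hiV) hqa).trans hbs)
  have h4 := congrArg (W.presheaf.map (homOfLE hM2).op) h3
  have h5 : r.appLE (t ⁻¹ᵁ U) M hM ≫ W.presheaf.map (homOfLE hM2).op = r.app (t ⁻¹ᵁ U) := by
    rw [Scheme.Hom.appLE_map, Scheme.Hom.appLE_eq_app]
  have h6 : ∀ z, W.presheaf.map (homOfLE hM2).op (r.appLE (t ⁻¹ᵁ U) M hM z) = r.app (t ⁻¹ᵁ U) z :=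
    fun z => DFunLike.congr_fun (congrArg CommRingCat.Hom.hom h5) z
  exact (h6 _).symm.trans (h4.trans (h6 _))

end Motivic

namespace Motivic

/-! ### Products of morphisms -/

theorem isPullback_prodMap_fst {C : Type*} [Category C] [HasBinaryProducts C] {X X' : C}
    (u : X ⟶ X') (Y : C) :
    IsPullback (prod.fst : X ⨯ Y ⟶ X) (prod.map u (𝟙 Y)) u prod.fst := by
  refine ⟨⟨by simp⟩, ⟨PullbackCone.IsLimit.mk _ (fun s => prod.lift s.fst (s.snd ≫ prod.snd))
    (fun s => prod.lift_fst _ _) (fun s => ?_) fun s m h₁ h₂ => ?_⟩⟩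
  · ext
    · simpa [prod.lift_fst, prod.lift_snd] using s.condition
    · simp [prod.lift_snd]
  · ext
    · simpa [prod.lift_fst, prod.lift_snd] using h₁
    · simpa [prod.lift_fst, prod.lift_snd] using h₂ =≫ prod.snd

theorem isPullback_prodMap_snd {C : Type*} [Category C] [HasBinaryProducts C] (X : C) {Y Y' : C}
    (v : Y ⟶ Y') :
    IsPullback (prod.snd : X ⨯ Y ⟶ Y) (prod.map (𝟙 X) v) v prod.snd := by
  refine ⟨⟨by simp⟩, ⟨PullbackCone.IsLimit.mk _ (fun s => prod.lift (s.snd ≫ prod.fst) s.fst)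
    (fun s => prod.lift_snd _ _) (fun s => ?_) fun s m h₁ h₂ => ?_⟩⟩
  · ext
    · simp [prod.lift_fst]
    · simpa [prod.lift_fst, prod.lift_snd] using s.condition
  · ext
    · simpa [prod.lift_fst, prod.lift_snd] using h₂ =≫ prod.fst
    · simpa [prod.lift_fst, prod.lift_snd] using h₁

section

variable (P : MorphismProperty CSch) [P.IsStableUnderBaseChange] [P.IsMultiplicative]

theorem prodMap_mem {X X' Y Y' : CSch} {u : X ⟶ X'} {v : Y ⟶ Y'} (hu : P u) (hv : P v) :
    P (prod.map u v) := by
  have : prod.map u v = prod.map u (𝟙 Y) ≫ prod.map (𝟙 X') v := by simp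
  rw [this]
  exact P.comp_mem _ _ (P.of_isPullback (isPullback_prodMap_fst u Y) hu)
    (P.of_isPullback (isPullback_prodMap_snd X' v) hv)

end

/-- Morphisms of finite type, as a property of morphisms. -/
def ftProp : MorphismProperty CSch := fun _ _ u => FT u

/-- Closed immersions, as a property of morphisms. -/
def closedProp : MorphismProperty CSch := fun _ _ u => IsClosedImmersion (mor u)

/-- Open immersions, as a property of morphisms. -/
def openProp : MorphismProperty CSch := fun _ _ u => IsOpenImmersion (mor u)

instance : ftProp.IsMultiplicative where
  id_mem := FT.id
  comp_mem _ _ := FT.comp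

instance : ftProp.IsStableUnderBaseChange where
  of_isPullback h hg := FT.of_isPullback h.flip hg

instance : closedProp.IsMultiplicative where
  id_mem X := inferInstanceAs (IsClosedImmersion (𝟙 X.toScheme))
  comp_mem u v hu hv := by
    have : IsClosedImmersion (mor u) := hu
    have : IsClosedImmersion (mor v) := hv
    exact inferInstanceAs (IsClosedImmersion (mor u ≫ mor v))

instance : closedProp.IsStableUnderBaseChange where
  of_isPullback h hg := isClosedImmersion_of_isPullback h.flip hg

instance : openProp.IsMultiplicative where
  id_mem X := inferInstanceAs (IsOpenImmersion (𝟙 X.toScheme))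
  comp_mem u v hu hv := by
    have : IsOpenImmersion (mor u) := hu
    have : IsOpenImmersion (mor v) := hv
    exact inferInstanceAs (IsOpenImmersion (mor u ≫ mor v))

instance : openProp.IsStableUnderBaseChange where
  of_isPullback h hg := isOpenImmersion_of_isPullback h.flip hg

theorem FT.prodMap {X X' Y Y' : CSch} {u : X ⟶ X'} {v : Y ⟶ Y'} (hu : FT u) (hv : FT v) :
    FT (prod.map u v) := prodMap_mem ftProp hu hv

/-- The product morphism is a composite of base changes of `u` and `v`, and the range of a base
change is the preimage of the range. Points of a product are not pairs of points, so this needs the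
surjectivity properties of fibre products. -/
theorem range_prodMap {X X' Y Y' : CSch} (u : X ⟶ X') (v : Y ⟶ Y') :
    Set.range (mor (prod.map u v)) = {z | mor (prod.fst : X' ⨯ Y' ⟶ X') z ∈ Set.range (mor u) ∧
      mor (prod.snd : X' ⨯ Y' ⟶ Y') z ∈ Set.range (mor v)} := by
  have hfst := range_of_isPullback (isPullback_prodMap_fst u Y).flip
  have hsnd := range_of_isPullback (isPullback_prodMap_snd X' v).flip
  ext z
  constructor
  · rintro ⟨w, rfl⟩
    refine ⟨⟨mor prod.fst w, ?_⟩, ⟨mor prod.snd w, ?_⟩⟩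
    · rw [← mor_comp_apply, ← mor_comp_apply, prod.map_fst]
    · rw [← mor_comp_apply, ← mor_comp_apply, prod.map_snd]
  · rintro ⟨h1, h2⟩
    obtain ⟨w, rfl⟩ := hsnd.ge h2
    have h3 : w ∈ Set.range (mor (prod.map u (𝟙 Y))) := by
      rw [hfst]
      rw [← mor_comp_apply, prod.map_fst, Category.comp_id] at h1
      exact h1
    obtain ⟨w', rfl⟩ := h3
    refine ⟨w', ?_⟩
    rw [← mor_comp_apply]
    simp only [prod.map_map, Category.comp_id, Category.id_comp]

/-! ### Powers -/

section Concat

variable {l m n : ℕ} (h : l + m = n) (X : CSch)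

/-- The index of a coordinate of the first factor. -/
def idxL (a : Fin l) : Fin n := ⟨a, by omega⟩

/-- The index of a coordinate of the second factor. -/
def idxR (b : Fin m) : Fin n := ⟨l + b, by omega⟩

theorem idx_cases (k : Fin n) : (∃ a, k = idxL h a) ∨ ∃ b, k = idxR h b := by
  by_cases hk : (k : ℕ) < l
  · exact .inl ⟨⟨k, hk⟩, rfl⟩
  · exact .inr ⟨⟨k - l, by omega⟩, Fin.ext (by simp [idxR]; omega)⟩

theorem concat_idxL (a : Fin l) : concat h X ≫ Pi.π (fun _ : Fin n => X) (idxL h a) =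
    prod.fst ≫ Pi.π (fun _ : Fin l => X) a := by
  simp [concat, idxL]

theorem concat_idxR (b : Fin m) : concat h X ≫ Pi.π (fun _ : Fin n => X) (idxR h b) =
    prod.snd ≫ Pi.π (fun _ : Fin m => X) b := by
  simp [concat, idxR]

/-- The inverse of the concatenation isomorphism. -/
def unconcat : pow n X ⟶ pow l X ⨯ pow m X :=
  prod.lift (Pi.lift fun a => Pi.π (fun _ : Fin n => X) (idxL h a))
    (Pi.lift fun b => Pi.π (fun _ : Fin n => X) (idxR h b))

theorem concat_unconcat : concat h X ≫ unconcat h X = 𝟙 _ := by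
  refine Limits.prod.hom_ext (Pi.hom_ext _ _ fun a => ?_) (Pi.hom_ext _ _ fun b => ?_)
  · rw [Category.assoc, Category.assoc, unconcat, prod.lift_fst_assoc, Pi.lift_π, concat_idxL,
      Category.id_comp]
  · rw [Category.assoc, Category.assoc, unconcat, prod.lift_snd_assoc, Pi.lift_π, concat_idxR,
      Category.id_comp]

theorem unconcat_concat : unconcat h X ≫ concat h X = 𝟙 _ := by
  apply Pi.hom_ext
  intro k
  rw [Category.assoc, Category.id_comp]
  obtain ⟨a, rfl⟩ | ⟨b, rfl⟩ := idx_cases h k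
  · rw [concat_idxL, unconcat, prod.lift_fst_assoc, Pi.lift_π]
  · rw [concat_idxR, unconcat, prod.lift_snd_assoc, Pi.lift_π]

instance : IsIso (concat h X) := ⟨unconcat h X, concat_unconcat h X, unconcat_concat h X⟩

variable {X} in
theorem prodMap_concat {Y : CSch} (u : X ⟶ Y) :
    prod.map (powMap l u) (powMap m u) ≫ concat h Y = concat h X ≫ powMap n u := by
  apply Pi.hom_ext
  intro k
  rw [Category.assoc, Category.assoc]
  have : powMap n u ≫ Pi.π (fun _ : Fin n => Y) k = Pi.π (fun _ : Fin n => X) k ≫ u := by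
    simp [powMap]
  rw [this]
  obtain ⟨a, rfl⟩ | ⟨b, rfl⟩ := idx_cases h k
  · rw [concat_idxL, ← Category.assoc (concat h X), concat_idxL]; simp [powMap]
  · rw [concat_idxR, ← Category.assoc (concat h X), concat_idxR]; simp [powMap]

end Concat

theorem powMap_π {n : ℕ} {X Y : CSch} (u : X ⟶ Y) (k : Fin n) :
    powMap n u ≫ Pi.π (fun _ : Fin n => Y) k = Pi.π (fun _ : Fin n => X) k ≫ u := by
  simp [powMap]

theorem permute_π {n : ℕ} (X : CSch) (τ : Equiv.Perm (Fin n)) (k : Fin n) :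
    permute X τ ≫ Pi.π (fun _ : Fin n => X) k = Pi.π (fun _ : Fin n => X) (τ k) := by
  simp [permute]

/-- The isomorphism `X^1 ≅ X`. -/
def powOne (X : CSch) : pow 1 X ≅ X where
  hom := Pi.π (fun _ : Fin 1 => X) 0
  inv := Pi.lift fun _ => 𝟙 X
  hom_inv_id := by
    apply Pi.hom_ext
    intro k
    rw [Subsingleton.elim k 0]
    simp
  inv_hom_id := by simp

theorem isIso_of_pow_zero {X Y : CSch} (f : pow 0 X ⟶ pow 0 Y) : IsIso f :=
  ⟨Pi.lift fun k => k.elim0, Pi.hom_ext _ _ fun k => k.elim0, Pi.hom_ext _ _ fun k => k.elim0⟩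

/-- Induction through the concatenation isomorphism `X^1 × X^n ≅ X^(n+1)`. -/
theorem powMap_mem (P : MorphismProperty CSch) [P.IsStableUnderBaseChange] [P.IsMultiplicative]
    (n : ℕ) {X Y : CSch} {u : X ⟶ Y} (hu : P u) : P (powMap n u) := by
  induction n with
  | zero =>
    have := isIso_of_pow_zero (powMap 0 u)
    exact P.of_isIso _
  | succ n ih =>
    have h1 : P (powMap 1 u) := by
      refine (P.arrow_mk_iso_iff (Arrow.isoMk (powOne X) (powOne Y) ?_)).2 hu
      exact (powMap_π u 0).symm
    have h2 := prodMap_concat (Nat.add_comm 1 n) u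
    rw [← IsIso.inv_comp_eq] at h2
    rw [← h2]
    exact P.comp_mem _ _ (P.of_isIso _) (P.comp_mem _ _ (prodMap_mem P h1 ih) (P.of_isIso _))

theorem FT.powMap (n : ℕ) {X Y : CSch} {u : X ⟶ Y} (hu : FT u) : FT (powMap n u) :=
  powMap_mem ftProp n hu

theorem surjective_concat {l m n : ℕ} (h : l + m = n) (X : CSch) :
    Function.Surjective (mor (concat h X)) := by
  intro y
  refine ⟨mor (unconcat h X) y, ?_⟩
  rw [← mor_comp_apply, unconcat_concat]
  rfl

theorem range_powMap (n : ℕ) {X Y : CSch} (u : X ⟶ Y) : Set.range (mor (powMap n u)) =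
    {y | ∀ k, mor (Pi.π (fun _ : Fin n => Y) k) y ∈ Set.range (mor u)} := by
  refine Set.Subset.antisymm ?_ ?_
  · refine Set.range_subset_iff.2 fun x k => ⟨mor (Pi.π (fun _ : Fin n => X) k) x, ?_⟩
    rw [← mor_comp_apply, ← mor_comp_apply, powMap_π]
  · induction n with
    | zero =>
      intro y _
      have := isIso_of_pow_zero (powMap 0 u)
      exact ⟨mor (inv (powMap 0 u)) y, by rw [← mor_comp_apply, IsIso.inv_hom_id]; rfl⟩
    | succ n ih =>
      intro y hy
      let h := Nat.add_comm 1 n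
      obtain ⟨z, rfl⟩ := surjective_concat h Y y
      have hz : z ∈ Set.range (mor (prod.map (powMap 1 u) (powMap n u))) := by
        rw [range_prodMap]
        constructor
        · have h0 := hy (idxL h 0)
          rw [← mor_comp_apply, concat_idxL] at h0
          obtain ⟨x, hx⟩ := h0
          refine ⟨mor (powOne X).inv x, ?_⟩
          rw [← mor_comp_apply]
          have h1 : (powOne X).inv ≫ powMap 1 u = u ≫ (powOne Y).inv := by
            rw [Iso.inv_comp_eq, ← Category.assoc, Iso.eq_comp_inv]
            exact powMap_π u 0
          rw [h1, mor_comp_apply, hx, ← mor_comp_apply]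
          have h2 : (prod.fst ≫ Pi.π (fun _ : Fin 1 => Y) 0) ≫ (powOne Y).inv =
              (prod.fst : pow 1 Y ⨯ pow n Y ⟶ pow 1 Y) := by
            rw [Category.assoc]
            exact ((_ ≫= (powOne Y).hom_inv_id)).trans (Category.comp_id _)
          rw [h2]
        · refine ih fun k => ?_
          have h0 := hy (idxR h k)
          rw [← mor_comp_apply, concat_idxR] at h0
          exact h0
      obtain ⟨w, rfl⟩ := hz
      refine ⟨mor (concat h X) w, ?_⟩
      rw [← mor_comp_apply, ← mor_comp_apply, prodMap_concat]

end Motivic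

namespace Motivic

/-! ### Symmetric powers -/

theorem isAct_permute (n : ℕ) (X : CSch) : IsAct fun τ : Equiv.Perm (Fin n) => permute X τ where
  one := Pi.hom_ext _ _ fun k => by rw [permute_π, Category.id_comp]; rfl
  mul g k := Pi.hom_ext _ _ fun i => by rw [permute_π, Category.assoc, permute_π, permute_π]; rfl

section Good

variable {G : Type} [Group G] [Finite G] {Y Q : CSch} {ρ : G → (Y ⟶ Y)} {q : Y ⟶ Q}

omit [Group G] [Finite G] in
theorem IsGood.hom_ext_mor (hq : IsGood (fun g => mor (ρ g)) (mor q)) {T : CSch} {f g : Q ⟶ T}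
    (h : q ≫ f = q ≫ g) : f = g :=
  mor_injective (hq.hom_ext (congrArg mor h))

theorem IsGood.exists_desc (hρ : IsAct ρ) (hq : IsGood (fun g => mor (ρ g)) (mor q)) {T : CSch}
    (f : Y ⟶ T) (hf : ∀ g, ρ g ≫ f = f) : ∃ t : Q ⟶ T, q ≫ t = f := by
  obtain ⟨a, ha⟩ := hq.isCategorical (isAct_mor hρ) (mor f) fun g => congrArg mor (hf g)
  refine ⟨ofMor a (hq.hom_ext ?_), mor_injective ha⟩
  rw [reassoc_of% ha, mor_w, mor_w]

omit [Group G] [Finite G] in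
theorem IsGood.inv_mor (hq : IsGood (fun g => mor (ρ g)) (mor q)) (g : G) : ρ g ≫ q = q :=
  mor_injective (hq.inv g)

omit [Group G] [Finite G] in
theorem IsGood.ft (hq : IsGood (fun g => mor (ρ g)) (mor q)) : FT q :=
  have := hq.affine
  ⟨inferInstance, inferInstance⟩

theorem IsGood.prodMap_id (hρ : IsAct ρ) (hq : IsGood (fun g => mor (ρ g)) (mor q)) (Z : CSch) :
    IsGood (fun g => mor (prod.map (ρ g) (𝟙 Z))) (mor (prod.map q (𝟙 Z))) := by
  refine IsGood.of_isPullback (isPullback_mor (isPullback_prodMap_fst q Z)) (isAct_mor hρ)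
    (isAct_mor (ρ := fun g => prod.map (ρ g) (𝟙 Z)) ⟨?_, fun g k => ?_⟩) hq
    (fun g => congrArg mor (?_ : prod.map (ρ g) (𝟙 Z) ≫ prod.map q (𝟙 Z) = prod.map q (𝟙 Z)))
    fun g => congrArg mor (prod.map_fst (ρ g) (𝟙 Z))
  · simp [hρ.one]
  · simp [hρ.mul]
  · simp [hq.inv_mor]

theorem IsGood.id_prodMap (hρ : IsAct ρ) (hq : IsGood (fun g => mor (ρ g)) (mor q)) (Z : CSch) :
    IsGood (fun g => mor (prod.map (𝟙 Z) (ρ g))) (mor (prod.map (𝟙 Z) q)) := by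
  refine IsGood.of_isPullback (isPullback_mor (isPullback_prodMap_snd Z q)) (isAct_mor hρ)
    (isAct_mor (ρ := fun g => prod.map (𝟙 Z) (ρ g)) ⟨?_, fun g k => ?_⟩) hq
    (fun g => congrArg mor (?_ : prod.map (𝟙 Z) (ρ g) ≫ prod.map (𝟙 Z) q = prod.map (𝟙 Z) q))
    fun g => congrArg mor (prod.map_snd (𝟙 Z) (ρ g))
  · simp [hρ.one]
  · simp [hρ.mul]
  · simp [hq.inv_mor]

variable {H : Type} [Group H] [Finite H] {Y' Q' : CSch} {ρ' : H → (Y' ⟶ Y')} {q' : Y' ⟶ Q'}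

omit [Finite G] [Finite H] in
theorem isAct_prodMap (hρ : IsAct ρ) (hρ' : IsAct ρ') :
    IsAct fun k : G × H => prod.map (ρ k.1) (ρ' k.2) where
  one := by simp [hρ.one, hρ'.one]
  mul g k := by simp [hρ.mul, hρ'.mul]

/-- The quotient is taken in stages, first by `G` and then by `H`; each stage is a base change of a
given good quotient. -/
theorem IsGood.prodMap (hρ : IsAct ρ) (hρ' : IsAct ρ') (hq : IsGood (fun g => mor (ρ g)) (mor q))
    (hq' : IsGood (fun g => mor (ρ' g)) (mor q')) :
    IsGood (fun k : G × H => mor (prod.map (ρ k.1) (ρ' k.2))) (mor (prod.map q q')) := by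
  have h1 := (hq.prodMap_id hρ Y').comp (hq'.id_prodMap hρ' Q)
    (τ := fun k : G × H => mor (prod.map (ρ k.1) (ρ' k.2)))
    (fun k => congrArg mor (?_ : prod.map (ρ k.1) (ρ' k.2) ≫ prod.map q (𝟙 Y') ≫
      prod.map (𝟙 Q) q' = prod.map q (𝟙 Y') ≫ prod.map (𝟙 Q) q'))
    (fun g => (g, 1)) (fun g => congrArg mor (?_ : prod.map (ρ g) (ρ' 1) = prod.map (ρ g) (𝟙 _)))
    (fun h => (1, h)) (fun h => congrArg mor (?_ : prod.map (ρ 1) (ρ' h) ≫ prod.map q (𝟙 Y') =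
      prod.map q (𝟙 Y') ≫ prod.map (𝟙 Q) (ρ' h)))
  · have h2 : prod.map q q' = prod.map q (𝟙 Y') ≫ prod.map (𝟙 Q) q' := by simp
    rw [h2]
    exact h1
  · simp [hq.inv_mor, hq'.inv_mor]
  · rw [hρ'.one]
  · simp [hρ.one]

end Good

/-- Objects of `CSch` are separated, so the good quotient of `X^n` has the universal property for
all of them. -/
theorem exists_symPow (n : ℕ) (X : CSch) :
    ∃ S : SymPow n X, IsGood (fun τ => mor (permute X τ)) (mor S.proj) := by
  obtain ⟨Q, q, hq⟩ := exists_isGood (isAct_permute n X)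
  refine ⟨⟨Q, q, hq.inv_mor, fun f hf => ?_⟩, hq⟩
  obtain ⟨t, ht⟩ := hq.exists_desc (isAct_permute n X) f hf
  exact ⟨t, ht, fun t' ht' => hq.hom_ext_mor (ht'.trans ht.symm)⟩

namespace SymPow

variable {n : ℕ} {X Y Z : CSch} (S : SymPow n X) (T : SymPow n Y) (R : SymPow n Z)

theorem proj_map (u : X ⟶ Y) : S.proj ≫ S.map T u = powMap n u ≫ T.proj :=
  (S.existsUnique_desc (powMap n u ≫ T.proj) (T.map_aux u)).choose_spec.1

variable {S} in
theorem hom_ext {W : CSch} {f g : S.obj ⟶ W} (h : S.proj ≫ f = S.proj ≫ g) : f = g :=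
  (S.existsUnique_desc (S.proj ≫ g) fun τ => by rw [← Category.assoc, S.invariant]).unique h rfl

theorem map_comp (u : X ⟶ Y) (v : Y ⟶ Z) : S.map T u ≫ T.map R v = S.map R (u ≫ v) := by
  apply hom_ext
  rw [← Category.assoc, proj_map, Category.assoc, proj_map, proj_map, ← Category.assoc]
  congr 1
  exact Pi.hom_ext _ _ fun k => by simp [powMap]

theorem map_id : S.map S (𝟙 X) = 𝟙 _ := by
  apply hom_ext
  rw [proj_map, Category.comp_id]
  have : powMap n (𝟙 X) = 𝟙 _ := Pi.hom_ext _ _ fun k => by simp [powMap]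
  rw [this, Category.id_comp]

instance isIso_map (u : X ⟶ Y) [IsIso u] : IsIso (S.map T u) :=
  ⟨T.map S (inv u), by rw [map_comp, IsIso.hom_inv_id, map_id],
    by rw [map_comp, IsIso.inv_hom_id, map_id]⟩

/-- A categorical quotient is unique up to isomorphism, so every model inherits the good properties
of the constructed one. -/
theorem isGood : IsGood (fun τ => mor (permute X τ)) (mor S.proj) := by
  obtain ⟨S', hS'⟩ := exists_symPow n X
  have h1 := proj_map S' S (𝟙 X)
  have h2 : powMap n (𝟙 X) = 𝟙 _ := Pi.hom_ext _ _ fun k => by simp [powMap]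
  rw [h2, Category.id_comp] at h1
  rw [← h1]
  have := isIso_mor (S'.map S (𝟙 X))
  exact hS'.comp_iso (isAct_mor (isAct_permute n X)) _

theorem surjective_proj : Function.Surjective (mor S.proj) :=
  S.isGood.surjective (isAct_mor (isAct_permute n X))

theorem ft_proj : FT S.proj := S.isGood.ft

variable {S T} in
theorem ft_map {u : X ⟶ Y} (hu : FT u) : FT (S.map T u) := by
  refine FT.of_surjective_comp (u := S.proj) ?_ S.surjective_proj
  rw [proj_map]
  exact (hu.powMap n).comp T.ft_proj

end SymPow

section Prod

variable {l m : ℕ} {X Y : CSch} (S : SymPow l X) (T : SymPow m Y)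

theorem isAct_prodPermute : IsAct fun k : Equiv.Perm (Fin l) × Equiv.Perm (Fin m) =>
    prod.map (permute X k.1) (permute Y k.2) :=
  isAct_prodMap (isAct_permute l X) (isAct_permute m Y)

theorem isGood_prodProj : IsGood (fun k : Equiv.Perm (Fin l) × Equiv.Perm (Fin m) =>
    mor (prod.map (permute X k.1) (permute Y k.2))) (mor (prod.map S.proj T.proj)) :=
  S.isGood.prodMap (isAct_permute l X) (isAct_permute m Y) T.isGood

theorem surjective_prodProj : Function.Surjective (mor (prod.map S.proj T.proj)) :=
  (isGood_prodProj S T).surjective (isAct_mor isAct_prodPermute)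

variable {S T} in
theorem prodProj_hom_ext {W : CSch} {f g : S.obj ⨯ T.obj ⟶ W}
    (h : prod.map S.proj T.proj ≫ f = prod.map S.proj T.proj ≫ g) : f = g :=
  (isGood_prodProj S T).hom_ext_mor h

end Prod

section Add

variable {l m n : ℕ} (h : l + m = n)

/-- The indices of the coordinates of the two factors. -/
def sumIdx : Fin l ⊕ Fin m ≃ Fin n := finSumFinEquiv.trans (finCongr h)

theorem sumIdx_inl (a : Fin l) : sumIdx h (.inl a) = idxL h a := rfl

theorem sumIdx_inr (b : Fin m) : sumIdx h (.inr b) = idxR h b := rfl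

/-- The block permutations. -/
def blockPerm : Equiv.Perm (Fin l) × Equiv.Perm (Fin m) →* Equiv.Perm (Fin n) :=
  (sumIdx h).permCongrHom.toMonoidHom.comp (Equiv.Perm.sumCongrHom (Fin l) (Fin m))

theorem blockPerm_idxL (k : Equiv.Perm (Fin l) × Equiv.Perm (Fin m)) (a : Fin l) :
    blockPerm h k (idxL h a) = idxL h (k.1 a) := by
  rw [← sumIdx_inl, ← sumIdx_inl]
  simp [blockPerm, Equiv.permCongrHom]

theorem blockPerm_idxR (k : Equiv.Perm (Fin l) × Equiv.Perm (Fin m)) (b : Fin m) :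
    blockPerm h k (idxR h b) = idxR h (k.2 b) := by
  rw [← sumIdx_inr, ← sumIdx_inr]
  simp [blockPerm, Equiv.permCongrHom]

/-- A permutation of a finite set which maps the first block into itself also preserves the
complementary block. -/
theorem mem_range_blockPerm (τ : Equiv.Perm (Fin n)) (hτ : ∀ a, ∃ a', τ (idxL h a) = idxL h a') :
    τ ∈ (blockPerm h).range := by
  let τ' := (sumIdx h).permCongrHom.symm τ
  have h1 : τ' ∈ (Equiv.Perm.sumCongrHom (Fin l) (Fin m)).range := by
    refine Equiv.Perm.mem_sumCongrHom_range_of_perm_mapsTo_inl ?_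
    rintro _ ⟨a, rfl⟩
    obtain ⟨a', ha'⟩ := hτ a
    refine ⟨a', ?_⟩
    change _ = (sumIdx h).symm (τ (sumIdx h (.inl a)))
    rw [sumIdx_inl, ha', ← sumIdx_inl, Equiv.symm_apply_apply]
  obtain ⟨k, hk⟩ := h1
  refine ⟨k, ?_⟩
  change (sumIdx h).permCongrHom (Equiv.Perm.sumCongrHom (Fin l) (Fin m) k) = τ
  rw [hk]
  exact MulEquiv.apply_symm_apply _ _

variable {X : CSch}

theorem prodPermute_concat (k : Equiv.Perm (Fin l) × Equiv.Perm (Fin m)) :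
    prod.map (permute X k.1) (permute X k.2) ≫ concat h X = concat h X ≫ permute X (blockPerm h k) := by
  apply Pi.hom_ext
  intro i
  rw [Category.assoc, Category.assoc, permute_π]
  obtain ⟨a, rfl⟩ | ⟨b, rfl⟩ := idx_cases h i
  · rw [concat_idxL, prod.map_fst_assoc, blockPerm_idxL, concat_idxL, permute_π]
  · rw [concat_idxR, prod.map_snd_assoc, blockPerm_idxR, concat_idxR, permute_π]

variable (S : SymPow l X) (T : SymPow m X) (P : SymPow n X)

theorem exists_isSymAdd : ∃ c : S.obj ⨯ T.obj ⟶ P.obj, IsSymAdd h S T P c := by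
  refine (isGood_prodProj S T).exists_desc isAct_prodPermute (concat h X ≫ P.proj) fun k => ?_
  rw [← Category.assoc, prodPermute_concat, Category.assoc, P.invariant]

variable {S T P} in
theorem IsSymAdd.ft {c : S.obj ⨯ T.obj ⟶ P.obj} (hc : IsSymAdd h S T P c) : FT c := by
  refine FT.of_surjective_comp (u := prod.map S.proj T.proj) ?_ (surjective_prodProj S T)
  rw [hc]
  exact (FT.of_isIso _).comp P.ft_proj

end Add

end Motivic

namespace Motivic

/-! ### The stratification of the symmetric powers of a scheme with a closed subscheme -/

theorem exists_perm_of_ncard {l m n : ℕ} (h : l + m = n) (A : Set (Fin n)) (hA : A.ncard = l) :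
    ∃ τ : Equiv.Perm (Fin n), (∀ a, τ (idxL h a) ∈ A) ∧ ∀ b, τ (idxR h b) ∉ A := by
  classical
  have hA' : (Aᶜ).ncard = m := by
    have := Set.ncard_add_ncard_compl A
    rw [Nat.card_eq_fintype_card, Fintype.card_fin] at this
    omega
  have h1 : Fintype.card A = l := by rw [← Nat.card_eq_fintype_card]; exact hA
  have h2 : Fintype.card (Aᶜ : Set (Fin n)) = m := by rw [← Nat.card_eq_fintype_card]; exact hA'
  let e₁ : Fin l ≃ A := (Fintype.equivFinOfCardEq h1).symm
  let e₂ : Fin m ≃ (Aᶜ : Set (Fin n)) := (Fintype.equivFinOfCardEq h2).symm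
  let τ : Equiv.Perm (Fin n) :=
    (sumIdx h).symm.trans ((Equiv.sumCongr e₁ e₂).trans (Equiv.Set.sumCompl A))
  refine ⟨τ, fun a => ?_, fun b => ?_⟩
  · have : τ (idxL h a) = e₁ a := by
      rw [← sumIdx_inl]; simp [τ]
    rw [this]
    exact (e₁ a).2
  · have : τ (idxR h b) = e₂ b := by
      rw [← sumIdx_inr]; simp [τ]
    rw [this]
    exact (e₂ b).2

section Strata

variable {V Z : CSch} (i : Z ⟶ V) (n : ℕ)

/-- The indices of the coordinates which lie in the image of `i`. -/
def coordSet {n : ℕ} (y : (pow n V).toScheme) : Set (Fin n) :=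
  {k | mor (Pi.π (fun _ : Fin n => V) k) y ∈ Set.range (mor i)}

theorem coordSet_permute {n : ℕ} (τ : Equiv.Perm (Fin n)) (y : (pow n V).toScheme) :
    coordSet i (mor (permute V τ) y) = τ ⁻¹' coordSet i y := by
  ext k
  simp only [coordSet, Set.mem_ofPred_eq, Set.mem_preimage]
  rw [← mor_comp_apply, permute_π]

theorem ncard_coordSet_permute {n : ℕ} (τ : Equiv.Perm (Fin n)) (y : (pow n V).toScheme) :
    (coordSet i (mor (permute V τ) y)).ncard = (coordSet i y).ncard := by
  rw [coordSet_permute, ← Equiv.image_symm_eq_preimage,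
    Set.ncard_image_of_injective _ τ.symm.injective]

variable [IsClosedImmersion (mor i)]

/-- The open subset of points with less than `k` coordinates in a closed subset. -/
def fewOpens (k : ℕ) : (pow n V).toScheme.Opens where
  carrier := {y | (coordSet i y).ncard < k}
  is_open' := by
    -- The complement is the finite union, over index sets `A` with at least `k` elements, of the
    -- closed loci where all coordinates in `A` lie in the image of `i`.
    have : {y : (pow n V).toScheme | (coordSet i y).ncard < k} =
        (⋃ A ∈ {A : Set (Fin n) | k ≤ A.ncard}, ⋂ c ∈ A,
          mor (Pi.π (fun _ : Fin n => V) c) ⁻¹' Set.range (mor i))ᶜ := by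
      ext y
      simp only [Set.mem_ofPred_eq, Set.mem_compl_iff, Set.mem_iUnion, Set.mem_iInter,
        Set.mem_preimage, exists_prop, not_exists, not_and]
      constructor
      · intro hy A hA hAy
        exact absurd (hA.trans (Set.ncard_le_ncard (fun c hc => hAy c hc))) (not_le.2 hy)
      · intro hy
        by_contra hk
        exact hy (coordSet i y) (not_lt.1 hk) fun c hc => hc
    rw [this, isOpen_compl_iff]
    refine Set.Finite.isClosed_biUnion (Set.toFinite _) fun A _ => ?_
    exact isClosed_biInter fun c _ =>
      (mor i).isClosedEmbedding.isClosed_range.preimage (mor _).continuous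

variable {n} (S : SymPow n V)

/-- The open subset of the symmetric power of points with less than `k` coordinates in a closed
subset. -/
def fewSym (k : ℕ) : S.obj.toScheme.Opens :=
  S.isGood.imageOpens (isAct_mor (isAct_permute n V)) (fewOpens i n k)

theorem preimage_fewSym (k : ℕ) : mor S.proj ⁻¹ᵁ fewSym i S k = fewOpens i n k :=
  S.isGood.preimage_imageOpens (isAct_mor (isAct_permute n V)) fun τ y hy => by
    change (coordSet i (mor (permute V τ) y)).ncard < k
    rw [ncard_coordSet_permute]
    exact hy

theorem proj_mem_fewSym (k : ℕ) (y : (pow n V).toScheme) :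
    mor S.proj y ∈ fewSym i S k ↔ (coordSet i y).ncard < k := by
  change y ∈ mor S.proj ⁻¹ᵁ fewSym i S k ↔ _
  rw [preimage_fewSym]
  rfl

theorem fewSym_zero : fewSym i S 0 = ⊥ := by
  ext x
  obtain ⟨y, rfl⟩ := S.surjective_proj x
  refine iff_of_false (fun hx => ?_) id
  have := (proj_mem_fewSym i S 0 y).1 hx
  omega

theorem fewSym_top : fewSym i S (n + 1) = ⊤ := by
  ext x
  obtain ⟨y, rfl⟩ := S.surjective_proj x
  refine iff_of_true ((proj_mem_fewSym i S _ y).2 ?_) trivial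
  have := Set.ncard_le_card (coordSet i y)
  rw [Nat.card_eq_fintype_card, Fintype.card_fin] at this
  omega

theorem fewSym_mono {k k' : ℕ} (hk : k ≤ k') : fewSym i S k ≤ fewSym i S k' := by
  intro x hx
  obtain ⟨y, rfl⟩ := S.surjective_proj x
  exact (proj_mem_fewSym i S _ y).2 (((proj_mem_fewSym i S _ y).1 hx).trans_le hk)

end Strata

section Stratum

variable {V Z U : CSch} {i : Z ⟶ V} {j : U ⟶ V} (hij : IsCut i j) {l m n : ℕ} (h : l + m = n)

/-- The morphism `Z^l × U^m ⟶ V^n`. -/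
def stratMap (i : Z ⟶ V) (j : U ⟶ V) : pow l Z ⨯ pow m U ⟶ pow n V :=
  prod.map (powMap l i) (powMap m j) ≫ concat h V

include hij in
theorem coordSet_stratMap (w : (pow l Z ⨯ pow m U).toScheme) :
    coordSet i (mor (stratMap h i j) w) = Set.range (idxL h) := by
  ext k
  simp only [coordSet, Set.mem_ofPred_eq]
  rw [← mor_comp_apply, stratMap, Category.assoc]
  obtain ⟨a, rfl⟩ | ⟨b, rfl⟩ := idx_cases h k
  · refine iff_of_true ?_ ⟨a, rfl⟩
    rw [concat_idxL, prod.map_fst_assoc, powMap_π, ← Category.assoc]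
    exact ⟨_, rfl⟩
  · refine iff_of_false ?_ ?_
    · rw [concat_idxR, prod.map_snd_assoc, powMap_π, ← Category.assoc]
      have : mor ((prod.snd ≫ Pi.π (fun _ : Fin m => U) b) ≫ j) w ∈ Set.range (mor j) := ⟨_, rfl⟩
      rw [hij.compl] at this
      exact this
    · rintro ⟨a, ha⟩
      have := congrArg Fin.val ha
      simp [idxL, idxR] at this
      omega

theorem injective_idxL : Function.Injective (idxL (l := l) h) := fun a a' haa => by
  have := congrArg Fin.val haa
  exact Fin.ext this

theorem ncard_range_idxL : (Set.range (idxL (l := l) h)).ncard = l := by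
  rw [← Set.image_univ, Set.ncard_image_of_injective _ (injective_idxL h), Set.ncard_univ,
    Nat.card_eq_fintype_card, Fintype.card_fin]

include hij in
theorem mem_range_stratMap_iff (y : (pow n V).toScheme) :
    y ∈ Set.range (mor (stratMap h i j)) ↔ coordSet i y = Set.range (idxL h) := by
  constructor
  · rintro ⟨w, rfl⟩
    exact coordSet_stratMap hij h w
  · intro hy
    obtain ⟨z, rfl⟩ := surjective_concat h V y
    have hz : z ∈ Set.range (mor (prod.map (powMap l i) (powMap m j))) := by
      rw [range_prodMap, range_powMap, range_powMap]
      constructor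
      · intro a
        rw [← mor_comp_apply, ← concat_idxL h]
        exact hy.ge ⟨a, rfl⟩
      · intro b
        rw [← mor_comp_apply, ← concat_idxR h, hij.compl]
        intro hb
        obtain ⟨a, ha⟩ := hy.le hb
        have := congrArg Fin.val ha
        simp [idxL, idxR] at this
        omega
    obtain ⟨w, rfl⟩ := hz
    exact ⟨w, mor_comp_apply _ _ _⟩

variable (P : SymPow l Z) (R : SymPow m U) (S : SymPow n V)

-- The stratum of points with exactly `l` coordinates in `Z` is closed in the open locus with at
-- most `l` such coordinates, and the locus with fewer than `l` is its complement there. Upstairs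
-- the stratum is a union of translates of `Z^l × U^m`, which coincide or are disjoint, and the
-- stabilizer is the group of block permutations. This identifies the quotient of the stratum with
-- the product of symmetric powers.
include hij in
theorem exists_isCut_strata {t : P.obj ⨯ R.obj ⟶ S.obj}
    (ht : prod.map P.proj R.proj ≫ t = stratMap h i j ≫ S.proj) :
    have := hij.closed
    ∃ (t' : P.obj ⨯ R.obj ⟶ openSub S.obj (fewSym i S (l + 1)))
      (e : openSub S.obj (fewSym i S l) ⟶ openSub S.obj (fewSym i S (l + 1))),
      IsCut t' e ∧ t' ≫ openSubι _ _ = t ∧ e ≫ openSubι _ _ = openSubι _ _ := by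
  have := hij.closed
  intro _
  have hopen := hij.isOpen
  -- The image consists of the points with exactly `l` coordinates in `Z`: a permutation moves these
  -- coordinates to the first `l` places.
  have hrange : Set.range (mor t) =
      {x | x ∈ fewSym i S (l + 1) ∧ x ∉ fewSym i S l} := by
    refine Set.Subset.antisymm (Set.range_subset_iff.2 fun x => ?_) ?_
    · obtain ⟨w, rfl⟩ := surjective_prodProj P R x
      rw [← mor_comp_apply, ht, mor_comp_apply]
      have h1 : (coordSet i (mor (stratMap h i j) w)).ncard = l := by
        rw [coordSet_stratMap hij, ncard_range_idxL]
      refine ⟨(proj_mem_fewSym i S _ _).2 (by omega), fun h2 => ?_⟩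
      have := (proj_mem_fewSym i S _ _).1 h2
      omega
    · rintro x ⟨hx1, hx2⟩
      obtain ⟨y, rfl⟩ := S.surjective_proj x
      rw [proj_mem_fewSym] at hx1 hx2
      obtain ⟨τ, hτ1, hτ2⟩ := exists_perm_of_ncard h (coordSet i y) (by omega)
      have hy : mor (permute V τ) y ∈ Set.range (mor (stratMap h i j)) := by
        rw [mem_range_stratMap_iff hij, coordSet_permute]
        ext k
        obtain ⟨a, rfl⟩ | ⟨b, rfl⟩ := idx_cases h k
        · exact iff_of_true (hτ1 a) ⟨a, rfl⟩
        · refine iff_of_false (hτ2 b) ?_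
          rintro ⟨a, ha⟩
          have := congrArg Fin.val ha
          simp [idxL, idxR] at this
          omega
      obtain ⟨w, hw⟩ := hy
      refine ⟨mor (prod.map P.proj R.proj) w, ?_⟩
      rw [← mor_comp_apply, ht, mor_comp_apply, hw, ← mor_comp_apply, S.invariant]
  let D := fewSym i S (l + 1)
  let d : openSub S.obj D ⟶ S.obj := openSubι _ _
  let Y := openSub (pow n V) (fewOpens i n (l + 1))
  let y : Y ⟶ pow n V := openSubι _ _
  have hd : Set.range (mor d) = D := range_openSubι _ _
  have hy : Set.range (mor y) = fewOpens i n (l + 1) := range_openSubι _ _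
  let t' : P.obj ⨯ R.obj ⟶ openSub S.obj D := liftOpen d t (by
    rw [hrange, hd]; exact fun x hx => hx.1)
  have ht' : t' ≫ d = t := liftOpen_fac _ _ _
  let e : openSub S.obj (fewSym i S l) ⟶ openSub S.obj D := liftOpen d (openSubι _ _) (by
    rw [range_openSubι, hd]; exact fewSym_mono i S (Nat.le_succ l))
  have he : e ≫ d = openSubι _ _ := liftOpen_fac _ _ _
  let q : Y ⟶ openSub S.obj D := liftOpen d (y ≫ S.proj) (by
    rw [hd]
    refine Set.range_subset_iff.2 fun x => ?_
    have h1 : mor y x ∈ Set.range (mor y) := ⟨x, rfl⟩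
    rw [hy, ← preimage_fewSym] at h1
    exact h1)
  have hq : q ≫ d = y ≫ S.proj := liftOpen_fac _ _ _
  have hpb : IsPullback y q S.proj d := isPullback_of_isOpenImmersion hq.symm (by
    rw [hd, hy, ← preimage_fewSym]
    exact fun x hx => hx)
  let ρ : Equiv.Perm (Fin n) → (Y ⟶ Y) := fun τ => hpb.lift (y ≫ permute V τ) q (by
    rw [Category.assoc, S.invariant, hq])
  have hρy : ∀ τ, ρ τ ≫ y = y ≫ permute V τ := fun τ => hpb.lift_fst _ _ _
  have hρq : ∀ τ, ρ τ ≫ q = q := fun τ => hpb.lift_snd _ _ _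
  have hρ : IsAct ρ := by
    refine ⟨?_, fun g k => ?_⟩
    · rw [← cancel_mono y, hρy, (isAct_permute n V).one, Category.id_comp, Category.comp_id]
    · rw [← cancel_mono y, hρy, (isAct_permute n V).mul, Category.assoc, hρy, ← Category.assoc,
        ← Category.assoc, hρy]
  have hgood : IsGood (fun τ => mor (ρ τ)) (mor q) :=
    IsGood.of_isPullback (isPullback_mor hpb) (isAct_mor (isAct_permute n V)) (isAct_mor hρ)
      S.isGood (fun τ => congrArg mor (hρq τ)) (fun τ => congrArg mor (hρy τ))
  let f : pow l Z ⨯ pow m U ⟶ Y := liftOpen y (stratMap h i j) (by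
    rw [hy]
    refine Set.range_subset_iff.2 fun w => ?_
    change (coordSet i (mor (stratMap h i j) w)).ncard < l + 1
    rw [coordSet_stratMap hij, ncard_range_idxL]
    exact Nat.lt_succ_self l)
  have hf : f ≫ y = stratMap h i j := liftOpen_fac _ _ _
  have hfY : ∀ w, coordSet i (mor y (mor f w)) = Set.range (idxL h) := fun w => by
    rw [← mor_comp_apply, hf, coordSet_stratMap hij]
  -- In `Y` at most `l` coordinates lie in `Z`, so the closed condition that the first `l` do forces
  -- the others into `U`. Hence the range of the immersion `f` is closed.
  have hfclosed : IsClosedImmersion (mor f) := by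
    have h1 : IsPreimmersion (mor (prod.map (powMap l i) (powMap m j))) := by
      have h2 : IsClosedImmersion (mor (prod.map (powMap l i) (𝟙 (pow m U)))) :=
        prodMap_mem closedProp (powMap_mem closedProp l hij.closed) (closedProp.id_mem _)
      have h3 : IsOpenImmersion (mor (prod.map (𝟙 (pow l V)) (powMap m j))) :=
        prodMap_mem openProp (openProp.id_mem _) (powMap_mem openProp m hij.isOpen)
      have h4 : prod.map (powMap l i) (powMap m j) =
          prod.map (powMap l i) (𝟙 (pow m U)) ≫ prod.map (𝟙 (pow l V)) (powMap m j) := by simp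
      rw [h4]
      exact inferInstanceAs (IsPreimmersion (mor _ ≫ mor _))
    have h2 : IsPreimmersion (mor f ≫ mor y) := by
      have h3 : mor f ≫ mor y = mor (prod.map (powMap l i) (powMap m j)) ≫ mor (concat h V) :=
        congrArg mor hf
      have := isIso_mor (concat h V)
      rw [h3]
      infer_instance
    have h3 : IsPreimmersion (mor f) := IsPreimmersion.of_comp (mor f) (mor y)
    refine IsClosedImmersion.of_isPreimmersion _ ?_
    have h4 : Set.range (mor f) = mor y ⁻¹' (⋂ a : Fin l,
        mor (Pi.π (fun _ : Fin n => V) (idxL h a)) ⁻¹' Set.range (mor i)) := by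
      ext x
      constructor
      · rintro ⟨w, rfl⟩
        exact Set.mem_iInter.2 fun a => (hfY w).ge ⟨a, rfl⟩
      · intro hx
        have hx1 : Set.range (idxL h) ⊆ coordSet i (mor y x) :=
          Set.range_subset_iff.2 fun a => Set.mem_iInter.1 hx a
        have hx2 : mor y x ∈ fewOpens i n (l + 1) := hy.le ⟨x, rfl⟩
        have hx3 : (coordSet i (mor y x)).ncard < l + 1 := hx2
        have hx4 := Set.eq_of_subset_of_ncard_le hx1 (by
          rw [ncard_range_idxL]; exact Nat.lt_succ_iff.1 hx3)
        obtain ⟨w, hw⟩ := (mem_range_stratMap_iff hij h _).2 hx4.symm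
        refine ⟨w, (mor y).isOpenEmbedding.injective ?_⟩
        rw [← hw, ← mor_comp_apply, hf]
    rw [h4]
    refine IsClosed.preimage (mor y).continuous (isClosed_iInter fun a => ?_)
    exact (mor i).isClosedEmbedding.isClosed_range.preimage (mor _).continuous
  -- A permutation that maps some point of `Z^l × U^m` to another such point preserves the set of
  -- indices of coordinates in `Z`, so it is a block permutation.
  have hclosed : IsClosedImmersion (mor t') := by
    refine IsGood.isClosedImmersion (isAct_mor hρ) (isAct_mor isAct_prodPermute) hgood
      (isGood_prodProj P R) (blockPerm h) (i := mor f) (fun k => congrArg mor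
        (?_ : prod.map (permute Z k.1) (permute U k.2) ≫ f = f ≫ ρ (blockPerm h k)))
      (fun τ hτ w w' hww => hτ (mem_range_blockPerm h τ fun a => ?_))
      (congrArg mor (?_ : prod.map P.proj R.proj ≫ t' = f ≫ q))
    · rw [← cancel_mono y, Category.assoc, hf, Category.assoc, hρy, ← Category.assoc f, hf,
        stratMap, Category.assoc, ← prodPermute_concat, ← Category.assoc, ← Category.assoc]
      simp only [prod.map_map, permute_powMap]
    · have h1 : mor y (mor f w) = mor (permute V τ) (mor y (mor f w')) := by
        rw [hww, ← mor_comp_apply, hρy, mor_comp_apply]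
      have h2 := hfY w
      rw [h1, coordSet_permute, hfY w'] at h2
      obtain ⟨a', ha'⟩ := h2.ge ⟨a, rfl⟩
      exact ⟨a', ha'.symm⟩
    · rw [← cancel_mono d, Category.assoc, ht', ht, Category.assoc, hq, ← Category.assoc, hf]
  have heo : IsOpenImmersion (mor e) := by
    have h1 : IsOpenImmersion (mor e ≫ mor d) := by
      have h2 : mor e ≫ mor d = mor (openSubι S.obj (fewSym i S l)) := congrArg mor he
      rw [h2]; infer_instance
    exact IsOpenImmersion.of_comp (mor e) (mor d)
  refine ⟨t', e, ⟨hclosed, heo, ?_⟩, ht', he⟩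
  have hinj := (mor d).isOpenEmbedding.injective
  have himg : ∀ {W : CSch} (a : W ⟶ openSub S.obj D) (x : (openSub S.obj D).toScheme),
      x ∈ Set.range (mor a) ↔ mor d x ∈ Set.range (mor (a ≫ d)) := by
    intro W a x
    constructor
    · rintro ⟨w, rfl⟩; exact ⟨w, rfl⟩
    · rintro ⟨w, hw⟩; exact ⟨w, hinj hw⟩
  ext x
  rw [Set.mem_compl_iff, himg, himg, he, ht', range_openSubι, hrange]
  have hx : mor d x ∈ D := hd.le ⟨x, rfl⟩
  simp only [Set.mem_ofPred_eq, not_and, not_not]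
  exact ⟨fun h1 _ => h1, fun h1 => h1 hx⟩

end Stratum

end Motivic

namespace Motivic

/-! ### The relative Grothendieck group -/

theorem isPullback_comp_iso {P X Y V V' : CSch} {p : P ⟶ X} {q : P ⟶ V} {u : X ⟶ Y} {v : V ⟶ Y}
    {v' : V' ⟶ Y} (h : IsPullback p q u v) (e : V ≅ V') (he : e.hom ≫ v' = v) :
    IsPullback p (q ≫ e.hom) u v' := by
  simpa using h.paste_vert (IsPullback.of_vert_isIso (fst := v) (snd := e.hom) (f := 𝟙 Y) (g := v')
    ⟨by simp [he]⟩)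

namespace K0

variable {X Y Z : CSch}

/-- The relations of `K0 X` for a function on morphisms of finite type to `X`. -/
structure IsMotivic {A : Type*} [AddCommGroup A] (f : ∀ {V : CSch} (v : V ⟶ X), FT v → A) :
    Prop where
  iso : ∀ {V V' : CSch} (e : V ≅ V') (v : V ⟶ X) (v' : V' ⟶ X) (hv : FT v) (hv' : FT v'),
    e.hom ≫ v' = v → f v hv = f v' hv'
  cut : ∀ {V Z U : CSch} (v : V ⟶ X) (hv : FT v) {i : Z ⟶ V} {j : U ⟶ V}, IsCut i j →
    ∀ (z : Z ⟶ X) (w : U ⟶ X) (hz : FT z) (hw : FT w), i ≫ v = z → j ≫ v = w →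
      f v hv = f z hz + f w hw

/-- The universal property of `K0 X`. -/
def lift {A : Type*} [AddCommGroup A] {f : ∀ {V : CSch} (v : V ⟶ X), FT v → A}
    (hf : IsMotivic f) : K0 X →+ A :=
  QuotientAddGroup.lift _ (FreeAbelianGroup.lift fun v : FTOver X => f v.hom v.ft) (by
    rw [AddSubgroup.closure_le]
    intro r hr
    rw [SetLike.mem_coe, AddMonoidHom.mem_ker]
    obtain ⟨v, hv, v', hv', e, h⟩ | ⟨v, hv, i, j, h⟩ := hr
    · simp [hf.iso e v v' hv hv' h.symm]
    · simp [hf.cut v hv h _ _ ((FT.of_isClosedImmersion h.closed).comp hv)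
        ((FT.of_isOpenImmersion h.isOpen).comp hv) rfl rfl])

@[simp]
theorem lift_cls {A : Type*} [AddCommGroup A] {f : ∀ {V : CSch} (v : V ⟶ X), FT v → A}
    (hf : IsMotivic f) {V : CSch} (v : V ⟶ X) (hv : FT v) : lift hf (cls v hv) = f v hv :=
  FreeAbelianGroup.lift_apply_of _ _

theorem hom_ext {A : Type*} [AddCommGroup A] {f g : K0 X →+ A}
    (h : ∀ {V : CSch} (v : V ⟶ X) (hv : FT v), f (cls v hv) = g (cls v hv)) : f = g := by
  apply QuotientAddGroup.addMonoidHom_ext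
  ext v
  exact h v.hom v.ft

theorem isMotivic_cls : IsMotivic (X := X) cls where
  iso e v v' hv hv' h := sub_eq_zero.1 ((QuotientAddGroup.eq_zero_iff _).2
    (AddSubgroup.subset_closure (K0Rel.iso _ hv _ hv' e h.symm)))
  cut v hv i j h z w hz hw hz' hw' := by
    subst hz' hw'
    have := (QuotientAddGroup.eq_zero_iff _).2
      (AddSubgroup.subset_closure (K0Rel.cut v hv i j h))
    rw [QuotientAddGroup.mk_sub, QuotientAddGroup.mk_sub, sub_sub, sub_eq_zero] at this
    exact this

theorem cls_congr {V V' : CSch} {v : V ⟶ X} {v' : V' ⟶ X} (e : V ≅ V') (h : e.hom ≫ v' = v)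
    (hv : FT v) (hv' : FT v') : cls v hv = cls v' hv' :=
  isMotivic_cls.iso e v v' hv hv' h

theorem cls_of_isPullback {V P P' : CSch} {v : V ⟶ Y} {p : P ⟶ X} {q : P ⟶ V}
    {p' : P' ⟶ X} {q' : P' ⟶ V} {u : X ⟶ Y} (h : IsPullback p q u v) (h' : IsPullback p' q' u v)
    (hp : FT p) (hp' : FT p') : cls p hp = cls p' hp' :=
  cls_congr (h.isoIsPullback _ _ h') (h.isoIsPullback_hom_fst _ _ h') _ _

/-- An empty scheme is cut into two copies of itself, so its class equals twice itself. -/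
theorem cls_of_isEmpty {V : CSch} {v : V ⟶ X} (hv : FT v) [IsEmpty V.toScheme] :
    cls v hv = 0 := by
  have h : IsCut (𝟙 V) (𝟙 V) :=
    ⟨inferInstanceAs (IsClosedImmersion (𝟙 V.toScheme)),
      inferInstanceAs (IsOpenImmersion (𝟙 V.toScheme)), Subsingleton.elim _ _⟩
  simpa using isMotivic_cls.cut v hv h v v hv hv (Category.id_comp v) (Category.id_comp v)

/-! #### Pull-back, push-forward and product -/

theorem isMotivic_pull (u : X ⟶ Y) :
    IsMotivic fun {V : CSch} (v : V ⟶ Y) (hv : FT v) =>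
      cls (fibFst u v) (.of_isPullback (isPullback_fib u v) hv) where
  iso e v v' hv hv' h :=
    cls_of_isPullback (isPullback_comp_iso (isPullback_fib u v) e h) (isPullback_fib u v') _ _
  cut {V Z U} v hv i j h z w hz hw hz' hw' := by
    subst hz' hw'
    have hi := isPullback_fib (fibSnd u v) i
    have hj := isPullback_fib (fibSnd u v) j
    have hc := h.of_isPullback hi hj
    have hi' := hi.paste_horiz (isPullback_fib u v)
    have hj' := hj.paste_horiz (isPullback_fib u v)
    rw [isMotivic_cls.cut _ _ hc _ _ (.of_isPullback hi' hz) (.of_isPullback hj' hw) rfl rfl]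
    exact congrArg₂ _ (cls_of_isPullback hi' (isPullback_fib _ _) _ _)
      (cls_of_isPullback hj' (isPullback_fib _ _) _ _)

/-- The pull-back `K0 Y → K0 X`. -/
def pull (u : X ⟶ Y) : K0 Y →+ K0 X := lift (isMotivic_pull u)

theorem pull_cls {P V : CSch} {p : P ⟶ X} {q : P ⟶ V} {u : X ⟶ Y} {v : V ⟶ Y}
    (h : IsPullback p q u v) (hv : FT v) (hp : FT p) : pull u (cls v hv) = cls p hp :=
  (lift_cls _ _ _).trans (cls_of_isPullback (isPullback_fib u v) h _ _)

theorem isMotivic_push (u : X ⟶ Y) (hu : FT u) :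
    IsMotivic fun {V : CSch} (v : V ⟶ X) (hv : FT v) => cls (v ≫ u) (hv.comp hu) where
  iso e v v' hv hv' h := cls_congr e (by rw [← h, Category.assoc]) _ _
  cut v hv i j h z w hz hw hz' hw' := isMotivic_cls.cut _ _ h _ _ _ _
    (by rw [← hz', Category.assoc]) (by rw [← hw', Category.assoc])

/-- The push-forward `K0 X → K0 Y`. -/
def push (u : X ⟶ Y) (hu : FT u) : K0 X →+ K0 Y := lift (isMotivic_push u hu)

@[simp]
theorem push_cls {V : CSch} (u : X ⟶ Y) (hu : FT u) (v : V ⟶ X) (hv : FT v) :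
    push u hu (cls v hv) = cls (v ≫ u) (hv.comp hu) := lift_cls _ _ _

theorem push_pull_cls {V W P : CSch} {p : P ⟶ W} {q : P ⟶ V} {w : W ⟶ X} {v : V ⟶ X}
    (h : IsPullback p q w v) (hv : FT v) (hw : FT w) (hp : FT (p ≫ w)) :
    push w hw (pull w (cls v hv)) = cls (p ≫ w) hp := by
  rw [pull_cls h hv (.of_isPullback h hv), push_cls]

/-- Multiplication by `[W → X]` is the operator `w_! w^*`, so only its dependence on `w` is left to
be checked against the relations. -/
theorem isMotivic_mul : IsMotivic fun {W : CSch} (w : W ⟶ X) (hw : FT w) =>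
    (push w hw).comp (pull w) where
  iso {W W'} e w w' hw hw' h := hom_ext fun v hv => by
    have h1 := isPullback_fib w v
    have h2 := isPullback_comp_iso h1.flip e h
    have h3 : FT (fibFst w v ≫ w) := (FT.of_isPullback h1 hv).comp hw
    rw [AddMonoidHom.comp_apply, AddMonoidHom.comp_apply, push_pull_cls h1 hv hw h3,
      push_pull_cls h2.flip hv hw' (by rwa [Category.assoc, h])]
    exact cls_congr (Iso.refl _) (by rw [Category.assoc, h]; exact Category.id_comp _) _ _
  cut {W Z U} w hw i j h z y hz hy hz' hy' := hom_ext fun {V} v hv => by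
    subst hz' hy'
    have h1 := isPullback_fib w v
    have hi := isPullback_fib (fibFst w v) i
    have hj := isPullback_fib (fibFst w v) j
    have hi' := (hi.paste_horiz h1.flip).flip
    have hj' := (hj.paste_horiz h1.flip).flip
    have h3 : FT (fibFst w v ≫ w) := (FT.of_isPullback h1 hv).comp hw
    rw [AddMonoidHom.add_apply, AddMonoidHom.comp_apply, AddMonoidHom.comp_apply,
      AddMonoidHom.comp_apply, push_pull_cls h1 hv hw h3,
      push_pull_cls hi' hv hz ((FT.of_isPullback hi' hv).comp hz),
      push_pull_cls hj' hv hy ((FT.of_isPullback hj' hv).comp hy)]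
    exact isMotivic_cls.cut _ _ (h.of_isPullback hi hj) _ _ _ _
      (by rw [← Category.assoc, hi.w, Category.assoc])
      (by rw [← Category.assoc, hj.w, Category.assoc])

/-- The product of `K0 X`, given by the fibre product over `X`. -/
def mul : K0 X →+ K0 X →+ K0 X := lift isMotivic_mul

theorem mul_cls {V W P : CSch} {p : P ⟶ W} {q : P ⟶ V} {w : W ⟶ X} {v : V ⟶ X}
    (h : IsPullback p q w v) (hv : FT v) (hw : FT w) (hp : FT (p ≫ w)) :
    mul (cls w hw) (cls v hv) = cls (p ≫ w) hp := by
  rw [mul, lift_cls]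
  exact push_pull_cls h hv hw hp

end K0
end Motivic

namespace Motivic

/-! ### Components -/

theorem FT.openSubι (X : CSch) (U : X.toScheme.Opens) : FT (openSubι X U) :=
  .of_isOpenImmersion inferInstance

instance (X : CSch) (c : π₀ X) : IsOpenImmersion (mor (componentι X c)) :=
  inferInstanceAs (IsOpenImmersion (compOpens X c).ι)

theorem FT.componentι (X : CSch) (c : π₀ X) : FT (componentι X c) :=
  .of_isOpenImmersion inferInstance

theorem range_componentι (X : CSch) (c : π₀ X) :
    Set.range (mor (componentι X c)) = (ConnectedComponents.mk ⁻¹' {c} : Set X.toScheme) :=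
  range_openSubι X (compOpens X c)

theorem mk_componentι {X : CSch} (c : π₀ X) (x : (component X c).toScheme) :
    ConnectedComponents.mk (mor (componentι X c) x) = c := by
  have : mor (componentι X c) x ∈ Set.range (mor (componentι X c)) := ⟨x, rfl⟩
  rwa [range_componentι] at this

instance (X : CSch) : DiscreteTopology (π₀ X) := by
  refine discreteTopology_iff_isOpen_singleton.2 fun c => ?_
  exact ConnectedComponents.isQuotientMap_coe.isOpen_preimage.1 (compOpens X c).isOpen

theorem finite_components (X : CSch) [CompactSpace X.toScheme] : Finite (π₀ X) :=
  finite_of_compact_of_discrete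

instance (X : CSch) (c : π₀ X) : CompactSpace (component X c).toScheme := by
  obtain ⟨x, rfl⟩ := ConnectedComponents.surjective_coe c
  rw [← isCompact_univ_iff, (mor (componentι X _)).isOpenEmbedding.isEmbedding.isCompact_iff,
    Set.image_univ, range_componentι, connectedComponents_preimage_singleton]
  exact X.property.2.1 x

theorem FT.compactSpace {X Y : CSch} {u : X ⟶ Y} (hu : FT u) [CompactSpace Y.toScheme] :
    CompactSpace X.toScheme :=
  have := hu.2
  QuasiCompact.compactSpace_of_compactSpace (mor u)

/-- The image of a connected component. -/
def compMap {X Y : CSch} (u : X ⟶ Y) : π₀ X → π₀ Y :=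
  (mor u).continuous.connectedComponentsMap

/-- The restriction of a morphism to a connected component. -/
def compHom {X Y : CSch} (u : X ⟶ Y) (c : π₀ X) : component X c ⟶ component Y (compMap u c) :=
  liftOpen (componentι Y _) (componentι X c ≫ u) (Set.range_subset_iff.2 fun x => by
    rw [range_componentι]
    exact congrArg (compMap u) (mk_componentι c x))

@[simp]
theorem compHom_ι {X Y : CSch} (u : X ⟶ Y) (c : π₀ X) :
    compHom u c ≫ componentι Y _ = componentι X c ≫ u := liftOpen_fac _ _ _

theorem isPullback_restrictMap {V X : CSch} (v : V ⟶ X) (U : X.toScheme.Opens)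
    (hU : IsClosed (U : Set X.toScheme)) :
    IsPullback (restrictMap v U hU) (restrictι V _ (hU.preimage (mor v).continuous))
      (restrictι X U hU) v :=
  isPullback_of_mor (isPullback_morphismRestrict (mor v) U)

/-! ### Finite decompositions -/

theorem isCut_of_isClosed {V Z U : CSch} {i : Z ⟶ V} {j : U ⟶ V} [IsOpenImmersion (mor i)]
    [hj : IsOpenImmersion (mor j)] (h : Set.range (mor j) = (Set.range (mor i))ᶜ) : IsCut i j where
  closed := .of_isPreimmersion _ (by
    rw [← isOpen_compl_iff, ← h]
    exact (mor j).isOpenEmbedding.isOpen_range)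
  isOpen := hj
  compl := h

namespace K0

variable {X Y : CSch}

theorem cls_openSub_sup {V : CSch} (v : V ⟶ X) (hv : FT v) (U W : V.toScheme.Opens)
    (h : Disjoint U W) :
    cls (openSubι V (U ⊔ W) ≫ v) ((FT.openSubι V _).comp hv) =
      cls (openSubι V U ≫ v) ((FT.openSubι V _).comp hv) +
        cls (openSubι V W ≫ v) ((FT.openSubι V _).comp hv) := by
  have hU : Set.range (mor (openSubι V U)) ⊆ Set.range (mor (openSubι V (U ⊔ W))) := by
    rw [range_openSubι, range_openSubι]; exact SetLike.coe_subset_coe.2 le_sup_left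
  have hW : Set.range (mor (openSubι V W)) ⊆ Set.range (mor (openSubι V (U ⊔ W))) := by
    rw [range_openSubι, range_openSubι]; exact SetLike.coe_subset_coe.2 le_sup_right
  let i := liftOpen _ _ hU
  let j := liftOpen _ _ hW
  have hi : i ≫ openSubι V (U ⊔ W) = openSubι V U := liftOpen_fac _ _ _
  have hj : j ≫ openSubι V (U ⊔ W) = openSubι V W := liftOpen_fac _ _ _
  have : IsOpenImmersion (mor i ≫ mor (openSubι V (U ⊔ W))) := by
    rw [← mor_comp, hi]; infer_instance
  have := IsOpenImmersion.of_comp (mor i) (mor (openSubι V (U ⊔ W)))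
  have : IsOpenImmersion (mor j ≫ mor (openSubι V (U ⊔ W))) := by
    rw [← mor_comp, hj]; infer_instance
  have := IsOpenImmersion.of_comp (mor j) (mor (openSubι V (U ⊔ W)))
  refine isMotivic_cls.cut _ _ (isCut_of_isClosed (i := i) (j := j) ?_) _ _ _ _
    (by rw [← Category.assoc, hi]) (by rw [← Category.assoc, hj])
  have hinj := (mor (openSubι V (U ⊔ W))).isOpenEmbedding.injective
  have hi' : mor (openSubι V (U ⊔ W)) '' Set.range (mor i) = U := by
    rw [← Set.range_comp, ← range_openSubι V U, ← hi]; rfl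
  have hj' : mor (openSubι V (U ⊔ W)) '' Set.range (mor j) = W := by
    rw [← Set.range_comp, ← range_openSubι V W, ← hj]; rfl
  apply hinj.image_injective
  rw [hj', Set.image_compl_eq_range_sdiff_image hinj, hi', range_openSubι]
  have hd : Disjoint (U : Set V.toScheme) W := TopologicalSpace.Opens.coe_disjoint.2 h
  exact (hd.sup_sdiff_cancel_left).symm

theorem cls_openSub_bot {V : CSch} (v : V ⟶ X) (hv : FT v) :
    cls (openSubι V ⊥ ≫ v) ((FT.openSubι V _).comp hv) = 0 := by
  have : IsEmpty (openSub V ⊥).toScheme :=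
    ⟨fun x => ((range_openSubι V ⊥).le ⟨x, rfl⟩ : _ ∈ ((⊥ : V.toScheme.Opens) : Set V.toScheme))⟩
  exact cls_of_isEmpty _

theorem cls_openSub_sup_finset {V : CSch} (v : V ⟶ X) (hv : FT v) {σ : Type*} (s : Finset σ)
    (U : σ → V.toScheme.Opens) (h : Pairwise fun i j => Disjoint (U i) (U j)) :
    cls (openSubι V (s.sup U) ≫ v) ((FT.openSubι V _).comp hv) =
      ∑ i ∈ s, cls (openSubι V (U i) ≫ v) ((FT.openSubι V _).comp hv) := by
  classical
  induction s using Finset.induction_on with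
  | empty => exact cls_openSub_bot v hv
  | insert a s ha ih =>
    rw [Finset.sum_insert ha, ← ih, ← cls_openSub_sup v hv _ _
      (Finset.disjoint_sup_right.2 fun i hi => h (ne_of_mem_of_not_mem hi ha).symm)]
    congr 1
    all_goals rw [Finset.sup_insert]

theorem cls_openSub {V W : CSch} (v : V ⟶ X) (hv : FT v) (U : V.toScheme.Opens) (w : W ⟶ V)
    [IsOpenImmersion (mor w)] (hw : Set.range (mor w) = U) (hwv : FT (w ≫ v)) :
    cls (openSubι V U ≫ v) ((FT.openSubι V _).comp hv) = cls (w ≫ v) hwv :=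
  cls_congr (isoOfRangeEq _ _ (by rw [range_openSubι, hw]))
    (by rw [← Category.assoc, isoOfRangeEq_hom_comp]) _ _

/-- An element of `K0 X` is the sum of its restrictions to the connected components. -/
theorem sum_push_pull [Fintype (π₀ X)] (a : K0 X) :
    ∑ c : π₀ X, push (componentι X c) (.componentι X c) (pull (componentι X c) a) = a := by
  suffices h : ∑ c : π₀ X, (push (componentι X c) (.componentι X c)).comp (pull (componentι X c)) =
      AddMonoidHom.id _ by
    simpa using DFunLike.congr_fun h a
  refine hom_ext fun {V} v hv => ?_
  -- The preimages of the finitely many components form a partition of `V` into open subschemes, and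
  -- the summand for `c` is the class of the corresponding piece.
  let U : π₀ X → V.toScheme.Opens := fun c => mor v ⁻¹ᵁ compOpens X c
  have hU : Pairwise fun c d => Disjoint (U c) (U d) := fun c d hcd =>
    TopologicalSpace.Opens.coe_disjoint.1
      ((Set.disjoint_singleton.2 hcd).preimage (fun y => ConnectedComponents.mk (mor v y)))
  have htop : Finset.univ.sup U = ⊤ := by
    refine TopologicalSpace.Opens.ext (Set.eq_univ_of_forall fun x => ?_)
    rw [SetLike.mem_coe]
    exact (Finset.le_sup (f := U) (Finset.mem_univ (ConnectedComponents.mk (mor v x))) :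
      U _ ≤ _) (show x ∈ U _ from rfl)
  have : IsOpenImmersion (mor (𝟙 V)) := inferInstanceAs (IsOpenImmersion (𝟙 V.toScheme))
  have key := cls_openSub_sup_finset v hv Finset.univ U hU
  have h1 := cls_openSub v hv (Finset.univ.sup U) (𝟙 V)
    (hw := by rw [htop]; exact Set.range_id) ((FT.id V).comp hv)
  have h2 : cls (𝟙 V ≫ v) ((FT.id V).comp hv) = cls v hv :=
    cls_congr (Iso.refl V) (by simp) _ _
  rw [AddMonoidHom.finsetSum_apply, AddMonoidHom.id_apply]
  refine Eq.trans ?_ (key.symm.trans (h1.trans h2))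
  refine Finset.sum_congr rfl fun c _ => ?_
  have hp := isPullback_restrictMap v (compOpens X c) (isClosed_compOpens X c)
  exact (push_pull_cls hp hv (FT.componentι X c) ((FT.of_isPullback hp hv).comp (FT.componentι X c))).trans
    (cls_congr (Iso.refl _) ((Category.id_comp _).trans hp.w.symm) _ _)

end K0
end Motivic

namespace Motivic

/-! ### Classes generate -/

/-- The preimage of a compact open set is the union of its compact traces on `Z` and on `U`. -/
theorem FT.of_isCut {V Z U X : CSch} {i : Z ⟶ V} {j : U ⟶ V} (h : IsCut i j) {v : V ⟶ X}
    (hi : FT (i ≫ v)) (hj : FT (j ≫ v)) : FT v := by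
  refine ⟨inferInstance, ⟨fun O hO (hc : IsCompact O) => ?_⟩⟩
  have h1 := (hi.2.isCompact_preimage O hO hc).image (mor i).continuous
  have h2 := (hj.2.isCompact_preimage O hO hc).image (mor j).continuous
  have : mor v ⁻¹' O = mor i '' (mor (i ≫ v) ⁻¹' O) ∪ mor j '' (mor (j ≫ v) ⁻¹' O) := by
    refine Set.Subset.antisymm (fun x hx => ?_) (Set.union_subset ?_ ?_)
    · by_cases hxi : x ∈ Set.range (mor i)
      · obtain ⟨y, rfl⟩ := hxi
        exact Or.inl ⟨y, hx, rfl⟩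
      · obtain ⟨y, rfl⟩ := h.compl.ge hxi
        exact Or.inr ⟨y, hx, rfl⟩
    · exact Set.image_subset_iff.2 fun y hy => hy
    · exact Set.image_subset_iff.2 fun y hy => hy
  rw [this]
  exact h1.union h2

theorem exists_isCut_sum {V W X : CSch} (v : V ⟶ X) (w : W ⟶ X) :
    ∃ (S : CSch) (i : V ⟶ S) (j : W ⟶ S) (s : S ⟶ X), IsCut i j ∧ i ≫ s = v ∧ j ≫ s = w := by
  let F : Bool → CSch := fun b => cond b V W
  refine ⟨sigmaObj F, sigmaInj F true, sigmaInj F false,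
    sigmaDesc (V := F) (Bool.rec w v), isCut_of_isClosed ?_, sigmaInj_desc (V := F) _ true,
    sigmaInj_desc (V := F) _ false⟩
  ext x
  constructor
  · rintro ⟨y, rfl⟩ ⟨z, hz⟩
    exact Bool.noConfusion (sigmaInj_eq_iff F hz)
  · intro hx
    obtain ⟨b, y, rfl⟩ := exists_sigmaInj_eq F x
    cases b
    · exact ⟨y, rfl⟩
    · exact (hx ⟨y, rfl⟩).elim

/-- A family of morphisms to the connected components comes from a morphism to the whole. -/
theorem exists_isPullback_components {X : CSch} (V : π₀ X → CSch) (v : ∀ c, V c ⟶ component X c)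
    (hv : ∀ c, FT (v c)) : ∃ (W : CSch) (w : W ⟶ X), FT w ∧
      ∀ c, ∃ q, IsPullback (v c) q (componentι X c) w := by
  let w : sigmaObj V ⟶ X := sigmaDesc fun c => v c ≫ componentι X c
  have hw : ∀ c, sigmaInj V c ≫ w = v c ≫ componentι X c := sigmaInj_desc _
  have H : ∀ c, IsPullback (v c) (sigmaInj V c) (componentι X c) w := fun c => by
    refine (isPullback_of_isOpenImmersion (hw c) fun x hx => ?_).flip
    obtain ⟨d, y, rfl⟩ := exists_sigmaInj_eq V x
    rw [Set.mem_preimage, range_componentι, ← mor_comp_apply, hw d] at hx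
    obtain rfl : d = c := (mk_componentι d (mor (v d) y)).symm.trans hx
    exact ⟨y, rfl⟩
  refine ⟨sigmaObj V, w, ⟨inferInstance, ?_⟩, fun c => ⟨_, H c⟩⟩
  have : IsZariskiLocalAtTarget @QuasiCompact :=
    (HasAffineProperty.iff.1
      instHasAffinePropertyQuasiCompactCompactSpaceCarrierCarrierCommRingCat).1
  -- The components form an open cover of `X`, and over the component `c` the morphism `w` is
  -- isomorphic to `v c`.
  refine IsZariskiLocalAtTarget.of_iSup_eq_top (P := @QuasiCompact) (compOpens X)
    (TopologicalSpace.Opens.ext (Set.eq_univ_of_forall fun x => ?_)) fun c => ?_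
  · exact TopologicalSpace.Opens.mem_iSup.2 ⟨ConnectedComponents.mk x, rfl⟩
  · have hp := isPullback_restrictMap w (compOpens X c) (isClosed_compOpens X c)
    have h1 := hp.isoIsPullback_hom_fst _ _ (H c)
    have h2 : FT (restrictMap w (compOpens X c) (isClosed_compOpens X c)) := by
      rw [← h1]; exact (FT.of_isIso _).comp (hv c)
    exact h2.2

namespace K0

variable {X Y : CSch}

theorem exists_cls_add {V W : CSch} (v : V ⟶ X) (w : W ⟶ X) (hv : FT v) (hw : FT w) :
    ∃ (S : CSch) (s : S ⟶ X) (hs : FT s), cls s hs = cls v hv + cls w hw := by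
  obtain ⟨S, i, j, s, h, rfl, rfl⟩ := exists_isCut_sum v w
  have hs := FT.of_isCut h hv hw
  exact ⟨S, s, hs, isMotivic_cls.cut s hs h _ _ hv hw rfl rfl⟩

/-- Disjoint unions realise sums of classes. A generator is written as `[V ⊔ V] - [V]`, and its
negative as `[V] - [V ⊔ V]`. -/
theorem exists_eq_sub (a : K0 X) : ∃ (V W : CSch) (v : V ⟶ X) (w : W ⟶ X) (hv : FT v) (hw : FT w),
    a = cls v hv - cls w hw := by
  induction a using QuotientAddGroup.induction_on with | H a => ?_
  have key : ∀ v : FTOver X, ∃ (S : CSch) (s : S ⟶ X) (hs : FT s),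
      cls s hs = cls v.hom v.ft + cls v.hom v.ft := fun v => exists_cls_add _ _ _ _
  induction a using FreeAbelianGroup.induction_on with
  | zero => exact ⟨X, X, 𝟙 X, 𝟙 X, FT.id X, FT.id X, (sub_self _).symm⟩
  | of v =>
    obtain ⟨S, s, hs, h⟩ := key v
    exact ⟨S, _, s, v.hom, hs, v.ft, by rw [h, add_sub_cancel_right]; rfl⟩
  | neg v =>
    obtain ⟨S, s, hs, h⟩ := key v
    exact ⟨_, S, v.hom, s, v.ft, hs, by rw [h, sub_add_cancel_left]; rfl⟩
  | add a b ha hb =>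
    obtain ⟨V, W, v, w, hv, hw, h⟩ := ha
    obtain ⟨V', W', v', w', hv', hw', h'⟩ := hb
    obtain ⟨S, s, hs, h1⟩ := exists_cls_add v v' hv hv'
    obtain ⟨T, t, ht, h2⟩ := exists_cls_add w w' hw hw'
    refine ⟨S, T, s, t, hs, ht, ?_⟩
    rw [h1, h2, add_sub_add_comm, ← h, ← h']; rfl

end K0

namespace K0Bar

variable {X Y : CSch}

@[ext]
theorem ext_apply {a b : K0Bar X} (h : ∀ c, a c = b c) : a = b := funext h

theorem add_apply (a b : K0Bar X) (c : π₀ X) : (a + b) c = a c + b c := rfl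

theorem sub_apply (a b : K0Bar X) (c : π₀ X) : (a - b) c = a c - b c := rfl

theorem cls_apply {V P : CSch} {v : V ⟶ X} {c : π₀ X} {p : P ⟶ component X c} {q : P ⟶ V}
    (h : IsPullback p q (componentι X c) v) (hv : FT v) (hp : FT p) :
    cls v hv c = K0.cls p hp :=
  K0.cls_of_isPullback (isPullback_restrictMap v (compOpens X c) (isClosed_compOpens X c)) h _ _

theorem cls_congr {V V' : CSch} {v : V ⟶ X} {v' : V' ⟶ X} (e : V ≅ V') (h : e.hom ≫ v' = v)
    (hv : FT v) (hv' : FT v') : cls v hv = cls v' hv' := by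
  ext c
  have h1 := isPullback_fib (componentι X c) v
  have hp := FT.of_isPullback h1 hv
  rw [cls_apply h1 hv hp, cls_apply (isPullback_comp_iso h1 e h) hv' hp]

theorem cls_of_isEmpty {V : CSch} {v : V ⟶ X} (hv : FT v) [IsEmpty V.toScheme] :
    cls v hv = 0 := by
  ext c
  have h1 := isPullback_fib (componentι X c) v
  have : IsEmpty (fibObj (componentι X c) v).toScheme :=
    ⟨fun x => IsEmpty.false (mor (fibSnd (componentι X c) v) x)⟩
  rw [cls_apply h1 hv (.of_isPullback h1 hv), K0.cls_of_isEmpty]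
  rfl

theorem cls_cut {V Z U : CSch} {v : V ⟶ X} (hv : FT v) {i : Z ⟶ V} {j : U ⟶ V} (h : IsCut i j)
    {z : Z ⟶ X} {w : U ⟶ X} (hz : FT z) (hw : FT w) (hz' : i ≫ v = z) (hw' : j ≫ v = w) :
    cls v hv = cls z hz + cls w hw := by
  subst hz' hw'
  ext c
  have h1 := isPullback_fib (componentι X c) v
  have hi := isPullback_fib (fibSnd (componentι X c) v) i
  have hj := isPullback_fib (fibSnd (componentι X c) v) j
  have hi' := hi.paste_horiz h1
  have hj' := hj.paste_horiz h1
  rw [add_apply, cls_apply h1 hv (.of_isPullback h1 hv),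
    cls_apply hi' hz (.of_isPullback hi' hz), cls_apply hj' hw (.of_isPullback hj' hw)]
  exact K0.isMotivic_cls.cut _ _ (h.of_isPullback hi hj) _ _ _ _ rfl rfl

theorem exists_cls_add {V W : CSch} (v : V ⟶ X) (w : W ⟶ X) (hv : FT v) (hw : FT w) :
    ∃ (S : CSch) (s : S ⟶ X) (hs : FT s) (i : V ⟶ S) (j : W ⟶ S), IsCut i j ∧ i ≫ s = v ∧
      j ≫ s = w ∧ cls s hs = cls v hv + cls w hw := by
  obtain ⟨S, i, j, s, h, rfl, rfl⟩ := exists_isCut_sum v w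
  have hs := FT.of_isCut h hv hw
  exact ⟨S, s, hs, i, j, h, rfl, rfl, cls_cut hs h hv hw rfl rfl⟩

/-- Pick a difference of classes over every component; the disjoint union over all components is
still of finite type over `X`, as this is local on `X`. Therefore additive identities on the
completed group may be verified on classes alone. -/
theorem exists_eq_sub (a : K0Bar X) :
    ∃ (V W : CSch) (v : V ⟶ X) (w : W ⟶ X) (hv : FT v) (hw : FT w), a = cls v hv - cls w hw := by
  choose V W v w hv hw h using fun c => K0.exists_eq_sub (a c)
  obtain ⟨V', v', hv', H⟩ := exists_isPullback_components V v hv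
  obtain ⟨W', w', hw', H'⟩ := exists_isPullback_components W w hw
  refine ⟨V', W', v', w', hv', hw', ext_apply fun c => ?_⟩
  rw [sub_apply, h c, cls_apply (H c).choose_spec, cls_apply (H' c).choose_spec]

theorem hom_ext {A : Type*} [AddCommGroup A] {f g : K0Bar X →+ A}
    (h : ∀ {V : CSch} (v : V ⟶ X) (hv : FT v), f (cls v hv) = g (cls v hv)) : f = g := by
  ext a
  obtain ⟨V, W, v, w, hv, hw, rfl⟩ := exists_eq_sub a
  rw [map_sub, map_sub, h, h]

/-- A function on morphisms of finite type which respects equality of classes and disjoint unions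
extends to the completed Grothendieck group. -/
structure IsMotivic {A : Type*} [AddCommGroup A] (f : ∀ {V : CSch} (v : V ⟶ X), FT v → A) :
    Prop where
  congr : ∀ {V W : CSch} (v : V ⟶ X) (w : W ⟶ X) (hv : FT v) (hw : FT w),
    cls v hv = cls w hw → f v hv = f w hw
  cut : ∀ {V Z U : CSch} (v : V ⟶ X) (hv : FT v) {i : Z ⟶ V} {j : U ⟶ V}, IsCut i j →
    ∀ (hz : FT (i ≫ v)) (hw : FT (j ≫ v)), f v hv = f (i ≫ v) hz + f (j ≫ v) hw

theorem IsMotivic.sub_eq_sub {A : Type*} [AddCommGroup A]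
    {f : ∀ {V : CSch} (v : V ⟶ X), FT v → A} (hf : IsMotivic f) {V W V' W' : CSch} {v : V ⟶ X}
    {w : W ⟶ X} {v' : V' ⟶ X} {w' : W' ⟶ X} (hv : FT v) (hw : FT w) (hv' : FT v') (hw' : FT w')
    (h : cls v hv - cls w hw = cls v' hv' - cls w' hw') :
    f v hv - f w hw = f v' hv' - f w' hw' := by
  rw [sub_eq_sub_iff_add_eq_add] at h ⊢
  obtain ⟨S, s, hs, i, j, hc, rfl, rfl, h1⟩ := exists_cls_add v w' hv hw'
  obtain ⟨T, t, ht, i', j', hc', rfl, rfl, h2⟩ := exists_cls_add v' w hv' hw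
  rw [← hf.cut s hs hc, ← hf.cut t ht hc']
  exact hf.congr _ _ _ _ (h1.trans (h.trans h2.symm))

/-- The completed group is a product and has no evident presentation by generators and relations.
Every element is however a difference of classes, and an equality of differences becomes an equality
of two classes of disjoint unions, to which `congr` applies. -/
theorem IsMotivic.exists_lift {A : Type*} [AddCommGroup A]
    {f : ∀ {V : CSch} (v : V ⟶ X), FT v → A} (hf : IsMotivic f) :
    ∃ F : K0Bar X →+ A, ∀ {V : CSch} (v : V ⟶ X) (hv : FT v), F (cls v hv) = f v hv := by
  choose V W v w hv hw h using exists_eq_sub (X := X)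
  have key : ∀ {V' W' : CSch} (v' : V' ⟶ X) (w' : W' ⟶ X) (hv' : FT v') (hw' : FT w')
      (a : K0Bar X), a = cls v' hv' - cls w' hw' →
      f (v a) (hv a) - f (w a) (hw a) = f v' hv' - f w' hw' := fun v' w' hv' hw' a ha =>
    hf.sub_eq_sub _ _ _ _ ((h a).symm.trans ha)
  refine ⟨AddMonoidHom.mk' (fun a => f (v a) (hv a) - f (w a) (hw a)) fun a b => ?_,
    fun {V'} v' hv' => ?_⟩
  · obtain ⟨S, s, hs, i, j, hc, hi, hj, h1⟩ := exists_cls_add (v a) (v b) (hv a) (hv b)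
    obtain ⟨T, t, ht, i', j', hc', hi', hj', h2⟩ := exists_cls_add (w a) (w b) (hw a) (hw b)
    rw [key s t hs ht (a + b) (by rw [h1, h2, add_sub_add_comm, ← h a, ← h b]),
      hf.cut s hs hc (by rw [hi]; exact hv a) (by rw [hj]; exact hv b),
      hf.cut t ht hc' (by rw [hi']; exact hw a) (by rw [hj']; exact hw b)]
    simp only [hi, hj, hi', hj']
    abel
  -- A class is the difference between the class of two disjoint copies and the class of one copy.
  · obtain ⟨S, s, hs, i, j, hc, rfl, hj, h1⟩ := exists_cls_add v' v' hv' hv'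
    refine (key s (i ≫ s) hs hv' _ (by rw [h1, add_sub_cancel_right])).trans ?_
    rw [hf.cut s hs hc hv' (by rwa [hj])]
    simp only [hj, add_sub_cancel_right]

end K0Bar
end Motivic

namespace Motivic

/-! ### Operations on the completed Grothendieck group -/

namespace K0Bar

variable {X Y Z : CSch}

/-- The projection of `K0Bar X` to the factor of a connected component. -/
def proj (c : π₀ X) : K0Bar X →+ K0 (component X c) := Pi.evalAddMonoidHom _ c

/-- The pull-back to the uncompleted Grothendieck group of a quasi-compact `T`. -/
def ev {T : CSch} [CompactSpace T.toScheme] (g : T ⟶ Y) : K0Bar Y →+ K0 T :=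
  haveI := finite_components T
  haveI := Fintype.ofFinite (π₀ T)
  ∑ c : π₀ T, ((K0.push (componentι T c) (.componentι T c)).comp (K0.pull (compHom g c))).comp
    (proj (compMap g c))

/-- A quasi-compact `T` has finitely many components, each mapping to one component of `Y`, and the
class of the base change is the sum of its restrictions to them. -/
theorem ev_cls {T V P : CSch} [CompactSpace T.toScheme] {g : T ⟶ Y} {v : V ⟶ Y} {p : P ⟶ T}
    {q : P ⟶ V} (h : IsPullback p q g v) (hv : FT v) (hp : FT p) :
    ev g (cls v hv) = K0.cls p hp := by
  have := finite_components T
  let := Fintype.ofFinite (π₀ T)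
  rw [ev, AddMonoidHom.finsetSum_apply]
  refine Eq.trans (Finset.sum_congr rfl fun c _ => ?_) (K0.sum_push_pull (K0.cls p hp))
  rw [AddMonoidHom.comp_apply, AddMonoidHom.comp_apply]
  congr 1
  have h1 := isPullback_restrictMap v (compOpens Y (compMap g c)) (isClosed_compOpens _ _)
  have h2 := isPullback_fib (compHom g c)
    (restrictMap v (compOpens Y (compMap g c)) (isClosed_compOpens _ _))
  have h3 := isPullback_fib (componentι T c) p
  have h4 := h2.paste_vert h1
  have h5 := h3.paste_vert h
  have h6 : compHom g c ≫ restrictι Y (compOpens Y (compMap g c)) (isClosed_compOpens _ _) =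
      componentι T c ≫ g := compHom_ι g c
  rw [h6] at h4
  have hp3 := FT.of_isPullback h3 hp
  have hp2 := FT.of_isPullback h4 hv
  rw [K0.pull_cls h3 hp hp3]
  exact (K0.pull_cls h2 (hv.restrictMap _ _) hp2).trans (K0.cls_of_isPullback h4 h5 _ _)

theorem ev_componentι (c : π₀ X) (a : K0Bar X) : ev (componentι X c) a = a c := by
  suffices h : ev (componentι X c) = proj c from DFunLike.congr_fun h a
  refine hom_ext fun v hv => ?_
  have h := isPullback_restrictMap v (compOpens X c) (isClosed_compOpens X c)
  exact ev_cls (T := component X c) h hv (hv.restrictMap _ _)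

theorem ext_ev {a b : K0Bar X} (h : ∀ c, ev (componentι X c) a = ev (componentι X c) b) :
    a = b :=
  funext fun c => (ev_componentι c a).symm.trans ((h c).trans (ev_componentι c b))

/-- A homomorphism from its components. -/
def mkHom {A : Type*} [AddCommGroup A] (f : ∀ c : π₀ X, A →+ K0 (component X c)) : A →+ K0Bar X :=
  AddMonoidHom.mk' (fun a c => f c a) fun a b => funext fun c => map_add (f c) a b

/-- The pull-back. -/
def pull (u : X ⟶ Y) : K0Bar Y →+ K0Bar X := mkHom fun c => ev (componentι X c ≫ u)

theorem pull_cls {P V : CSch} {p : P ⟶ X} {q : P ⟶ V} {u : X ⟶ Y} {v : V ⟶ Y}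
    (h : IsPullback p q u v) (hv : FT v) (hp : FT p) : pull u (cls v hv) = cls p hp := by
  ext c
  have h1 := isPullback_fib (componentι X c) p
  have hp1 := FT.of_isPullback h1 hp
  rw [cls_apply h1 hp hp1]
  exact ev_cls (h1.paste_vert h) hv hp1

theorem pull_cls_fib (u : X ⟶ Y) {V : CSch} (v : V ⟶ Y) (hv : FT v) :
    pull u (cls v hv) = cls (fibFst u v) (.of_isPullback (isPullback_fib u v) hv) :=
  pull_cls (isPullback_fib u v) _ _

theorem ft_fibFst (u : X ⟶ Y) {V : CSch} {v : V ⟶ Y} (hv : FT v) : FT (fibFst u v) :=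
  .of_isPullback (isPullback_fib u v) hv

theorem compactSpace_fib {X T : CSch} [CompactSpace T.toScheme] (t : T ⟶ Y) {u : X ⟶ Y}
    (hu : FT u) : CompactSpace (fibObj t u).toScheme := (ft_fibFst t hu).compactSpace

/-- The push-forward. -/
def push (u : X ⟶ Y) (hu : FT u) : K0Bar X →+ K0Bar Y := mkHom fun c =>
  -- The preimage under `u` of a component of `Y` may have several components of `X`, but it is
  -- quasi-compact since `u` is of finite type, so `ev` applies to it.
  haveI := compactSpace_fib (componentι Y c) hu
  (K0.push (fibFst (componentι Y c) u) (ft_fibFst _ hu)).comp (ev (fibSnd (componentι Y c) u))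

theorem push_cls {V : CSch} (v : V ⟶ X) (u : X ⟶ Y) (hv : FT v) (hu : FT u) {w : V ⟶ Y}
    (hw : v ≫ u = w) (hvu : FT w) :
    push u hu (cls v hv) = cls w hvu := by
  subst hw
  ext c
  have := compactSpace_fib (componentι Y c) hu
  have h1 := isPullback_fib (fibSnd (componentι Y c) u) v
  have h2 := h1.flip.paste_vert (isPullback_fib (componentι Y c) u).flip
  have hp := FT.of_isPullback h2.flip hvu
  rw [cls_apply h2.flip hvu hp]
  refine (congrArg _ (ev_cls h1 hv (.of_isPullback h1 hv))).trans (K0.push_cls _ (ft_fibFst _ hu) _ _)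

theorem isPullback_prodMap {V W : CSch} (v : V ⟶ X) (w : W ⟶ Y) :
    IsPullback (prod.map (𝟙 V) w) (prod.map v (𝟙 W)) (prod.map v (𝟙 Y)) (prod.map (𝟙 X) w) := by
  have h := isPullback_prodMap_snd V w
  rw [← Category.comp_id (prod.snd : V ⨯ W ⟶ W), ← prod.map_snd v (𝟙 W),
    ← Category.comp_id (prod.snd : V ⨯ Y ⟶ Y), ← prod.map_snd v (𝟙 Y)] at h
  exact (h.of_right (by simp) (isPullback_prodMap_snd X w)).flip

/-- The exterior product. -/
def ext : K0Bar X →+ K0Bar Y →+ K0Bar (X ⨯ Y) :=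
  AddMonoidHom.mk' (fun a => mkHom fun c => (K0.mul (ev (componentι (X ⨯ Y) c ≫ prod.fst) a)).comp
    (ev (componentι (X ⨯ Y) c ≫ prod.snd))) fun a b => by
      ext x c
      change K0.mul (ev _ (a + b)) _ = K0.mul (ev _ a) _ + K0.mul (ev _ b) _
      rw [map_add, map_add, AddMonoidHom.add_apply]

/-- The exterior product is the fibre product over `X × Y` of the pull-backs along the two
projections, and `V × W` is the fibre product of `V × Y` and `X × W`. -/
theorem ext_cls {V W : CSch} (v : V ⟶ X) (w : W ⟶ Y) (hv : FT v) (hw : FT w)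
    (hvw : FT (prod.map v w)) : ext (cls v hv) (cls w hw) = cls (prod.map v w) hvw := by
  ext c
  let i := componentι (X ⨯ Y) c
  change K0.mul (ev (i ≫ prod.fst) (cls v hv)) (ev (i ≫ prod.snd) (cls w hw)) = _
  have hv1 : IsPullback (prod.map v (𝟙 Y)) prod.fst prod.fst v := (isPullback_prodMap_fst v Y).flip
  have hw1 : IsPullback (prod.map (𝟙 X) w) prod.snd prod.snd w := (isPullback_prodMap_snd X w).flip
  have hv2 := isPullback_fib i (prod.map v (𝟙 Y))
  have hw2 := isPullback_fib i (prod.map (𝟙 X) w)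
  have hv3 := hv2.paste_vert hv1
  have hw3 := hw2.paste_vert hw1
  rw [ev_cls hv3 hv (.of_isPullback hv3 hv), ev_cls hw3 hw (.of_isPullback hw3 hw)]
  have h := isPullback_fib (fibFst i (prod.map v (𝟙 Y))) (fibFst i (prod.map (𝟙 X) w))
  have hK := isPullback_prodMap v w
  have h1 := h.paste_vert hw2
  rw [(isPullback_fib i (prod.map v (𝟙 Y))).w] at h1
  have h2 := (IsPullback.of_bot' h1 hK).paste_horiz hv2
  have hvw' : prod.map (𝟙 V) w ≫ prod.map v (𝟙 Y) = prod.map v w := by simp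
  rw [hvw'] at h2
  have hp := FT.of_isPullback h2 hvw
  rw [K0.mul_cls h _ _ hp, cls_apply h2 hvw hp]

end K0Bar
end Motivic

/-! ### The axioms for pull-back, push-forward and exterior product -/

namespace Motivic

theorem isPullback_prodMap_prodMap {P Q X X' W W' Y Y' : CSch} {p : P ⟶ X} {q : P ⟶ W}
    {u : X ⟶ Y} {w : W ⟶ Y} {p' : Q ⟶ X'} {q' : Q ⟶ W'} {u' : X' ⟶ Y'} {w' : W' ⟶ Y'}
    (h : IsPullback p q u w) (h' : IsPullback p' q' u' w') :
    IsPullback (prod.map p p') (prod.map q q') (prod.map u u') (prod.map w w') := by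
  refine ⟨⟨by simp [h.w, h'.w]⟩, ⟨PullbackCone.IsLimit.mk _
    (fun s => prod.lift
      (h.lift (s.fst ≫ prod.fst) (s.snd ≫ prod.fst) (by simpa using s.condition =≫ prod.fst))
      (h'.lift (s.fst ≫ prod.snd) (s.snd ≫ prod.snd) (by simpa using s.condition =≫ prod.snd)))
    (fun s => ?_) (fun s => ?_) fun s m h₁ h₂ => ?_⟩⟩
  · apply Limits.prod.hom_ext <;> simp [prod.lift_fst, prod.lift_snd]
  · apply Limits.prod.hom_ext <;> simp [prod.lift_fst, prod.lift_snd]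
  · apply Limits.prod.hom_ext
    · rw [prod.lift_fst]
      apply h.hom_ext
      · simpa using h₁ =≫ prod.fst
      · simpa using h₂ =≫ prod.fst
    · rw [prod.lift_snd]
      apply h'.hom_ext
      · simpa using h₁ =≫ prod.snd
      · simpa using h₂ =≫ prod.snd

theorem isPullback_of_mono {V Z X : CSch} (v : V ⟶ Z) (i : Z ⟶ X) [Mono i] :
    IsPullback v (𝟙 V) i (v ≫ i) := by
  simpa using (IsPullback.id_vert v).paste_horiz (IsKernelPair.id_of_mono i)

instance isIso_lift_toPt (X : CSch) : IsIso (prod.lift (𝟙 X) (toPt X)) :=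
  ⟨prod.fst, prod.lift_fst _ _, by
    apply Limits.prod.hom_ext
    · simp [prod.lift_fst]
    · exact ptIsTerminal.hom_ext _ _⟩

theorem isEmpty_fib_of_disjoint {X Y Z : CSch} {f : X ⟶ Z} {g : Y ⟶ Z}
    (h : Disjoint (Set.range (mor f)) (Set.range (mor g))) : IsEmpty (fibObj f g).toScheme :=
  ⟨fun x => Set.disjoint_left.1 h ⟨mor (fibFst f g) x, rfl⟩ ⟨mor (fibSnd f g) x, by
    rw [← mor_comp_apply, ← mor_comp_apply, (isPullback_fib f g).w]⟩⟩

namespace K0Bar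

variable {X Y Z : CSch}

@[elab_as_elim]
theorem induction {p : K0Bar X → Prop} (a : K0Bar X)
    (cls : ∀ {V : CSch} (v : V ⟶ X) (hv : FT v), p (cls v hv))
    (sub : ∀ a b, p a → p b → p (a - b)) : p a := by
  obtain ⟨V, W, v, w, hv, hw, rfl⟩ := exists_eq_sub a
  exact sub _ _ (cls v hv) (cls w hw)

theorem pull_id (a : K0Bar X) : pull (𝟙 X) a = a := by
  induction a using induction with
  | cls v hv => exact pull_cls (IsPullback.id_vert v) hv hv
  | sub a b ha hb => rw [map_sub, ha, hb]

theorem pull_comp (u : X ⟶ Y) (v : Y ⟶ Z) (a : K0Bar Z) : pull (u ≫ v) a = pull u (pull v a) := by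
  induction a using induction with
  | cls w hw =>
    have h1 := isPullback_fib v w
    have h2 := isPullback_fib u (fibFst v w)
    have hp := FT.of_isPullback h1 hw
    have hp2 := FT.of_isPullback h2 hp
    rw [pull_cls h1 hw hp, pull_cls h2 hp hp2]
    exact pull_cls (h2.paste_vert h1) hw hp2
  | sub a b ha hb => simp only [map_sub, ha, hb]

theorem push_id (a : K0Bar X) : push (𝟙 X) (FT.id X) a = a := by
  induction a using induction with
  | cls v hv => exact push_cls _ _ _ _ (Category.comp_id v) hv
  | sub a b ha hb => simp only [map_sub, ha, hb]

theorem push_comp (u : X ⟶ Y) (v : Y ⟶ Z) (hu : FT u) (hv : FT v) (a : K0Bar X) :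
    push (u ≫ v) (hu.comp hv) a = push v hv (push u hu a) := by
  induction a using induction with
  | cls w hw =>
    rw [push_cls w u hw hu rfl (hw.comp hu), push_cls _ v (hw.comp hu) hv rfl ((hw.comp hu).comp hv)]
    exact push_cls _ _ _ _ (Category.assoc _ _ _).symm _
  | sub a b ha hb => simp only [map_sub, ha, hb]

theorem pull_cls_of_isIso {V W : CSch} (u : X ⟶ Y) [IsIso u] (e : V ⟶ W) [IsIso e] {v : V ⟶ X}
    {w : W ⟶ Y} (h : v ≫ u = e ≫ w) (hv : FT v) (hw : FT w) : pull u (cls w hw) = cls v hv :=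
  pull_cls (IsPullback.of_vert_isIso ⟨h⟩) hw hv

theorem ext_assoc (a : K0Bar X) (b : K0Bar Y) (c : K0Bar Z) :
    pull (prod.associator X Y Z).hom (ext a (ext b c)) = ext (ext a b) c := by
  induction a using induction with
  | sub a b ha hb => simp only [map_sub, AddMonoidHom.sub_apply, ha, hb]
  | cls u hu =>
  induction b using induction with
  | sub a b ha hb => simp only [map_sub, AddMonoidHom.sub_apply, ha, hb]
  | cls v hv =>
  induction c using induction with
  | sub a b ha hb => simp only [map_sub, ha, hb]
  | cls w hw =>
  rw [ext_cls v w hv hw (hv.prodMap hw), ext_cls u v hu hv (hu.prodMap hv),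
    ext_cls _ _ hu (hv.prodMap hw) (hu.prodMap (hv.prodMap hw)),
    ext_cls _ _ (hu.prodMap hv) hw ((hu.prodMap hv).prodMap hw)]
  exact pull_cls_of_isIso _ (Limits.prod.associator _ _ _).hom (prod.associator_naturality _ _ _) _ _

theorem ext_symm (a : K0Bar X) (b : K0Bar Y) :
    pull (prod.braiding Y X).hom (ext a b) = ext b a := by
  induction a using induction with
  | sub a b ha hb => simp only [map_sub, AddMonoidHom.sub_apply, ha, hb]
  | cls u hu =>
  induction b using induction with
  | sub a b ha hb => simp only [map_sub, AddMonoidHom.sub_apply, ha, hb]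
  | cls v hv =>
  rw [ext_cls u v hu hv (hu.prodMap hv), ext_cls v u hv hu (hv.prodMap hu)]
  exact pull_cls_of_isIso _ (prod.braiding _ _).hom (by simp) _ _

theorem ext_one (a : K0Bar X) :
    pull (prod.lift (𝟙 X) (toPt X)) (ext a (cls (𝟙 pt) (FT.id pt))) = a := by
  induction a using induction with
  | sub a b ha hb => simp only [map_sub, AddMonoidHom.sub_apply, ha, hb]
  | @cls V v hv =>
  rw [ext_cls v _ hv (FT.id pt) (hv.prodMap (FT.id pt))]
  refine pull_cls_of_isIso _ (prod.lift (𝟙 V) (toPt V)) ?_ hv _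
  apply Limits.prod.hom_ext
  · simp [prod.lift_fst]
  · exact ptIsTerminal.hom_ext _ _

theorem ev_eq {T : CSch} [CompactSpace T.toScheme] (g : T ⟶ Y) (a : K0Bar Y) :
    ev g a = ev (𝟙 T) (pull g a) := by
  induction a using induction with
  | sub a b ha hb => simp only [map_sub, ha, hb]
  | cls v hv =>
  have h := isPullback_fib g v
  have hp := FT.of_isPullback h hv
  rw [ev_cls h hv hp, pull_cls h hv hp, ev_cls (IsPullback.id_vert _) hp hp]

/-- Surjectivity comes from disjoint unions: differences of classes over the components are
assembled into one difference over `X`. -/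
theorem pull_component_bijective (X : CSch) :
    Function.Bijective fun (a : K0Bar X) (c : π₀ X) => pull (componentι X c) a := by
  constructor
  · intro a b h
    refine ext_ev fun c => ?_
    rw [ev_eq, ev_eq _ b]
    exact congrArg (ev (𝟙 (component X c))) (congrFun h c)
  · intro b
    choose V W v w hv hw h using fun c => exists_eq_sub (b c)
    obtain ⟨V', v', hv', H⟩ := exists_isPullback_components V v hv
    obtain ⟨W', w', hw', H'⟩ := exists_isPullback_components W w hw
    refine ⟨cls v' hv' - cls w' hw', funext fun c => ?_⟩
    rw [h c, ← pull_cls (H c).choose_spec hv', ← pull_cls (H' c).choose_spec hw']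
    exact map_sub _ _ _

theorem base_change {P : CSch} {v' : P ⟶ X} {u' : P ⟶ Y} {u : X ⟶ Z} {v : Y ⟶ Z}
    (h : IsPullback v' u' u v) (hu : FT u) (hu' : FT u') (a : K0Bar X) :
    push u' hu' (pull v' a) = pull v (push u hu a) := by
  induction a using induction with
  | sub a b ha hb => simp only [map_sub, ha, hb]
  | cls w hw =>
  have h1 := isPullback_fib v' w
  have hp := FT.of_isPullback h1 hw
  rw [pull_cls h1 hw hp, push_cls _ u' hp hu' rfl (hp.comp hu'),
    push_cls w u hw hu rfl (hw.comp hu)]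
  exact (pull_cls (h1.paste_horiz h.flip) _ _).symm

theorem pull_ext {X' Y' : CSch} (u : X ⟶ X') (v : Y ⟶ Y') (a : K0Bar X') (b : K0Bar Y') :
    pull (prod.map u v) (ext a b) = ext (pull u a) (pull v b) := by
  induction a using induction with
  | sub a b ha hb => simp only [map_sub, AddMonoidHom.sub_apply, ha, hb]
  | cls w hw =>
  induction b using induction with
  | sub a b ha hb => simp only [map_sub, ha, hb]
  | cls x hx =>
  have h1 := isPullback_fib u w
  have h2 := isPullback_fib v x
  have hp1 := FT.of_isPullback h1 hw
  have hp2 := FT.of_isPullback h2 hx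
  rw [ext_cls w x hw hx (hw.prodMap hx), pull_cls h1 hw hp1, pull_cls h2 hx hp2,
    ext_cls _ _ hp1 hp2 (hp1.prodMap hp2)]
  exact pull_cls (isPullback_prodMap_prodMap h1 h2) _ _

theorem push_ext {X' Y' : CSch} (u : X ⟶ X') (v : Y ⟶ Y') (hu : FT u) (hv : FT v)
    (huv : FT (prod.map u v)) (a : K0Bar X) (b : K0Bar Y) :
    push (prod.map u v) huv (ext a b) = ext (push u hu a) (push v hv b) := by
  induction a using induction with
  | sub a b ha hb => simp only [map_sub, AddMonoidHom.sub_apply, ha, hb]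
  | cls w hw =>
  induction b using induction with
  | sub a b ha hb => simp only [map_sub, ha, hb]
  | cls x hx =>
  rw [ext_cls w x hw hx (hw.prodMap hx), push_cls w u hw hu rfl (hw.comp hu),
    push_cls x v hx hv rfl (hx.comp hv), ext_cls _ _ _ _ ((hw.comp hu).prodMap (hx.comp hv))]
  exact push_cls _ _ _ _ (by simp) _

theorem pull_push_of_mono (i : Z ⟶ X) [Mono i] (hi : FT i) (a : K0Bar Z) :
    pull i (push i hi a) = a := by
  induction a using induction with
  | sub a b ha hb => simp only [map_sub, ha, hb]
  | cls v hv =>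
  rw [push_cls v i hv hi rfl (hv.comp hi)]
  exact pull_cls (isPullback_of_mono v i) _ _

theorem pull_push_of_disjoint {U : CSch} (i : Z ⟶ X) (hi : FT i) (j : U ⟶ X)
    (h : Disjoint (Set.range (mor j)) (Set.range (mor i))) (a : K0Bar Z) :
    pull j (push i hi a) = 0 := by
  induction a using induction with
  | sub a b ha hb => simp only [map_sub, ha, hb, sub_zero]
  | cls v hv =>
  have hr : Set.range (mor (v ≫ i)) ⊆ Set.range (mor i) :=
    Set.range_subset_iff.2 fun x => ⟨mor v x, rfl⟩
  have := isEmpty_fib_of_disjoint (h.mono_right hr)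
  rw [push_cls v i hv hi rfl (hv.comp hi), pull_cls_fib, cls_of_isEmpty]

theorem cut_add {U : CSch} {i : Z ⟶ X} {j : U ⟶ X} (h : IsCut i j) (a : K0Bar X) :
    a = push i (.of_isClosedImmersion h.closed) (pull i a) +
      push j (.of_isOpenImmersion h.isOpen) (pull j a) := by
  induction a using induction with
  | sub a b ha hb => rw [map_sub, map_sub, map_sub, map_sub, sub_add_sub_comm, ← ha, ← hb]
  | cls v hv =>
  have hi : FT i := .of_isClosedImmersion h.closed
  have hj : FT j := .of_isOpenImmersion h.isOpen
  have h1 := isPullback_fib i v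
  have h2 := isPullback_fib j v
  have hp1 := FT.of_isPullback h1 hv
  have hp2 := FT.of_isPullback h2 hv
  rw [pull_cls h1 hv hp1, pull_cls h2 hv hp2, push_cls _ i hp1 hi rfl (hp1.comp hi),
    push_cls _ j hp2 hj rfl (hp2.comp hj)]
  exact cls_cut hv (h.of_isPullback h1.flip h2.flip) _ _ h1.w.symm h2.w.symm

end K0Bar
end Motivic

namespace Motivic

/-! ### The group of series with constant term `1` over a graded commutative ring -/

/-- A graded commutative ring, the product being indexed by equations between degrees. -/
structure GradedMul (A : ℕ → Type w) [∀ n, AddCommGroup (A n)] where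
  mul : ∀ {l m n : ℕ}, l + m = n → A l →+ A m →+ A n
  one : A 0
  mul_one : ∀ {n : ℕ} (a : A n), mul (Nat.add_zero n) a one = a
  mul_comm : ∀ {l m n : ℕ} (h : l + m = n) (h' : m + l = n) (a : A l) (b : A m),
    mul h a b = mul h' b a
  mul_assoc : ∀ {l m k p q n : ℕ} (h₁ : l + m = p) (h₂ : p + k = n) (h₃ : m + k = q)
    (h₄ : l + q = n) (a : A l) (b : A m) (c : A k), mul h₂ (mul h₁ a b) c = mul h₄ a (mul h₃ b c)

namespace GradedMul

variable {A : ℕ → Type w} [∀ n, AddCommGroup (A n)] (C : GradedMul A)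

/-- Series with constant term `1`. -/
@[ext]
structure Series where
  coeff : ∀ n, A n
  coeff_zero : coeff 0 = C.one

/-- A summand of the convolution product. -/
def term (s t : ∀ n, A n) (n : ℕ) (p : ℕ × ℕ) : A n :=
  if h : p.1 + p.2 = n then C.mul h (s p.1) (t p.2) else 0

theorem term_eq (s t : ∀ n, A n) {n : ℕ} {p : ℕ × ℕ} (h : p.1 + p.2 = n) :
    C.term s t n p = C.mul h (s p.1) (t p.2) := dif_pos h

theorem term_mk (s t : ∀ n, A n) {l m n : ℕ} (h : l + m = n) :
    C.term s t n (l, m) = C.mul h (s l) (t m) := dif_pos h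

/-- The convolution product. -/
def conv (s t : ∀ n, A n) (n : ℕ) : A n := ∑ p ∈ Finset.HasAntidiagonal.antidiagonal n, C.term s t n p

theorem conv_eq (s t : ∀ n, A n) (n : ℕ) :
    C.conv s t n = ∑ l : Fin (n + 1),
      C.mul (Nat.add_sub_of_le (Nat.le_of_lt_succ l.2)) (s l) (t (n - l)) := by
  rw [conv, Finset.Nat.sum_antidiagonal_eq_sum_range_succ_mk,
    ← Fin.sum_univ_eq_sum_range (fun l => C.term s t n (l, n - l))]
  exact Finset.sum_congr rfl fun l _ => C.term_eq s t _

theorem conv_zero (s t : ∀ n, A n) : C.conv s t 0 = C.mul (Nat.add_zero 0) (s 0) (t 0) := by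
  rw [conv_eq]
  exact Fin.sum_univ_one _

theorem conv_comm (s t : ∀ n, A n) : C.conv s t = C.conv t s := by
  funext n
  rw [conv, ← Finset.Nat.sum_antidiagonal_swap]
  refine Finset.sum_congr rfl fun p hp => ?_
  rw [Finset.HasAntidiagonal.mem_antidiagonal] at hp
  rw [C.term_eq t s hp]
  exact (C.term_eq s t ((Nat.add_comm _ _).trans hp)).trans (C.mul_comm _ _ _ _)

theorem conv_assoc (s t u : ∀ n, A n) : C.conv (C.conv s t) u = C.conv s (C.conv t u) := by
  funext n
  have h1 : C.conv (C.conv s t) u n = ∑ x ∈ (Finset.HasAntidiagonal.antidiagonal n).sigma fun p =>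
      Finset.HasAntidiagonal.antidiagonal p.1, C.term s (fun m => C.term t u m (x.2.2, x.1.2)) n
        (x.2.1, x.2.2 + x.1.2) := by
    rw [Finset.sum_sigma, conv]
    refine Finset.sum_congr rfl fun p hp => ?_
    rw [Finset.HasAntidiagonal.mem_antidiagonal] at hp
    rw [C.term_eq _ _ hp, conv, map_sum, AddMonoidHom.finsetSum_apply]
    refine Finset.sum_congr rfl fun q hq => ?_
    rw [Finset.HasAntidiagonal.mem_antidiagonal] at hq
    have h2 : q.1 + (q.2 + p.2) = n := by omega
    rw [C.term_eq s t hq, C.mul_assoc hq hp rfl h2]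
    refine Eq.trans ?_ (C.term_eq s _ (p := (q.1, q.2 + p.2)) h2).symm
    exact congrArg _ (C.term_eq t u (p := (q.2, p.2)) rfl).symm
  have h2 : C.conv s (C.conv t u) n = ∑ x ∈ (Finset.HasAntidiagonal.antidiagonal n).sigma fun p =>
      Finset.HasAntidiagonal.antidiagonal p.2, C.term s (fun m => C.term t u m x.2) n x.1 := by
    rw [Finset.sum_sigma, conv]
    refine Finset.sum_congr rfl fun p hp => ?_
    rw [Finset.HasAntidiagonal.mem_antidiagonal] at hp
    rw [C.term_eq _ _ hp, conv, map_sum]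
    exact Finset.sum_congr rfl fun q hq => (C.term_eq s (fun m => C.term t u m q) hp).symm
  rw [h1, h2]
  -- Both index sets parametrise the decompositions of `n` into three summands.
  refine Finset.sum_nbij' (fun x => ⟨(x.2.1, x.2.2 + x.1.2), (x.2.2, x.1.2)⟩)
    (fun x => ⟨(x.1.1 + x.2.1, x.2.2), (x.1.1, x.2.1)⟩) ?_ ?_ ?_ ?_ ?_
  · rintro ⟨⟨a, b⟩, c, d⟩ h
    simp only [Finset.mem_sigma, Finset.HasAntidiagonal.mem_antidiagonal] at h ⊢
    obtain ⟨rfl, rfl⟩ := h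
    exact ⟨by simp only [Nat.add_assoc], trivial⟩
  · rintro ⟨⟨a, b⟩, c, d⟩ h
    simp only [Finset.mem_sigma, Finset.HasAntidiagonal.mem_antidiagonal] at h ⊢
    obtain ⟨rfl, rfl⟩ := h
    exact ⟨by simp only [Nat.add_assoc], trivial⟩
  · rintro ⟨⟨a, b⟩, c, d⟩ h
    simp only [Finset.mem_sigma, Finset.HasAntidiagonal.mem_antidiagonal] at h
    obtain ⟨-, rfl⟩ := h
    rfl
  · rintro ⟨⟨a, b⟩, c, d⟩ h
    simp only [Finset.mem_sigma, Finset.HasAntidiagonal.mem_antidiagonal] at h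
    obtain ⟨-, rfl⟩ := h
    rfl
  · intro x _
    rfl

/-- The series `1`. -/
def oneCoeff : ∀ n, A n
  | 0 => C.one
  | _ + 1 => 0

theorem conv_one (s : ∀ n, A n) : C.conv s C.oneCoeff = s := by
  funext n
  rw [conv, Finset.sum_eq_single (n, 0)]
  · exact (C.term_eq s _ (Nat.add_zero n)).trans (C.mul_one _)
  · rintro ⟨a, b⟩ hp hne
    rw [Finset.HasAntidiagonal.mem_antidiagonal] at hp
    rw [C.term_eq _ _ hp]
    cases b with
    | zero => exact (hne (Prod.ext (by simpa using hp) rfl)).elim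
    | succ b => exact map_zero _
  · intro h
    exact (h (Finset.HasAntidiagonal.mem_antidiagonal.2 (Nat.add_zero n))).elim

/-- The inverse of a series with constant term `1`. -/
def invCoeff (s : ∀ n, A n) : ∀ n, A n
  | 0 => C.one
  | n + 1 => -∑ l : Fin (n + 1),
      C.mul (Nat.add_sub_of_le l.2.le) (invCoeff s l) (s (n + 1 - l))

theorem mul_coeff_sub_self (s : C.Series) {n m : ℕ} (hm : m = 0) (h : n + m = n) (a : A n) :
    C.mul h a (s.coeff m) = a := by
  subst hm
  rw [s.coeff_zero, C.mul_one]

theorem inv_conv (s : C.Series) : C.conv (C.invCoeff s.coeff) s.coeff = C.oneCoeff := by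
  funext n
  cases n with
  | zero =>
    rw [conv_zero, s.coeff_zero, C.mul_one]
    rw [invCoeff, oneCoeff]
  | succ n =>
    rw [conv_eq, Fin.sum_univ_castSucc]
    refine (congrArg₂ _ rfl (C.mul_coeff_sub_self s (Nat.sub_self _) _ _)).trans ?_
    change _ + C.invCoeff s.coeff (n + 1) = 0
    rw [invCoeff]
    exact add_neg_cancel _

theorem conv_coeff_one (s t : C.Series) : C.conv s.coeff t.coeff 1 = s.coeff 1 + t.coeff 1 := by
  have h0 : C.mul (Nat.zero_add 1) (s.coeff 0) (t.coeff 1) = t.coeff 1 := by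
    rw [s.coeff_zero, C.mul_comm _ (Nat.add_zero 1), C.mul_one]
  have h1 : C.mul (Nat.add_zero 1) (s.coeff 1) (t.coeff 0) = s.coeff 1 := by
    rw [t.coeff_zero, C.mul_one]
  rw [conv_eq, Fin.sum_univ_two]
  exact (congrArg₂ _ h0 h1).trans (add_comm _ _)

instance : Mul C.Series := ⟨fun s t => ⟨C.conv s.coeff t.coeff, by
  rw [conv_zero, s.coeff_zero, t.coeff_zero, C.mul_one]⟩⟩

instance : One C.Series := ⟨⟨C.oneCoeff, rfl⟩⟩

instance : Inv C.Series := ⟨fun s => ⟨C.invCoeff s.coeff, by rw [invCoeff]⟩⟩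

/-- The target of the total operation `a ↦ (σ^n(a))_n`: the addition formula says exactly that this
operation is a homomorphism from an additive group to this multiplicative one. -/
instance : CommGroup C.Series where
  mul_assoc s t u := Series.ext (C.conv_assoc _ _ _)
  one_mul s := Series.ext ((C.conv_comm _ _).trans (C.conv_one _))
  mul_one s := Series.ext (C.conv_one _)
  inv_mul_cancel s := Series.ext (C.inv_conv s)
  mul_comm s t := Series.ext (C.conv_comm _ _)

end GradedMul

end Motivic

namespace Motivic

/-! ### Addition of symmetric powers -/

section Add

variable {l m n : ℕ} {X : CSch}

theorem concat_comm (h : l + m = n) (h' : m + l = n) (X : CSch) :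
    ∃ τ, (prod.braiding (pow l X) (pow m X)).hom ≫ concat h' X = concat h X ≫ permute X τ := by
  refine ⟨(sumIdx h').symm.trans ((Equiv.sumComm _ _).trans (sumIdx h)), Pi.hom_ext _ _ fun k => ?_⟩
  rw [Category.assoc, Category.assoc, permute_π]
  obtain ⟨b, rfl⟩ | ⟨a, rfl⟩ := idx_cases h' k
  · rw [concat_idxL, ← sumIdx_inl]
    simp only [Equiv.trans_apply, Equiv.symm_apply_apply, Equiv.sumComm_apply, Sum.swap_inl]
    rw [sumIdx_inr, concat_idxR, prod.braiding_hom, prod.lift_fst_assoc]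
  · rw [concat_idxR, ← sumIdx_inr]
    simp only [Equiv.trans_apply, Equiv.symm_apply_apply, Equiv.sumComm_apply, Sum.swap_inr]
    rw [sumIdx_inl, concat_idxL, prod.braiding_hom, prod.lift_snd_assoc]

/-- Exchanging the two blocks changes the concatenation by a permutation of the coordinates, which
disappears in the symmetric power. -/
theorem IsSymAdd.comm {S : SymPow l X} {T : SymPow m X} {P : SymPow n X} {h : l + m = n}
    {h' : m + l = n} {c : S.obj ⨯ T.obj ⟶ P.obj} {c' : T.obj ⨯ S.obj ⟶ P.obj}
    (hc : IsSymAdd h S T P c) (hc' : IsSymAdd h' T S P c') :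
    (prod.braiding S.obj T.obj).hom ≫ c' = c := by
  apply prodProj_hom_ext
  obtain ⟨τ, hτ⟩ := concat_comm h h' X
  have h1 : prod.map S.proj T.proj ≫ (prod.braiding S.obj T.obj).hom =
      (prod.braiding _ _).hom ≫ prod.map T.proj S.proj := by simp
  rw [hc, ← Category.assoc, h1, Category.assoc, hc', ← Category.assoc, hτ, Category.assoc,
    P.invariant]

theorem concat_assoc {k p q : ℕ} (h₁ : l + m = p) (h₂ : p + k = n) (h₃ : m + k = q)
    (h₄ : l + q = n) (X : CSch) :
    prod.map (concat h₁ X) (𝟙 _) ≫ concat h₂ X =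
      (Limits.prod.associator _ _ _).hom ≫ prod.map (𝟙 _) (concat h₃ X) ≫ concat h₄ X := by
  apply Pi.hom_ext
  intro i
  simp only [Category.assoc]
  obtain ⟨a, rfl⟩ | ⟨c, rfl⟩ := idx_cases h₂ i
  · rw [concat_idxL, prod.map_fst_assoc]
    obtain ⟨a, rfl⟩ | ⟨b, rfl⟩ := idx_cases h₁ a
    · have : idxL h₂ (idxL h₁ a) = idxL h₄ a := rfl
      rw [concat_idxL, this, concat_idxL, prod.map_fst_assoc, Category.id_comp,
        prod.associator_hom, prod.lift_fst_assoc, Category.assoc]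
    · have : idxL h₂ (idxR h₁ b) = idxR h₄ (idxL h₃ b) := rfl
      rw [concat_idxR, this, concat_idxR, prod.map_snd_assoc, concat_idxL,
        prod.associator_hom, prod.lift_snd_assoc, prod.lift_fst_assoc, Category.assoc]
  · have : idxR h₂ c = idxR h₄ (idxR h₃ c) := Fin.ext (by simp only [idxR]; omega)
    rw [concat_idxR, this, concat_idxR, prod.map_snd_assoc, prod.map_snd_assoc, concat_idxR,
      Category.id_comp, prod.associator_hom, prod.lift_snd_assoc, prod.lift_snd_assoc]

theorem IsSymAdd.assoc {k p q : ℕ} {S : SymPow l X} {T : SymPow m X} {R : SymPow k X}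
    {P : SymPow p X} {Q : SymPow q X} {N : SymPow n X} {h₁ : l + m = p} {h₂ : p + k = n}
    {h₃ : m + k = q} {h₄ : l + q = n} {c₁ : S.obj ⨯ T.obj ⟶ P.obj} {c₂ : P.obj ⨯ R.obj ⟶ N.obj}
    {c₃ : T.obj ⨯ R.obj ⟶ Q.obj} {c₄ : S.obj ⨯ Q.obj ⟶ N.obj} (hc₁ : IsSymAdd h₁ S T P c₁)
    (hc₂ : IsSymAdd h₂ P R N c₂) (hc₃ : IsSymAdd h₃ T R Q c₃) (hc₄ : IsSymAdd h₄ S Q N c₄) :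
    prod.map c₁ (𝟙 _) ≫ c₂ = (Limits.prod.associator _ _ _).hom ≫ prod.map (𝟙 _) c₃ ≫ c₄ := by
  apply ((isGood_prodProj S T).prodMap isAct_prodPermute (isAct_permute k X) R.isGood).hom_ext_mor
  have h1 : prod.map (prod.map S.proj T.proj) R.proj ≫ prod.map c₁ (𝟙 _) =
      prod.map (concat h₁ X) (𝟙 _) ≫ prod.map P.proj R.proj := by
    rw [prod.map_map, prod.map_map, hc₁, Category.comp_id, Category.id_comp]
  have h2 : prod.map S.proj (prod.map T.proj R.proj) ≫ prod.map (𝟙 _) c₃ =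
      prod.map (𝟙 _) (concat h₃ X) ≫ prod.map S.proj Q.proj := by
    rw [prod.map_map, prod.map_map, hc₃, Category.comp_id, Category.id_comp]
  rw [← Category.assoc, h1, Category.assoc, hc₂, ← Category.assoc, concat_assoc h₁ h₂ h₃ h₄,
    prod.associator_naturality_assoc, ← Category.assoc _ _ c₄, h2]
  simp only [Category.assoc]
  rw [hc₄]

theorem isIso_toPt_symPow_zero (S : SymPow 0 X) : IsIso (toPt S.obj) :=
  ⟨Pi.lift (fun k : Fin 0 => k.elim0) ≫ S.proj, by
    apply SymPow.hom_ext
    simp only [← Category.assoc]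
    rw [Category.comp_id]
    exact (Pi.hom_ext _ _ (fun k => k.elim0) =≫ S.proj).trans (Category.id_comp _),
    ptIsTerminal.hom_ext _ _⟩

theorem isIso_map_zero {Y : CSch} (S : SymPow 0 X) (T : SymPow 0 Y) (u : X ⟶ Y) :
    IsIso (S.map T u) := by
  have h1 := isIso_toPt_symPow_zero S
  have h2 := isIso_toPt_symPow_zero T
  have h3 : S.map T u = toPt _ ≫ inv (toPt _) := by
    rw [IsIso.eq_comp_inv]; exact ptIsTerminal.hom_ext _ _
  rw [h3]; infer_instance

theorem isIso_fst_of_isIso_toPt (V : CSch) {T : CSch} (h : IsIso (toPt T)) :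
    IsIso (prod.fst : V ⨯ T ⟶ V) :=
  ⟨prod.lift (𝟙 V) (toPt V ≫ inv (toPt T)), by
    apply Limits.prod.hom_ext
    · rw [Category.assoc, prod.lift_fst, Category.comp_id, Category.id_comp]
    · rw [← cancel_mono (toPt T)]
      exact ptIsTerminal.hom_ext _ _, prod.lift_fst _ _⟩

theorem IsSymAdd.zero {S : SymPow n X} {T : SymPow 0 X} {h : n + 0 = n}
    {c : S.obj ⨯ T.obj ⟶ S.obj} (hc : IsSymAdd h S T S c) : c = prod.fst := by
  apply prodProj_hom_ext
  rw [hc, prod.map_fst]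
  congr 1
  exact Pi.hom_ext _ _ fun k => concat_idxL h X k

theorem IsSymAdd.map {Y : CSch} {S : SymPow l X} {T : SymPow m X} {P : SymPow n X}
    {S' : SymPow l Y} {T' : SymPow m Y} {P' : SymPow n Y} {h : l + m = n}
    {c : S.obj ⨯ T.obj ⟶ P.obj} {c' : S'.obj ⨯ T'.obj ⟶ P'.obj} (hc : IsSymAdd h S T P c)
    (hc' : IsSymAdd h S' T' P' c') (u : X ⟶ Y) :
    prod.map (S.map S' u) (T.map T' u) ≫ c' = c ≫ P.map P' u := by
  apply prodProj_hom_ext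
  rw [← Category.assoc, ← Category.assoc, hc, prod.map_map, SymPow.proj_map, SymPow.proj_map,
    Category.assoc, SymPow.proj_map, ← Category.assoc (concat h X), ← prodMap_concat h u,
    ← prod.map_map, Category.assoc, hc', Category.assoc]

end Add

/-- The chosen symmetric power. -/
def symPow (n : ℕ) (X : CSch) : SymPow n X := (exists_symPow n X).choose

/-- The addition of the chosen symmetric powers. -/
def symAdd {l m n : ℕ} (h : l + m = n) (X : CSch) :
    (symPow l X).obj ⨯ (symPow m X).obj ⟶ (symPow n X).obj :=
  (exists_isSymAdd h (symPow l X) (symPow m X) (symPow n X)).choose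

theorem isSymAdd_symAdd {l m n : ℕ} (h : l + m = n) (X : CSch) :
    IsSymAdd h (symPow l X) (symPow m X) (symPow n X) (symAdd h X) :=
  (exists_isSymAdd h (symPow l X) (symPow m X) (symPow n X)).choose_spec

theorem ft_symAdd {l m n : ℕ} (h : l + m = n) (X : CSch) : FT (symAdd h X) :=
  (isSymAdd_symAdd h X).ft

namespace K0Bar

/-- The completed Grothendieck groups of the symmetric powers form a graded ring. -/
def symMul (X : CSch) {l m n : ℕ} (h : l + m = n) :
    K0Bar (symPow l X).obj →+ K0Bar (symPow m X).obj →+ K0Bar (symPow n X).obj :=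
  ext.compr₂ (push (symAdd h X) (ft_symAdd h X))

theorem symMul_apply {X : CSch} {l m n : ℕ} (h : l + m = n) (a : K0Bar (symPow l X).obj)
    (b : K0Bar (symPow m X).obj) :
    symMul X h a b = push (symAdd h X) (ft_symAdd h X) (ext a b) := rfl

theorem symMul_cls {X V W : CSch} {l m n : ℕ} (h : l + m = n) (v : V ⟶ (symPow l X).obj)
    (w : W ⟶ (symPow m X).obj) (hv : FT v) (hw : FT w) {x : V ⨯ W ⟶ (symPow n X).obj}
    (hx : prod.map v w ≫ symAdd h X = x) (hx' : FT x) :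
    symMul X h (cls v hv) (cls w hw) = cls x hx' := by
  rw [symMul_apply, ext_cls v w hv hw (hv.prodMap hw)]
  exact push_cls _ _ _ _ hx _

/-- The graded ring of the completed Grothendieck groups of the symmetric powers of `X`. -/
def symRing (X : CSch) : GradedMul fun n => K0Bar (symPow n X).obj where
  mul h := symMul X h
  one := cls (𝟙 _) (FT.id _)
  mul_one {n} a := by
    induction a using induction with
    | sub a b ha hb => rw [map_sub, AddMonoidHom.sub_apply, ha, hb]
    | @cls V v hv =>
    have hf : FT (prod.map v (𝟙 (symPow 0 X).obj) ≫ symAdd (Nat.add_zero n) X) :=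
      (hv.prodMap (FT.id _)).comp (ft_symAdd _ X)
    rw [symMul_cls _ _ _ _ _ rfl hf]
    have h0 : IsIso (prod.fst : V ⨯ (symPow 0 X).obj ⟶ V) :=
      isIso_fst_of_isIso_toPt V (isIso_toPt_symPow_zero _)
    refine cls_congr (asIso (prod.fst : V ⨯ (symPow 0 X).obj ⟶ V)) ?_ _ _
    rw [(isSymAdd_symAdd (Nat.add_zero n) X).zero, asIso_hom, prod.map_fst]
  mul_comm h h' a b := by
    induction a using induction with
    | sub a b ha hb => simp only [map_sub, AddMonoidHom.sub_apply, ha, hb]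
    | cls v hv =>
    induction b using induction with
    | sub a b ha hb => simp only [map_sub, AddMonoidHom.sub_apply, ha, hb]
    | cls w hw =>
    rw [symMul_cls h v w hv hw rfl ((hv.prodMap hw).comp (ft_symAdd _ X)),
      symMul_cls h' w v hw hv rfl ((hw.prodMap hv).comp (ft_symAdd _ X))]
    refine cls_congr (Limits.prod.braiding _ _) ?_ _ _
    rw [← (isSymAdd_symAdd h X).comm (isSymAdd_symAdd h' X), ← Category.assoc, ← Category.assoc]
    congr 1
    simp
  mul_assoc h₁ h₂ h₃ h₄ a b c := by
    induction a using induction with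
    | sub a b ha hb => simp only [map_sub, AddMonoidHom.sub_apply, ha, hb]
    | cls u hu =>
    induction b using induction with
    | sub a b ha hb => simp only [map_sub, AddMonoidHom.sub_apply, ha, hb]
    | cls v hv =>
    induction c using induction with
    | sub a b ha hb => simp only [map_sub, ha, hb]
    | cls w hw =>
    have h12 := (hu.prodMap hv).comp (ft_symAdd h₁ X)
    have h34 := (hv.prodMap hw).comp (ft_symAdd h₃ X)
    rw [symMul_cls h₁ u v hu hv rfl h12, symMul_cls h₃ v w hv hw rfl h34,
      symMul_cls h₂ _ w h12 hw rfl ((h12.prodMap hw).comp (ft_symAdd _ X)),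
      symMul_cls h₄ u _ hu h34 rfl ((hu.prodMap h34).comp (ft_symAdd _ X))]
    refine cls_congr (Limits.prod.associator _ _ _) ?_ _ _
    have h1 := (isSymAdd_symAdd h₁ X).assoc (isSymAdd_symAdd h₂ X) (isSymAdd_symAdd h₃ X)
      (isSymAdd_symAdd h₄ X)
    have h2 : prod.map (prod.map u v ≫ symAdd h₁ X) w =
      prod.map (prod.map u v) w ≫ prod.map (symAdd h₁ X) (𝟙 _) := by simp
    have h3 : prod.map u (prod.map v w ≫ symAdd h₃ X) =
      prod.map u (prod.map v w) ≫ prod.map (𝟙 _) (symAdd h₃ X) := by simp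
    rw [h2, h3, Category.assoc, Category.assoc, h1, prod.associator_naturality_assoc]

end K0Bar
end Motivic

namespace Motivic

namespace K0Bar

variable {X : CSch}

/-- The class `[Sym^n(V) → Sym^n(X)]`. -/
def symCls {V : CSch} (v : V ⟶ X) (hv : FT v) (n : ℕ) : K0Bar (symPow n X).obj :=
  cls ((symPow n V).map (symPow n X) v) (SymPow.ft_map hv)

theorem symRing_mul_symCls {V W : CSch} {v : V ⟶ X} {w : W ⟶ X} {l m n : ℕ} (h : l + m = n)
    (hv : FT v) (hw : FT w) (hft : FT (prod.map ((symPow l V).map (symPow l X) v)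
      ((symPow m W).map (symPow m X) w) ≫ symAdd h X)) :
    (symRing X).mul h (symCls v hv l) (symCls w hw m) = cls _ hft :=
  symMul_cls h ((symPow l V).map (symPow l X) v) ((symPow m W).map (symPow m X) w)
    (SymPow.ft_map hv) (SymPow.ft_map hw) rfl hft

theorem strata_fac {V Z U : CSch} {v : V ⟶ X} {i : Z ⟶ V} {j : U ⟶ V} {l m n : ℕ}
    (h : l + m = n) :
    (prod.map ((symPow l Z).map (symPow l V) i) ((symPow m U).map (symPow m V) j) ≫ symAdd h V) ≫
      (symPow n V).map (symPow n X) v =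
    prod.map ((symPow l Z).map (symPow l X) (i ≫ v)) ((symPow m U).map (symPow m X) (j ≫ v)) ≫
      symAdd h X := by
  rw [Category.assoc, ← (isSymAdd_symAdd h V).map (isSymAdd_symAdd h X) v, ← Category.assoc,
    prod.map_map, SymPow.map_comp, SymPow.map_comp]

theorem strata_proj {V Z U : CSch} {i : Z ⟶ V} {j : U ⟶ V} {l m n : ℕ} (h : l + m = n) :
    prod.map (symPow l Z).proj (symPow m U).proj ≫ prod.map ((symPow l Z).map (symPow l V) i)
      ((symPow m U).map (symPow m V) j) ≫ symAdd h V = stratMap h i j ≫ (symPow n V).proj := by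
  rw [← Category.assoc, prod.map_map, SymPow.proj_map, SymPow.proj_map, ← prod.map_map,
    Category.assoc, isSymAdd_symAdd h V, stratMap, Category.assoc]

/-- The stratification of the symmetric power of a disjoint union of a closed and an open
subscheme. -/
theorem symCls_cut {V Z U : CSch} (v : V ⟶ X) (hv : FT v) {i : Z ⟶ V} {j : U ⟶ V}
    (h : IsCut i j) (hi : FT (i ≫ v)) (hj : FT (j ≫ v)) :
    symCls v hv = (symRing X).conv (symCls (i ≫ v) hi) (symCls (j ≫ v) hj) := by
  have := h.closed
  funext n
  let S := symPow n V
  let s := S.map (symPow n X) v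
  have hs : FT s := SymPow.ft_map hv
  let T : ℕ → K0Bar (symPow n X).obj := fun l =>
    (symRing X).term (symCls (i ≫ v) hi) (symCls (j ≫ v) hj) n (l, n - l)
  -- The class of the locus with fewer than `k` coordinates in `Z` is the sum of the first `k` terms
  -- of the convolution. Passing to `k + 1` adds the stratum with exactly `k` such coordinates, and
  -- `k = n + 1` exhausts `Sym^n(V)`.
  have key : ∀ k ≤ n + 1, cls (openSubι S.obj (fewSym i S k) ≫ s)
      ((FT.openSubι _ _).comp hs) = ∑ l ∈ Finset.range k, T l := by
    intro k
    induction k with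
    | zero =>
      intro _
      have : IsEmpty (openSub S.obj (fewSym i S 0)).toScheme := ⟨fun x => by
        have hx : mor (openSubι S.obj (fewSym i S 0)) x ∈ (fewSym i S 0 : Set S.obj.toScheme) :=
          (range_openSubι _ _).le ⟨x, rfl⟩
        exact (fewSym_zero i S).le hx⟩
      exact cls_of_isEmpty _
    | succ k ih =>
      intro hk
      have hkn : k + (n - k) = n := by omega
      obtain ⟨t', e, hte, ht', he⟩ := exists_isCut_strata h hkn (symPow k Z) (symPow (n - k) U) S
        (strata_proj hkn)
      rw [Finset.sum_range_succ, ← ih (by omega)]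
      have hft : FT (prod.map ((symPow k Z).map (symPow k X) (i ≫ v))
          ((symPow (n - k) U).map (symPow (n - k) X) (j ≫ v)) ≫ symAdd hkn X) :=
        ((SymPow.ft_map hi).prodMap (SymPow.ft_map hj)).comp (ft_symAdd hkn X)
      have hT : T k = cls _ hft :=
        ((symRing X).term_mk (symCls (i ≫ v) hi) (symCls (j ≫ v) hj) hkn).trans
          (symRing_mul_symCls hkn hi hj hft)
      rw [hT]
      have h1 : t' ≫ openSubι S.obj (fewSym i S (k + 1)) ≫ s = _ :=
        (Category.assoc _ _ _).symm.trans ((ht' =≫ s).trans (strata_fac hkn))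
      have h2 : e ≫ openSubι S.obj (fewSym i S (k + 1)) ≫ s = openSubι S.obj (fewSym i S k) ≫ s :=
        (Category.assoc _ _ _).symm.trans (he =≫ s)
      exact (cls_cut ((FT.openSubι _ _).comp hs) hte hft ((FT.openSubι _ _).comp hs) h1 h2).trans
        (add_comm _ _)
  have h1 := key (n + 1) le_rfl
  rw [GradedMul.conv, Finset.Nat.sum_antidiagonal_eq_sum_range_succ_mk]
  refine Eq.trans ?_ h1
  have hr : Set.range (mor (openSubι S.obj (fewSym i S (n + 1)))) = Set.univ := by
    rw [range_openSubι, fewSym_top]; rfl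
  have hr' : Set.range (mor (𝟙 S.obj)) = Set.univ := Set.range_id
  have : IsOpenImmersion (mor (𝟙 S.obj)) := inferInstanceAs (IsOpenImmersion (𝟙 S.obj.toScheme))
  refine (cls_congr (isoOfRangeEq (openSubι S.obj (fewSym i S (n + 1))) (𝟙 S.obj)
    (hr.trans hr'.symm)) ?_ _ _).symm
  have h2 := isoOfRangeEq_hom_comp (openSubι S.obj (fewSym i S (n + 1))) (𝟙 S.obj)
    (hr.trans hr'.symm)
  rw [Category.comp_id] at h2
  rw [h2]

theorem symCls_iso {V V' : CSch} (e : V ≅ V') {v : V ⟶ X} {v' : V' ⟶ X} (h : e.hom ≫ v' = v)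
    (hv : FT v) (hv' : FT v') : symCls v hv = symCls v' hv' := by
  funext n
  refine cls_congr (asIso ((symPow n V).map (symPow n V') e.hom)) ?_ _ _
  rw [asIso_hom, SymPow.map_comp, h]

/-- The series of the classes `[Sym^n(V) → Sym^n(X)]`. -/
def symSeries {V : CSch} (v : V ⟶ X) (hv : FT v) : (symRing X).Series where
  coeff := symCls v hv
  coeff_zero := by
    have h := isIso_map_zero (symPow 0 V) (symPow 0 X) v
    exact cls_congr (asIso ((symPow 0 V).map (symPow 0 X) v)) (Category.comp_id _) (SymPow.ft_map hv) (FT.id _)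

/-- The homomorphism `[V → X] ↦ ([Sym^n(V) → Sym^n(X)])_n`. -/
def symHom (X : CSch) : K0 X →+ Additive (symRing X).Series :=
  K0.lift (f := fun v hv => Additive.ofMul (symSeries v hv))
    { iso := fun e v v' hv hv' h =>
        congrArg Additive.ofMul (GradedMul.Series.ext (symCls_iso e h hv hv'))
      cut := fun v hv i j h z w hz hw hz' hw' => by
        subst hz' hw'
        exact congrArg Additive.ofMul (GradedMul.Series.ext (symCls_cut v hv h hz hw)) }

theorem symHom_cls {V : CSch} (v : V ⟶ X) (hv : FT v) :
    symHom X (K0.cls v hv) = Additive.ofMul (symSeries v hv) := K0.lift_cls _ _ _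

end K0Bar
end Motivic

namespace Motivic

/-! ### Symmetric powers of open subschemes -/

section OpenSym

variable {n : ℕ} {X D : CSch} (g : D ⟶ X) [hg : IsOpenImmersion (mor g)] (S : SymPow n D)
  (T : SymPow n X)

/-- The power of an open subscheme is an invariant open subscheme of the power, and good quotients
are compatible with these. -/
theorem SymPow.isPullback_map :
    IsOpenImmersion (mor (S.map T g)) ∧
      IsPullback (powMap n g) S.proj T.proj (S.map T g) := by
  have : IsOpenImmersion (mor (powMap n g)) := powMap_mem openProp n hg
  have h := T.isGood.isPullback_of_isOpenImmersion (isAct_mor (isAct_permute n X))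
    (isAct_mor (isAct_permute n D)) S.isGood (j := mor (powMap n g)) (t := mor (S.map T g))
    (fun τ => congrArg mor (permute_powMap g τ)) (congrArg mor (S.proj_map T g))
  exact ⟨h.1, isPullback_of_mor h.2⟩

theorem SymPow.proj_mem_range_map (y : (pow n X).toScheme) :
    mor T.proj y ∈ Set.range (mor (S.map T g)) ↔
      ∀ k, mor (Pi.π (fun _ : Fin n => X) k) y ∈ Set.range (mor g) := by
  have h := range_of_isPullback (SymPow.isPullback_map g S T).2
  rw [range_powMap] at h
  exact (Set.ext_iff.1 h y).symm

/-- Symmetric powers do not preserve general fibre products. Along an open immersion the question is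
only one of points, answered coordinatewise in `V^n`. -/
theorem SymPow.isPullback_map_map {V W : CSch} {v : V ⟶ X} {p : W ⟶ D} {r : W ⟶ V}
    (h : IsPullback p r g v) (S' : SymPow n W) (T' : SymPow n V) :
    IsPullback (S'.map S p) (S'.map T' r) (S.map T g) (T'.map T v) := by
  have hr : IsOpenImmersion (mor r) := isOpenImmersion_of_isPullback h.flip hg
  have := (SymPow.isPullback_map g S T).1
  have := (SymPow.isPullback_map r S' T').1
  refine (isPullback_of_isOpenImmersion ?_ fun x hx => ?_).flip
  · rw [SymPow.map_comp, SymPow.map_comp, h.w]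
  · obtain ⟨y, rfl⟩ := T'.surjective_proj x
    rw [SymPow.proj_mem_range_map]
    intro k
    rw [Set.mem_preimage, ← mor_comp_apply, T'.proj_map, mor_comp_apply,
      SymPow.proj_mem_range_map] at hx
    have h1 := hx k
    rw [← mor_comp_apply, powMap_π, mor_comp_apply] at h1
    exact (range_of_isPullback h.flip).ge h1

end OpenSym

/-- A component of the symmetric power of `X` involves only a quasi-compact open part of `X`. -/
theorem exists_isCompact_of_component {n : ℕ} {X : CSch} (T : SymPow n X) (c : π₀ T.obj) :
    ∃ D : X.toScheme.Opens, IsCompact (D : Set X.toScheme) ∧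
      ∀ y : (pow n X).toScheme, mor T.proj y ∈ Set.range (mor (componentι T.obj c)) →
        ∀ k, mor (Pi.π (fun _ : Fin n => X) k) y ∈ D := by
  let K := fibObj (componentι T.obj c) T.proj
  let s : K ⟶ pow n X := fibSnd (componentι T.obj c) T.proj
  have hK : CompactSpace K.toScheme :=
    (FT.of_isPullback (isPullback_fib (componentι T.obj c) T.proj) T.ft_proj).compactSpace
  have := finite_components K
  -- The part `K` of `X^n` above the component `c` is quasi-compact, so its finitely many components
  -- project to finitely many components of `X`; `D` is their union.
  let F : Set (π₀ X) := Set.range fun p : Fin n × π₀ K =>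
    compMap (s ≫ Pi.π (fun _ : Fin n => X) p.1) p.2
  have hF : F.Finite := Set.finite_range _
  refine ⟨⟨ConnectedComponents.mk ⁻¹' F, (isOpen_discrete F).preimage
    ConnectedComponents.continuous_coe⟩, ?_, fun y hy k => ?_⟩
  · have h1 : (ConnectedComponents.mk ⁻¹' F : Set X.toScheme) =
        ⋃ d ∈ F, Set.range (mor (componentι X d)) := by
      ext x
      simp only [range_componentι, Set.mem_preimage, Set.mem_iUnion, Set.mem_singleton_iff,
        exists_prop, exists_eq_right']
    change IsCompact (ConnectedComponents.mk ⁻¹' F : Set X.toScheme)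
    rw [h1]
    exact hF.isCompact_biUnion fun d _ => isCompact_range (mor (componentι X d)).continuous
  · obtain ⟨z, rfl⟩ := (range_of_isPullback
      (isPullback_fib (componentι T.obj c) T.proj).flip).ge hy
    exact ⟨(k, ConnectedComponents.mk z), rfl⟩

namespace K0Bar

variable {X : CSch}

/-- A component of `[Sym^n(V) → Sym^n(X)]` depends only on the class of `V → X`. -/
theorem symCls_congr {V W : CSch} (v : V ⟶ X) (w : W ⟶ X) (hv : FT v) (hw : FT w)
    (h : cls v hv = cls w hw) : symCls v hv = symCls w hw := by
  funext n
  ext c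
  let T := symPow n X
  obtain ⟨D, hD, hDc⟩ := exists_isCompact_of_component T c
  have : CompactSpace (openSub X D).toScheme := isCompact_iff_compactSpace.1 hD
  let g := openSubι X D
  let S := symPow n (openSub X D)
  have hopen := (SymPow.isPullback_map g S T).1
  have hr : Set.range (mor (componentι T.obj c)) ⊆ Set.range (mor (S.map T g)) := by
    intro x hx
    obtain ⟨y, rfl⟩ := T.surjective_proj x
    refine (SymPow.proj_mem_range_map g S T y).2 fun k => ?_
    rw [range_openSubι]
    exact hDc y hx k
  let t : component T.obj c ⟶ S.obj := liftOpen (S.map T g) (componentι T.obj c) hr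
  have ht : t ≫ S.map T g = componentι T.obj c := liftOpen_fac _ _ _
  -- The component at `c` can be computed over the quasi-compact `D`: restrict the class to `D`,
  -- apply the homomorphism already known on the uncompleted group, and pull back along `t`. This
  -- only involves the class of `u`.
  have key : ∀ {U : CSch} (u : U ⟶ X) (hu : FT u), symCls u hu n c =
      ev t ((symHom _ (ev g (cls u hu))).toMul.coeff n) := by
    intro U u hu
    have h1 := isPullback_fib g u
    have hp := FT.of_isPullback h1 hu
    have h2 := SymPow.isPullback_map_map g S T h1 (symPow n _) (symPow n U)
    have h3 := isPullback_fib t ((symPow n _).map S (fibFst g u))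
    have h4 := h3.paste_vert h2
    rw [ht] at h4
    rw [ev_cls h1 hu hp, symHom_cls]
    have hs : FT ((symPow n (fibObj g u)).map S (fibFst g u)) := SymPow.ft_map hp
    exact (cls_apply h4 (SymPow.ft_map hu) (.of_isPullback h3 hs)).trans
      (ev_cls h3 hs _).symm
  rw [key v hv, key w hw, h]

theorem isMotivic_symSeries : IsMotivic (X := X) fun v hv => Additive.ofMul (symSeries v hv) where
  congr v w hv hw h := congrArg Additive.ofMul (GradedMul.Series.ext (symCls_congr v w hv hw h))
  cut v hv _ _ h hz hw :=
    congrArg Additive.ofMul (GradedMul.Series.ext (symCls_cut v hv h hz hw))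

/-- The homomorphism `[V → X] ↦ ([Sym^n(V) → Sym^n(X)])_n` on the completed group. -/
def symHomBar (X : CSch) : K0Bar X →+ Additive (symRing X).Series :=
  isMotivic_symSeries.exists_lift.choose

theorem symHomBar_cls {V : CSch} (v : V ⟶ X) (hv : FT v) :
    symHomBar X (cls v hv) = Additive.ofMul (symSeries v hv) :=
  isMotivic_symSeries.exists_lift.choose_spec v hv

/-- The operation `σ^n`, with values in the chosen symmetric power. -/
def sym (n : ℕ) (a : K0Bar X) : K0Bar (symPow n X).obj := (symHomBar X a).toMul.coeff n

theorem sym_cls (n : ℕ) {V : CSch} (v : V ⟶ X) (hv : FT v) :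
    sym n (cls v hv) = symCls v hv n := by
  rw [sym, symHomBar_cls]; rfl

theorem sym_zero (a : K0Bar X) : sym 0 a = cls (𝟙 _) (FT.id _) :=
  (symHomBar X a).toMul.coeff_zero

theorem sym_add (n : ℕ) (a b : K0Bar X) : sym n (a + b) = ∑ l : Fin (n + 1),
    symMul X (Nat.add_sub_of_le (Nat.le_of_lt_succ l.2)) (sym l a) (sym (n - l) b) := by
  rw [sym, map_add]
  exact (symRing X).conv_eq _ _ n

/-- The operation `σ^n`. -/
def sigma {n : ℕ} (S : SymPow n X) (a : K0Bar X) : K0Bar S.obj :=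
  push ((symPow n X).map S (𝟙 X)) (SymPow.ft_map (FT.id X)) (sym n a)

theorem sigma_cls {n : ℕ} {V : CSch} (v : V ⟶ X) (hv : FT v) (S : SymPow n V) (T : SymPow n X)
    (hSv : FT (S.map T v)) : sigma T (cls v hv) = cls (S.map T v) hSv := by
  rw [sigma, sym_cls]
  have hf : FT ((symPow n V).map T v) := SymPow.ft_map hv
  refine (push_cls ((symPow n V).map (symPow n X) v) _ (SymPow.ft_map hv) _
    ((symPow n V).map_comp _ _ _ _) (by rwa [Category.comp_id])).trans
    (cls_congr (asIso ((symPow n V).map S (𝟙 V))) ?_ _ _)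
  rw [asIso_hom, SymPow.map_comp, Category.id_comp, Category.comp_id]

end K0Bar
end Motivic

namespace Motivic

/-! ### The operations `σ^n` -/

theorem isIso_proj_one {X : CSch} (S : SymPow 1 X) : IsIso S.proj := by
  have h : ∀ τ, permute X τ ≫ 𝟙 (pow 1 X) = 𝟙 _ := fun τ => Pi.hom_ext _ _ fun k => by
    rw [Category.comp_id, permute_π, Category.id_comp, Subsingleton.elim (τ k) k]
  obtain ⟨g, hg, -⟩ := S.existsUnique_desc (𝟙 _) h
  refine ⟨g, hg, SymPow.hom_ext ?_⟩
  rw [← Category.assoc, hg, Category.id_comp, Category.comp_id]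

theorem isIso_diag_one {X : CSch} (S : SymPow 1 X) :
    IsIso (Pi.lift (fun _ : Fin 1 => 𝟙 X) ≫ S.proj) := by
  have := isIso_proj_one S
  exact inferInstanceAs (IsIso ((powOne X).inv ≫ S.proj))

theorem diag_one_naturality {V X : CSch} (v : V ⟶ X) (S : SymPow 1 V) (T : SymPow 1 X) :
    v ≫ Pi.lift (fun _ : Fin 1 => 𝟙 X) ≫ T.proj =
      (Pi.lift (fun _ : Fin 1 => 𝟙 V) ≫ S.proj) ≫ S.map T v := by
  rw [Category.assoc, S.proj_map, ← Category.assoc, ← Category.assoc]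
  congr 1
  refine Pi.hom_ext _ _ fun k => ?_
  rw [Category.assoc, Category.assoc, powMap_π, Pi.lift_π, Category.comp_id, Pi.lift_π_assoc,
    Category.id_comp]

namespace K0Bar

variable {X Y : CSch}

/-- The class of the identity of `Spec ℂ`. -/
def one : K0Bar pt := cls (𝟙 pt) (FT.id pt)

theorem pull_toPt_one (X : CSch) : pull (toPt X) one = cls (𝟙 X) (FT.id X) :=
  pull_cls (IsPullback.id_horiz (toPt X)) _ _

theorem cls_of_isIso {V : CSch} (v : V ⟶ X) [IsIso v] (hv : FT v) :
    cls v hv = cls (𝟙 X) (FT.id X) := cls_congr (asIso v) (Category.comp_id _) _ _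

theorem sigma_unit {n : ℕ} (S : SymPow n X) :
    sigma S (pull (toPt X) one) = pull (toPt S.obj) one := by
  rw [pull_toPt_one, pull_toPt_one, sigma_cls (𝟙 X) (FT.id X) S S (SymPow.ft_map (FT.id X)),
    cls_of_isIso]

theorem sigma_one {n : ℕ} (S : SymPow n pt) : sigma S one = pull (toPt S.obj) one := by
  rw [← sigma_unit S]
  congr 1
  rw [pull_toPt_one]; rfl

theorem sigma_zero (S : SymPow 0 X) (a : K0Bar X) : sigma S a = pull (toPt S.obj) one := by
  rw [sigma, sym_zero, pull_toPt_one,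
    push_cls _ _ (FT.id _) _ (Category.id_comp _) (SymPow.ft_map (FT.id X)), cls_of_isIso]

theorem sym_one_add (a b : K0Bar X) : sym 1 (a + b) = sym 1 a + sym 1 b := by
  rw [sym, map_add]
  exact (symRing X).conv_coeff_one _ _

/-- In degree `1` the operation is additive, because series with constant term `1` multiply by
adding their linear coefficients. So the identity may be checked on classes, where it is the
isomorphism `Sym^1(V) ≅ V`. -/
theorem sigma_single (S : SymPow 1 X) (a : K0Bar X) :
    pull (Pi.lift (fun _ : Fin 1 => 𝟙 X) ≫ S.proj) (sigma S a) = a := by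
  let s : K0Bar X →+ K0Bar (symPow 1 X).obj := AddMonoidHom.mk' (sym 1) sym_one_add
  let f : K0Bar X →+ K0Bar X := ((pull (Pi.lift (fun _ : Fin 1 => 𝟙 X) ≫ S.proj)).comp
    (push ((symPow 1 X).map S (𝟙 X)) (SymPow.ft_map (FT.id X)))).comp s
  suffices h : f = AddMonoidHom.id _ from DFunLike.congr_fun h a
  refine hom_ext fun {V} v hv => ?_
  change pull _ (sigma S (cls v hv)) = cls v hv
  have hs : FT ((symPow 1 V).map S v) := SymPow.ft_map hv
  rw [sigma_cls v hv (symPow 1 V) S hs]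
  have := isIso_diag_one S
  have := isIso_diag_one (symPow 1 V)
  exact pull_cls_of_isIso _ _ (diag_one_naturality v (symPow 1 V) S) _ _

theorem push_congr {u u' : X ⟶ Y} (h : u = u') (hu : FT u) (hu' : FT u') (a : K0Bar X) :
    push u hu a = push u' hu' a := by subst h; rfl

/-- Push-forward along symmetric powers of a morphism is multiplicative for convolution. With `u`
the identity it changes the models of the symmetric powers. -/
theorem push_symMul {l m n : ℕ} {h : l + m = n} {S' : SymPow l Y} {T' : SymPow m Y}
    {P' : SymPow n Y} {c : S'.obj ⨯ T'.obj ⟶ P'.obj} (hc : IsSymAdd h S' T' P' c) (hc' : FT c)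
    (u : X ⟶ Y) (hu : FT u) (a : K0Bar (symPow l X).obj) (b : K0Bar (symPow m X).obj) :
    push ((symPow n X).map P' u) (SymPow.ft_map hu) (symMul X h a b) =
      push c hc' (ext (push ((symPow l X).map S' u) (SymPow.ft_map hu) a)
        (push ((symPow m X).map T' u) (SymPow.ft_map hu) b)) := by
  have hS : FT ((symPow l X).map S' u) := SymPow.ft_map hu
  have hT : FT ((symPow m X).map T' u) := SymPow.ft_map hu
  rw [symMul_apply, ← push_comp, ← push_ext _ _ hS hT (hS.prodMap hT), ← push_comp]
  exact push_congr ((isSymAdd_symAdd h X).map hc u).symm _ _ _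

theorem sigma_add {n : ℕ} (S : ∀ l : ℕ, SymPow l X)
    (s : ∀ l : Fin (n + 1), (S l).obj ⨯ (S (n - l)).obj ⟶ (S n).obj)
    (h : ∀ l : Fin (n + 1),
      IsSymAdd (Nat.add_sub_of_le (Nat.le_of_lt_succ l.2)) (S l) (S (n - l)) (S n) (s l))
    (hs : ∀ l, FT (s l)) (a b : K0Bar X) :
    sigma (S n) (a + b) = ∑ l, push (s l) (hs l) (ext (sigma (S l) a) (sigma (S (n - l)) b)) := by
  rw [sigma, sym_add, map_sum]
  exact Finset.sum_congr rfl fun l _ => push_symMul (h l) (hs l) (𝟙 X) (FT.id X) _ _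

/-- The push-forward of series. -/
def symPush (u : X ⟶ Y) (hu : FT u) : (symRing X).Series →* (symRing Y).Series :=
  MonoidHom.mk' (fun s => ⟨fun n => push ((symPow n X).map (symPow n Y) u) (SymPow.ft_map hu)
    (s.coeff n), by
      have h := isIso_map_zero (symPow 0 X) (symPow 0 Y) u
      rw [s.coeff_zero]
      exact (push_cls _ _ (FT.id _) _ (Category.id_comp _) (SymPow.ft_map hu)).trans
        (cls_of_isIso _ _)⟩)
    fun s t => GradedMul.Series.ext (funext fun n => by
      change push _ _ ((symRing X).conv s.coeff t.coeff n) = (symRing Y).conv _ _ n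
      rw [GradedMul.conv_eq, GradedMul.conv_eq, map_sum]
      exact Finset.sum_congr rfl fun l _ =>
        push_symMul (isSymAdd_symAdd _ Y) (ft_symAdd _ Y) u hu _ _)

/-- A single `σ^n` is not additive, but the two total operations are homomorphisms into the group of
series, so comparing them on classes is enough. -/
theorem push_sym (n : ℕ) (u : X ⟶ Y) (hu : FT u) (a : K0Bar X) :
    push ((symPow n X).map (symPow n Y) u) (SymPow.ft_map hu) (sym n a) = sym n (push u hu a) := by
  have h : (symPush u hu).toAdditive.comp (symHomBar X) = (symHomBar Y).comp (push u hu) := by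
    refine hom_ext fun {V} v hv => ?_
    rw [AddMonoidHom.comp_apply, AddMonoidHom.comp_apply, symHomBar_cls,
      push_cls v u hv hu rfl (hv.comp hu), symHomBar_cls]
    refine congrArg Additive.ofMul (GradedMul.Series.ext (funext fun k => ?_))
    exact push_cls _ _ (SymPow.ft_map hv) _ (SymPow.map_comp _ _ _ _ _)
      (SymPow.ft_map (hv.comp hu))
  exact congrArg (fun s : Additive (symRing Y).Series => s.toMul.coeff n) (DFunLike.congr_fun h a)

theorem push_sigma {n : ℕ} (S : SymPow n X) (T : SymPow n Y) (u : X ⟶ Y) (hu : FT u)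
    (hSu : FT (S.map T u)) (a : K0Bar X) :
    push (S.map T u) hSu (sigma S a) = sigma T (push u hu a) := by
  rw [sigma, sigma, ← push_sym, ← push_comp, ← push_comp]
  refine push_congr ?_ _ _ _
  rw [SymPow.map_comp, SymPow.map_comp, Category.id_comp, Category.comp_id]

/-- The motivic theory of completed relative Grothendieck groups. -/
def motivicStructure : MotivicStructure K0Bar where
  pull := pull
  push := push
  one := one
  ext := ext
  sigma := sigma
  pull_id := pull_id
  pull_comp := pull_comp
  push_id := push_id
  push_comp := push_comp
  ext_assoc := ext_assoc
  ext_symm := ext_symm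
  ext_one := ext_one
  sigma_one := sigma_one
  pull_component_bijective := pull_component_bijective
  base_change := base_change
  pull_ext := pull_ext
  push_ext := push_ext
  push_sigma := push_sigma
  sigma_add := sigma_add
  sigma_zero := sigma_zero
  sigma_single := sigma_single
  cut_closed h a := by
    have := h.closed
    refine ⟨pull_push_of_mono _ _ a, pull_push_of_disjoint _ _ _ ?_ a⟩
    rw [h.compl]
    exact disjoint_compl_left
  cut_open h a := by
    have := h.isOpen
    refine ⟨pull_push_of_mono _ _ a, pull_push_of_disjoint _ _ _ ?_ a⟩
    rw [h.compl]
    exact disjoint_compl_right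
  cut_add := cut_add
  sigma_unit := sigma_unit

theorem isGeometric : IsGeometric motivicStructure where
  one := rfl
  pull h hw hp := pull_cls h hw hp
  push v u hv hu := push_cls v u hv hu rfl (hv.comp hu)
  ext := ext_cls
  sigma := sigma_cls

end K0Bar
end Motivic

namespace Motivic

/-! ### The universal property -/

namespace MotivicStructure

variable {R : CSch → Type v} [∀ X, AddCommGroup (R X)] (K : MotivicStructure R) {X Y Z : CSch}

/-- The pull-back of the unit. -/
def unit (X : CSch) : R X := K.pull (toPt X) K.one

theorem pull_congr {u u' : X ⟶ Y} (h : u = u') (a : R Y) : K.pull u a = K.pull u' a := by rw [h]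

theorem push_congr {u u' : X ⟶ Y} (h : u = u') (hu : FT u) (hu' : FT u') (a : R X) :
    K.push u hu a = K.push u' hu' a := by subst h; rfl

theorem pull_unit (u : X ⟶ Y) : K.pull u (K.unit Y) = K.unit X := by
  rw [unit, ← K.pull_comp]
  exact K.pull_congr (ptIsTerminal.hom_ext _ _) _

theorem unit_pt : K.unit pt = K.one :=
  (K.pull_congr (ptIsTerminal.hom_ext _ _) _).trans (K.pull_id _)

theorem push_pull_of_isIso (e : X ⟶ Y) [IsIso e] (he : FT e) (a : R Y) :
    K.push e he (K.pull e a) = a := by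
  have h : IsPullback e e (𝟙 Y) (𝟙 Y) := IsPullback.of_vert_isIso ⟨rfl⟩
  rw [K.base_change h (FT.id Y) he, K.pull_id, K.push_id]

theorem ext_one_eq (a : R X) : K.ext a K.one = K.pull prod.fst a := by
  have h : (prod.fst : X ⨯ pt ⟶ X) ≫ prod.lift (𝟙 X) (toPt X) = 𝟙 _ := by
    rw [← cancel_epi (prod.lift (𝟙 X) (toPt X)), prod.lift_fst_assoc, Category.id_comp,
      Category.comp_id]
  conv_rhs => rw [← K.ext_one a]
  rw [← K.pull_comp, h, K.pull_id]

/-- The unit of `Y` is pulled back from `Spec ℂ`, where the unit axiom applies, and exterior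
products commute with pull-backs. -/
theorem ext_unit (a : R X) : K.ext a (K.unit Y) = K.pull prod.fst a := by
  have h := K.pull_ext (𝟙 X) (toPt Y) a K.one
  rw [K.pull_id, ext_one_eq, ← K.pull_comp] at h
  exact h.symm.trans (K.pull_congr ((prod.map_fst _ _).trans (Category.comp_id _)) a)

theorem unit_ext_unit : K.ext (K.unit X) (K.unit Y) = K.unit (X ⨯ Y) := by
  rw [ext_unit, pull_unit]

/-- The class `v_!(1_V)`. -/
def cls {V : CSch} (v : V ⟶ X) (hv : FT v) : R X := K.push v hv (K.unit V)

/-- The scissor relation is the decomposition of `1_V` along a closed subscheme and its complement,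
pushed forward to `X`; isomorphism invariance follows from base change. -/
theorem isMotivic_cls : K0.IsMotivic (X := X) K.cls where
  iso e v v' hv hv' h := by
    have he : FT e.hom := FT.of_isIso e.hom
    rw [cls, ← K.pull_unit e.hom, K.push_congr h.symm hv (he.comp hv'), K.push_comp _ _ he hv',
      push_pull_of_isIso, cls]
  cut v hv i j h z w hz hw hz' hw' := by
    have hi : FT i := .of_isClosedImmersion h.closed
    have hj : FT j := .of_isOpenImmersion h.isOpen
    rw [cls, K.cut_add h (K.unit _), map_add, ← K.push_comp i v hi hv, ← K.push_comp j v hj hv,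
      pull_unit, pull_unit, K.push_congr hz' _ hz, K.push_congr hw' _ hw, cls, cls]

theorem pull_cls {P V : CSch} {p : P ⟶ X} {q : P ⟶ V} {u : X ⟶ Y} {v : V ⟶ Y}
    (h : IsPullback p q u v) (hv : FT v) (hp : FT p) : K.pull u (K.cls v hv) = K.cls p hp := by
  rw [cls, ← K.base_change h.flip hv hp, pull_unit, cls]

theorem push_cls {V : CSch} (v : V ⟶ X) (u : X ⟶ Y) (hv : FT v) (hu : FT u) :
    K.push u hu (K.cls v hv) = K.cls (v ≫ u) (hv.comp hu) := (K.push_comp _ _ _ _ _).symm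

theorem ext_cls {V W : CSch} (v : V ⟶ X) (w : W ⟶ Y) (hv : FT v) (hw : FT w)
    (hvw : FT (prod.map v w)) : K.ext (K.cls v hv) (K.cls w hw) = K.cls (prod.map v w) hvw := by
  rw [cls, cls, ← K.push_ext v w hv hw hvw, unit_ext_unit, cls]

/-- This combines the compatibility of `σ^n` with push-forward and the axiom `σ^n(1_V) = 1`, which
is used here only. -/
theorem sigma_cls {n : ℕ} {V : CSch} (v : V ⟶ X) (hv : FT v) (S : SymPow n V) (T : SymPow n X)
    (hSv : FT (S.map T v)) : K.sigma T (K.cls v hv) = K.cls (S.map T v) hSv := by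
  rw [cls, ← K.push_sigma S T v hv hSv, unit, K.sigma_unit, cls, unit]

/-- Elements of `R X` are determined by their restrictions to the components, and over a component
the universal property of the uncompleted group applies. -/
theorem isMotivic_cls_bar : K0Bar.IsMotivic (X := X) K.cls where
  congr v w hv hw h := by
    apply (K.pull_component_bijective X).1
    funext c
    have h1 := isPullback_fib (componentι X c) v
    have h2 := isPullback_fib (componentι X c) w
    have hp1 := FT.of_isPullback h1 hv
    have hp2 := FT.of_isPullback h2 hw
    have h3 := congrFun h c
    rw [K0Bar.cls_apply h1 hv hp1, K0Bar.cls_apply h2 hw hp2] at h3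
    have h4 := congrArg (K0.lift K.isMotivic_cls) h3
    rw [K0.lift_cls, K0.lift_cls] at h4
    change K.pull (componentι X c) (K.cls v hv) = K.pull (componentι X c) (K.cls w hw)
    rw [K.pull_cls h1 hv hp1, K.pull_cls h2 hw hp2, h4]
  cut v hv _ _ h hz hw := K.isMotivic_cls.cut v hv h _ _ hz hw rfl rfl

/-- The homomorphism `[V → X] ↦ v_!(1_V)`. -/
def eta (X : CSch) : K0Bar X →+ R X := K.isMotivic_cls_bar.exists_lift.choose

theorem eta_cls {V : CSch} (v : V ⟶ X) (hv : FT v) : K.eta X (K0Bar.cls v hv) = K.cls v hv :=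
  K.isMotivic_cls_bar.exists_lift.choose_spec v hv

theorem eta_sigma_cls {n : ℕ} (T : SymPow n X) {V : CSch} (v : V ⟶ X) (hv : FT v) :
    K.eta T.obj (K0Bar.sigma T (K0Bar.cls v hv)) = K.sigma T (K.eta X (K0Bar.cls v hv)) := by
  have hS : FT ((symPow n V).map T v) := SymPow.ft_map hv
  rw [K0Bar.sigma_cls v hv (symPow n V) T hS, eta_cls, eta_cls,
    K.sigma_cls v hv (symPow n V) T hS]

theorem push_ext_unit {n m : ℕ} (hm : m = 0) (h : n + m = n) {S : SymPow n X} {T : SymPow m X}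
    {c : S.obj ⨯ T.obj ⟶ S.obj} (hc : IsSymAdd h S T S c) (hc' : FT c) (a : R S.obj) :
    K.push c hc' (K.ext a (K.unit T.obj)) = a := by
  subst hm
  have := isIso_fst_of_isIso_toPt S.obj (isIso_toPt_symPow_zero T)
  obtain rfl := hc.zero
  rw [ext_unit, push_pull_of_isIso]

theorem sigma_eq_unit {m : ℕ} (hm : m = 0) (T : SymPow m X) (a : R X) :
    K.sigma T a = K.unit T.obj := by
  subst hm
  exact K.sigma_zero T a

/-- Cancellation for the convolution product. -/
theorem conv_cancel {S : ∀ n : ℕ, SymPow n X}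
    {s : ∀ (n : ℕ) (l : Fin (n + 1)), (S l).obj ⨯ (S (n - l)).obj ⟶ (S n).obj}
    (h : ∀ (n : ℕ) (l : Fin (n + 1)),
      IsSymAdd (Nat.add_sub_of_le (Nat.le_of_lt_succ l.2)) (S l) (S (n - l)) (S n) (s n l))
    (hs : ∀ n l, FT (s n l)) {f g : ∀ n, R (S n).obj} (b : R X)
    (H : ∀ n, ∑ l, K.push (s n l) (hs n l) (K.ext (f l) (K.sigma (S (n - l)) b)) =
      ∑ l, K.push (s n l) (hs n l) (K.ext (g l) (K.sigma (S (n - l)) b))) (n : ℕ) :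
    f n = g n := by
  induction n using Nat.strong_induction_on with
  | _ n ih =>
  have h1 := H n
  rw [Fin.sum_univ_castSucc, Fin.sum_univ_castSucc] at h1
  have h2 : ∀ l : Fin n, f l.castSucc = g l.castSucc := fun l => ih l l.2
  simp only [h2, add_right_inj] at h1
  -- The last summand contains `σ^0(b) = 1`, so it equals `f n`, respectively `g n`; the remaining
  -- summands agree by induction.
  have h3 : K.sigma (S (n - Fin.last n)) b = K.unit _ :=
    K.sigma_eq_unit (Nat.sub_self n) _ _
  rw [h3] at h1
  have h4 := fun a => K.push_ext_unit (Nat.sub_self n) _ (h n (Fin.last n)) (hs n (Fin.last n)) a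
  exact (h4 (f n)).symm.trans (h1.trans (h4 (g n)))

end MotivicStructure

/-- The morphism from the completed Grothendieck groups to a motivic theory. -/
def etaHom (R : MotivicTheory.{v}) :
    (MotivicTheory.mk K0Bar K0Bar.motivicStructure).Hom R where
  app X := R.str.eta X
  pull {X Y} u a := by
    change R.str.eta X (K0Bar.pull u a) = _
    induction a using K0Bar.induction with
    | sub a b ha hb => rw [map_sub, map_sub, map_sub, map_sub, ha, hb]
    | cls v hv =>
    have h := isPullback_fib u v
    have hp := FT.of_isPullback h hv
    rw [K0Bar.pull_cls h hv hp, R.str.eta_cls, R.str.eta_cls, R.str.pull_cls h hv hp]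
  push {X Y} u hu a := by
    change R.str.eta Y (K0Bar.push u hu a) = _
    induction a using K0Bar.induction with
    | sub a b ha hb => rw [map_sub, map_sub, map_sub, map_sub, ha, hb]
    | cls v hv =>
    rw [K0Bar.push_cls v u hv hu rfl (hv.comp hu), R.str.eta_cls, R.str.eta_cls, R.str.push_cls]
  ext_app {X Y} a b := by
    change R.str.eta _ (K0Bar.ext a b) = _
    induction a using K0Bar.induction with
    | sub a b ha hb => simp only [map_sub, AddMonoidHom.sub_apply, ha, hb]
    | cls v hv =>
    induction b using K0Bar.induction with
    | sub a b ha hb => simp only [map_sub, ha, hb]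
    | cls w hw =>
    rw [K0Bar.ext_cls v w hv hw (hv.prodMap hw), R.str.eta_cls, R.str.eta_cls, R.str.eta_cls,
      R.str.ext_cls v w hv hw (hv.prodMap hw)]
  one := by
    change R.str.eta pt (K0Bar.cls (𝟙 pt) (FT.id pt)) = _
    rw [R.str.eta_cls, MotivicStructure.cls, R.str.push_id, R.str.unit_pt]

/-- Compatibility with `σ^n` is known on classes only and does not extend additively. Writing `a +
[w] = [v]`, both `η(σ^n(a))` and `σ^n(η(a))` have the same convolution with the series of `η[w]`,
namely the series of `η[v]`, and that series can be cancelled. -/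
theorem etaHom_isLambda (R : MotivicTheory.{v}) : (etaHom R).IsLambda := by
  intro n X T a
  change R.str.eta T.obj (K0Bar.sigma T a) = R.str.sigma T (R.str.eta X a)
  obtain ⟨V, W, v, w, hv, hw, rfl⟩ := K0Bar.exists_eq_sub a
  set a := K0Bar.cls v hv - K0Bar.cls w hw
  have ha : a + K0Bar.cls w hw = K0Bar.cls v hv := sub_add_cancel _ _
  have key : ∀ m, R.str.eta _ (K0Bar.sigma (symPow m X) a) =
      R.str.sigma (symPow m X) (R.str.eta X a) := by
    let s := fun (n : ℕ) (l : Fin (n + 1)) =>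
      symAdd (Nat.add_sub_of_le (Nat.le_of_lt_succ l.2)) X
    have hs : ∀ n l, IsSymAdd (Nat.add_sub_of_le (Nat.le_of_lt_succ l.2)) _ _ _ (s n l) :=
      fun n l => isSymAdd_symAdd _ X
    have hs' : ∀ n l, FT (s n l) := fun n l => ft_symAdd _ X
    refine R.str.conv_cancel (S := fun m => symPow m X) hs hs' (R.str.eta X (K0Bar.cls w hw))
      fun k => ?_
    have h1 := R.str.sigma_add (fun m => symPow m X) (s k) (hs k) (hs' k) (R.str.eta X a)
      (R.str.eta X (K0Bar.cls w hw))
    have h2 := congrArg (R.str.eta _)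
      (K0Bar.sigma_add (fun m => symPow m X) (s k) (hs k) (hs' k) a (K0Bar.cls w hw))
    rw [ha, R.str.eta_sigma_cls, map_sum] at h2
    rw [← map_add, ha] at h1
    rw [← h1, h2]
    refine Finset.sum_congr rfl fun l _ => ?_
    rw [← R.str.eta_sigma_cls]
    exact (((etaHom R).push _ _ _).trans (congrArg _ ((etaHom R).ext_app _ _))).symm
  -- An arbitrary model `T` is reached from the chosen one by push-forward along the comparison
  -- isomorphism.
  have hT : FT ((symPow n X).map T (𝟙 X)) := SymPow.ft_map (FT.id X)
  have h1 := K0Bar.push_sigma (symPow n X) T (𝟙 X) (FT.id X) hT a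
  have h2 := R.str.push_sigma (symPow n X) T (𝟙 X) (FT.id X) hT (R.str.eta X a)
  rw [K0Bar.push_id] at h1
  rw [R.str.push_id, ← key] at h2
  rw [← h1, ← h2]
  exact (etaHom R).push _ _ _

/-- Each class is the push-forward along `v` of a pull-back of the unit, and a morphism commutes
with all three; classes determine homomorphisms out of the completed group. -/
theorem eq_etaHom (R : MotivicTheory.{v})
    (η : (MotivicTheory.mk K0Bar K0Bar.motivicStructure).Hom R) : η = etaHom R := by
  refine MotivicTheory.Hom.ext (funext fun X => K0Bar.hom_ext fun {V} v hv => ?_)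
  change _ = R.str.eta X (K0Bar.cls v hv)
  rw [R.str.eta_cls, MotivicStructure.cls, MotivicStructure.unit, ← η.one, ← η.pull, ← η.push]
  congr 1
  change _ = K0Bar.push v hv (K0Bar.pull (toPt V) K0Bar.one)
  rw [K0Bar.pull_toPt_one, K0Bar.push_cls _ v (FT.id V) hv (Category.id_comp v) hv]

end Motivic
end

theorem mainTheorem6 :
    (∀ (n : ℕ) (X : Motivic.CSch), Nonempty (Motivic.SymPow n X)) ∧
    ∃ K : Motivic.MotivicStructure Motivic.K0Bar,
      Motivic.IsGeometric K ∧
      Nonempty (IsInitial (Motivic.MotivicTheory.mk Motivic.K0Bar K)) ∧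
      ∀ R : Motivic.MotivicTheory.{v},
        ∃ η : (Motivic.MotivicTheory.mk Motivic.K0Bar K).Hom R,
          η.IsLambda ∧ ∀ η' : (Motivic.MotivicTheory.mk Motivic.K0Bar K).Hom R, η' = η := by
  refine ⟨fun n X => ⟨Motivic.symPow n X⟩, Motivic.K0Bar.motivicStructure,
    Motivic.K0Bar.isGeometric, ⟨IsInitial.ofUniqueHom Motivic.etaHom Motivic.eq_etaHom⟩,
    fun R => ⟨Motivic.etaHom R, Motivic.etaHom_isLambda R, Motivic.eq_etaHom R⟩⟩
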